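/- **Setting.** Let $D_\theta=\partial_\theta-i\bar\theta\partial_t$, $\bar D_\theta=-\partial_{\bar\theta}+i\theta\partial_t$, $D_\eta=\partial_\eta-i\bar\eta\partial_t$, $\bar D_\eta=-\partial_{\bar\eta}+i\eta\partial_t$ be the covariant derivatives on the superspace $(t;\theta,\bar\theta,\eta,\bar\eta)$, let $\epsilon^{12}=-\epsilon^{21}=-1$ and $\epsilon_{12}=-\epsilon_{21}=1$, and let $\int d\theta=\partial_\theta$, etc., $\int d\theta\,d\bar\theta\,d\eta\,d\bar\eta=\partial_\theta\partial_{\bar\theta}\partial_\eta\partial_{\bar\eta}$. Let $v^m_a,w^\mu_\alpha$ ($m,\mu=1,2$; $a=1,\dots,n$; $\alpha=1,\dots,m^*$) be complex bosonic and $\psi^m_a,\chi^\mu_\alpha$ fermionic (Grassmann odd) functions of $t$, let $V^m_a=v^m_a+\sqrt2\,\theta\psi^m_a-i\theta\bar\theta\dot v^m_a$, $W^\mu_\alpha=w^\mu_\alpha+\sqrt2\,\theta\chi^\mu_\alpha-i\theta\bar\theta\dot w^\mu_\alpha$, and let $$\mathcal V^m_a=V^m_a+\eta\,\epsilon^{mn}\bar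 D_\theta\bar V^{\bar n}_a-i\eta\bar\eta\,\dot V^m_a,\qquad \mathcal W^\mu_\alpha=W^\mu_\alpha+\bar\eta\,\epsilon^{\mu\nu}\bar D_\theta\bar W^{\bar\nu}_\alpha+i\eta\bar\eta\,\dot W^\mu_\alpha$$ be the ordinary and the mirror $(\mathbf 4,\mathbf 4,\mathbf 0)$ superfields. The bi-HKT model with prepotential $\mathcal L$ has the action $S=\frac14\int dt\,d\theta\,d\bar\theta\,d\eta\,d\bar\eta\;\mathcal L(\mathcal V,\bar{\mathcal V},\mathcal W,\bar{\mathcal W})$; its metric is block diagonal with the blocks $h^{ab}_{m\bar n}=\Delta^{ab}_{m\bar n}\mathcal L$ and $h^{\alpha\beta}_{\mu\bar\nu}=-\Delta^{\alpha\beta}_{\mu\bar\nu}\mathcal L$, where $\Delta^{ab}_{m\bar n}=\partial^a_m\bar\partial^b_{\bar n}+\epsilon_{mk}\epsilon_{\bar n\bar l}\bar\partial^a_{\bar k}\partial^b_l$, and likewise for $\Delta^{\alpha\beta}_{\mu\bar\nu}$. Put $$\mathcal Z^a=\mathcal V^1_a,\quad \Xi^a=\bar{\mathcal V}^2_a,\quad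 \mathcal U^\alpha=\mathcal W^1_\alpha,\quad \Sigma^\alpha=\bar{\mathcal W}^2_\alpha,$$ and let $z^a=v^1_a$, $\xi^a=\bar v^2_a$, $u^\alpha=w^1_\alpha$, $\sigma^\alpha=\bar w^2_\alpha$ be their lowest components. **Theorem 2.** Let $\mathcal K(z,\bar z,u,\bar u)$ be a smooth real function of $(z,u)$ in an open set $\Omega\subseteq\mathbb C^{n}\times\mathbb C^{m^*}$, and let $\mathcal A^{(1)}_a(z,u)$, $\mathcal A^{(2)}_a(z,\bar u)$, $\mathcal B^{(1)}_\alpha(u,z)$, $\mathcal B^{(2)}_\alpha(u,\bar z)$ be holomorphic functions of the displayed arguments. Consider the bi-HKT model with the prepotential $$\mathcal L=\mathcal K(\mathcal Z,\bar{\mathcal Z},\mathcal U,\bar{\mathcal U})+\Big\{\big[\mathcal A^{(1)}_a(\mathcal Z,\mathcal U)+\mathcal A^{(2)}_a(\mathcal Z,\bar{\mathcal U})\big]\Xi^a-\big[\mathcal B^{(1)}_\alpha(\mathcal U,\mathcal Z)+\mathcal B^{(2)}_\alpha(\mathcal U,\bar{\mathcal Z})\big]\Sigma^\alpha+\text{c.c.}\Big\}.$$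 1. The model is reducible with respect to the coordinates $\xi^a,\sigma^\alpha$: its metric does not depend on them and, up to a total time derivative, its Lagrangian (including the fermions) is a first-order Lagrangian in which $\xi^a,\sigma^\alpha$ enter only through $\dot\xi^a,\dot\sigma^\alpha$ and whose bosonic part is $h^{ab}_{m\bar n}\dot v^m_a\dot{\bar v}^{\bar n}_b+h^{\alpha\beta}_{\mu\bar\nu}\dot w^\mu_\alpha\dot{\bar w}^{\bar\nu}_\beta$. 2. Hamiltonian reduction with respect to $\xi^a,\sigma^\alpha$ (setting their conjugate momenta to zero and forgetting the coordinates) gives the quasicomplex bi-Kähler model $$\begin{aligned}\tilde S=\;&\tfrac14\int dt\,d\theta\,d\bar\theta\,d\eta\,d\bar\eta\;\mathcal K(\mathcal Z,\bar{\mathcal Z},\mathcal U,\bar{\mathcal U})\\&+\Big\{-\tfrac i4\Big[\int dt\,d\theta\,d\eta\,d\bar\eta\;\mathcal A^{(1)}_a(\mathcal Z,\mathcal U)D_\eta\mathcal Z^a-\int dt\,d\theta\,d\bar\theta\,d\eta\;\mathcal A^{(2)}_a(\mathcal Z,\bar{\mathcal U})D_\theta\mathcal Z^a\Big]\\&\quad+\tfrac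 i4\Big[\int dt\,d\theta\,d\eta\,d\bar\eta\;\mathcal B^{(1)}_\alpha(\mathcal U,\mathcal Z)\bar D_\eta\mathcal U^\alpha-\int dt\,d\theta\,d\bar\theta\,d\bar\eta\;\mathcal B^{(2)}_\alpha(\mathcal U,\bar{\mathcal Z})D_\theta\mathcal U^\alpha\Big]+\text{c.c.}\Big\}\end{aligned}$$ of the $(\mathbf 2,\mathbf 4,\mathbf 2)$ superfields $$\mathcal Z^a=Z^a+\sqrt2\,\eta\,\Phi^a-i\eta\bar\eta\,\dot Z^a,\qquad \mathcal U^\alpha=U^\alpha-\sqrt2\,\bar\eta\,\Psi^\alpha+i\eta\bar\eta\,\dot U^\alpha,$$ where $Z^a=z^a+\sqrt2\,\theta\phi^a-i\theta\bar\theta\dot z^a$, $\Phi^a=\varphi^a+\sqrt2\,\theta A^a-i\theta\bar\theta\dot\varphi^a$, $U^\alpha=u^\alpha+\sqrt2\,\theta\rho^\alpha-i\theta\bar\theta\dot u^\alpha$, $\Psi^\alpha=\varrho^\alpha+\sqrt2\,\theta B^\alpha-i\theta\bar\theta\dot\varrho^\alpha$; these are chiral, $\bar D_\theta\mathcal Z^a=\bar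 D_\eta\mathcal Z^a=0$, and twisted chiral, $\bar D_\theta\mathcal U^\alpha=D_\eta\mathcal U^\alpha=0$. Precisely, the Lagrangian of the bi-HKT model, including the fermions, coincides up to a total time derivative with that of $\tilde S$ under the identification $$A^a=\dot\xi^a,\quad B^\alpha=\dot\sigma^\alpha,\quad \phi^a=\psi^1_a,\quad \varphi^a=-i\bar\psi^2_a,\quad \rho^\alpha=\chi^1_\alpha,\quad \varrho^\alpha=-i\bar\chi^2_\alpha,$$ so that the time derivatives of the reduced coordinates become the auxiliary fields; and the Hamiltonian of the bi-HKT model at vanishing momenta conjugate to $\xi^a,\sigma^\alpha$ is the Hamiltonian of $\tilde S$ with the auxiliary fields $A^a,B^\alpha$ eliminated by their equations of motion. -/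

import Mathlib

open scoped ContDiff

namespace BiHKT

noncomputable section

/-! ### The complex Grassmann algebra on `K` real generators

An element is the family of its coefficients in the monomial basis
`e_S = e_{i₁} ⋯ e_{iₖ}`, `S = {i₁ < ⋯ < iₖ}`. -/

/-- The Grassmann algebra over `ℂ` on generators `e_0, …, e_{K-1}`. -/
def Gr (K : ℕ) : Type := Finset (Fin K) → ℂ

namespace Gr

variable {K : ℕ}

instance : NormedAddCommGroup (Gr K) :=
  inferInstanceAs (NormedAddCommGroup (Finset (Fin K) → ℂ))

instance : NormedSpace ℂ (Gr K) :=
  inferInstanceAs (NormedSpace ℂ (Finset (Fin K) → ℂ))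

/-- The number of inversions of the pair `(S, T)`. -/
def inv (S T : Finset (Fin K)) : ℕ := ((S ×ˢ T).filter fun p => p.2 < p.1).card

/-- The sign in `e_S e_T = sgn S T e_{S ∪ T}`, for disjoint `S`, `T`. -/
def sgn (S T : Finset (Fin K)) : ℂ := (-1) ^ inv S T

instance : Mul (Gr K) :=
  ⟨fun f g U => ∑ S ∈ U.powerset, sgn S (U \ S) * f S * g (U \ S)⟩

instance : One (Gr K) := ⟨fun U => if U = ∅ then 1 else 0⟩

theorem mul_apply (f g : Gr K) (U : Finset (Fin K)) :
    (f * g) U = ∑ S ∈ U.powerset, sgn S (U \ S) * f S * g (U \ S) := rfl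

theorem one_apply (U : Finset (Fin K)) : (1 : Gr K) U = if U = ∅ then 1 else 0 := rfl

theorem add_apply (f g : Gr K) (U : Finset (Fin K)) : (f + g) U = f U + g U := rfl

theorem zero_apply (U : Finset (Fin K)) : (0 : Gr K) U = 0 := rfl

theorem smul_apply (c : ℂ) (f : Gr K) (U : Finset (Fin K)) : (c • f) U = c * f U := rfl

theorem sgn_union_left {S T U : Finset (Fin K)} (h : Disjoint S T) :
    sgn (S ∪ T) U = sgn S U * sgn T U := by
  unfold sgn inv
  rw [← pow_add, Finset.union_product, Finset.filter_union, Finset.card_union_of_disjoint]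
  exact Finset.disjoint_filter_filter (Finset.disjoint_product.2 (Or.inl h))

theorem sgn_union_right {S T U : Finset (Fin K)} (h : Disjoint S T) :
    sgn U (S ∪ T) = sgn U S * sgn U T := by
  unfold sgn inv
  rw [← pow_add, Finset.product_union, Finset.filter_union, Finset.card_union_of_disjoint]
  exact Finset.disjoint_filter_filter (Finset.disjoint_product.2 (Or.inr h))

theorem sgn_empty_left (U : Finset (Fin K)) : sgn ∅ U = 1 := by simp [sgn, inv]

theorem sgn_empty_right (U : Finset (Fin K)) : sgn U ∅ = 1 := by simp [sgn, inv]

theorem gr_mul_assoc (f g h : Gr K) : f * g * h = f * (g * h) := by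
  funext U
  simp only [mul_apply, Finset.mul_sum, Finset.sum_mul]
  rw [Finset.sum_sigma', Finset.sum_sigma']
  refine Finset.sum_bij' (fun p _ => ⟨p.2, p.1 \ p.2⟩) (fun p _ => ⟨p.1 ∪ p.2, p.1⟩) ?_ ?_ ?_ ?_ ?_
  · rintro ⟨S, T⟩ h
    simp only [Finset.mem_sigma, Finset.mem_powerset] at h ⊢
    exact ⟨h.2.trans h.1, Finset.sdiff_subset_sdiff h.1 le_rfl⟩
  · rintro ⟨T, R⟩ h
    simp only [Finset.mem_sigma, Finset.mem_powerset] at h ⊢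
    exact ⟨Finset.union_subset h.1 (h.2.trans Finset.sdiff_subset), Finset.subset_union_left⟩
  · rintro ⟨S, T⟩ h
    simp only [Finset.mem_sigma, Finset.mem_powerset] at h
    simp [Finset.union_sdiff_of_subset h.2]
  · rintro ⟨T, R⟩ h
    simp only [Finset.mem_sigma, Finset.mem_powerset] at h
    have hd : Disjoint T R := (Finset.disjoint_sdiff).mono_right h.2
    simp [Finset.union_sdiff_cancel_left hd]
  · rintro ⟨S, T⟩ h
    simp only [Finset.mem_sigma, Finset.mem_powerset] at h
    obtain ⟨hS, hT⟩ := h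
    have e1 : (U \ T) \ (S \ T) = U \ S := by
      ext x
      simp only [Finset.mem_sdiff]
      constructor
      · rintro ⟨⟨a, b⟩, c⟩
        exact ⟨a, fun d => c ⟨d, b⟩⟩
      · rintro ⟨a, b⟩
        exact ⟨⟨a, fun d => b (hT d)⟩, fun d => b d.1⟩
    have e2 : U \ T = (S \ T) ∪ (U \ S) := by
      ext x
      simp only [Finset.mem_sdiff, Finset.mem_union]
      constructor
      · rintro ⟨a, b⟩
        by_cases c : x ∈ S
        · exact Or.inl ⟨c, b⟩
        · exact Or.inr ⟨a, c⟩
      · rintro (⟨a, b⟩ | ⟨a, b⟩)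
        · exact ⟨hS a, b⟩
        · exact ⟨a, fun d => b (hT d)⟩
    have d2 : Disjoint (S \ T) (U \ S) :=
      (Finset.disjoint_sdiff (s := S) (t := U)).mono_left Finset.sdiff_subset
    have e3 : sgn S (U \ S) = sgn T (U \ S) * sgn (S \ T) (U \ S) := by
      rw [← sgn_union_left Finset.disjoint_sdiff, Finset.union_sdiff_of_subset hT]
    have e4 : sgn T (U \ T) = sgn T (S \ T) * sgn T (U \ S) := by
      rw [e2, sgn_union_right d2]
    simp only [e1]
    rw [e3, e4]
    ring

theorem gr_one_mul (f : Gr K) : 1 * f = f := by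
  funext U
  rw [mul_apply, Finset.sum_eq_single ∅]
  · simp [one_apply, sgn_empty_left]
  · intro S _ hS
    simp [one_apply, hS]
  · intro h
    simp at h

theorem gr_mul_one (f : Gr K) : f * 1 = f := by
  funext U
  rw [mul_apply, Finset.sum_eq_single U]
  · simp [one_apply, sgn_empty_right]
  · intro S hS hne
    have : U \ S ≠ ∅ := fun h =>
      hne (Finset.Subset.antisymm (Finset.mem_powerset.1 hS) (Finset.sdiff_eq_empty_iff_subset.1 h))
    simp [one_apply, this]
  · intro h
    simp at h

instance : Ring (Gr K) :=
  { (inferInstance : AddCommGroup (Gr K)) with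
    mul := (· * ·)
    one := 1
    mul_assoc := gr_mul_assoc
    one_mul := gr_one_mul
    mul_one := gr_mul_one
    left_distrib := by
      intro f g h
      funext U
      change (f * (g + h)) U = (f * g) U + (f * h) U
      simp only [mul_apply, add_apply, mul_add, Finset.sum_add_distrib]
    right_distrib := by
      intro f g h
      funext U
      change ((f + g) * h) U = (f * h) U + (g * h) U
      simp only [mul_apply, add_apply, mul_add, add_mul, Finset.sum_add_distrib]
    zero_mul := by
      intro f
      funext U
      change (0 * f) U = 0
      simp [mul_apply, zero_apply]
    mul_zero := by
      intro f
      funext U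
      change (f * 0) U = 0
      simp [mul_apply, zero_apply] }

/-- The generator `e_i`. -/
def gen (i : Fin K) : Gr K := fun U => if U = {i} then 1 else 0

/-- The left derivative with respect to the generator `e_i`. -/
def pd (i : Fin K) (f : Gr K) : Gr K :=
  fun S => if i ∈ S then 0 else sgn {i} S * f (insert i S)

/-- Complex conjugation: antilinear, `conj (f * g) = conj g * conj f`, generators are real. -/
def conj (f : Gr K) : Gr K :=
  fun S => (-1) ^ (S.card * (S.card - 1) / 2) * starRingEnd ℂ (f S)

/-- The numerical part of an element. -/
def body (f : Gr K) : ℂ := f ∅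

end Gr

/-! ### Superspace

The first four generators of `Gr (4 + N)` make up the odd coordinates `θ, θ̄, η, η̄`; the other `N`
generators are the odd constants in which the component fields take their values. -/

section Superspace

variable {N : ℕ}

/-- The real generators `τ_0, …, τ_3` out of which `θ` and `η` are built. -/
def tau (N : ℕ) (k : Fin 4) : Gr (4 + N) := Gr.gen (Fin.castAdd N k)

def theta (N : ℕ) : Gr (4 + N) := tau N 0 + Complex.I • tau N 1
def thetaBar (N : ℕ) : Gr (4 + N) := tau N 0 - Complex.I • tau N 1
def eta (N : ℕ) : Gr (4 + N) := tau N 2 + Complex.I • tau N 3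
def etaBar (N : ℕ) : Gr (4 + N) := tau N 2 - Complex.I • tau N 3

/-- Left derivative with respect to `τ_k`. -/
def pdTau (k : Fin 4) (f : Gr (4 + N)) : Gr (4 + N) := Gr.pd (Fin.castAdd N k) f

/-- `∂/∂θ`, which is also the Berezin integral `∫ dθ`; likewise for the three maps below. -/
def dTheta (f : Gr (4 + N)) : Gr (4 + N) := (1 / 2 : ℂ) • (pdTau 0 f - Complex.I • pdTau 1 f)
def dThetaBar (f : Gr (4 + N)) : Gr (4 + N) := (1 / 2 : ℂ) • (pdTau 0 f + Complex.I • pdTau 1 f)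
def dEta (f : Gr (4 + N)) : Gr (4 + N) := (1 / 2 : ℂ) • (pdTau 2 f - Complex.I • pdTau 3 f)
def dEtaBar (f : Gr (4 + N)) : Gr (4 + N) := (1 / 2 : ℂ) • (pdTau 2 f + Complex.I • pdTau 3 f)

/-- Restriction to `θ = θ̄ = η = η̄ = 0`. -/
def atZero (f : Gr (4 + N)) : Gr (4 + N) :=
  fun S => if ∃ k : Fin 4, Fin.castAdd N k ∈ S then 0 else f S

/-- Even elements that do not involve `θ, θ̄, η, η̄`: the values of bosonic component fields. -/
def Ev (N : ℕ) : Submodule ℂ (Gr (4 + N)) where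
  carrier := {f | ∀ S, (¬ Even S.card ∨ ∃ k : Fin 4, Fin.castAdd N k ∈ S) → f S = 0}
  add_mem' := by
    intro f g hf hg S hS
    rw [Gr.add_apply, hf S hS, hg S hS, add_zero]
  zero_mem' := fun S _ => rfl
  smul_mem' := by
    intro c f hf S hS
    rw [Gr.smul_apply, hf S hS, mul_zero]

/-- Odd elements that do not involve `θ, θ̄, η, η̄`: the values of fermionic component fields. -/
def Od (N : ℕ) : Submodule ℂ (Gr (4 + N)) where
  carrier := {f | ∀ S, (¬ Odd S.card ∨ ∃ k : Fin 4, Fin.castAdd N k ∈ S) → f S = 0}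
  add_mem' := by
    intro f g hf hg S hS
    rw [Gr.add_apply, hf S hS, hg S hS, add_zero]
  zero_mem' := fun S _ => rfl
  smul_mem' := by
    intro c f hf S hS
    rw [Gr.smul_apply, hf S hS, mul_zero]

def conjEv (f : Ev N) : Ev N :=
  ⟨Gr.conj f.1, fun S hS => by simp [Gr.conj, f.2 S hS]⟩

def conjOd (f : Od N) : Od N :=
  ⟨Gr.conj f.1, fun S hS => by simp [Gr.conj, f.2 S hS]⟩

/-- A superfield: a function of time with values in the Grassmann algebra of the odd coordinates
and the odd constants. -/
abbrev SField (N : ℕ) : Type := ℝ → Gr (4 + N)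

/-- `D_θ = ∂_θ - i θ̄ ∂_t`. -/
def DTheta (X : SField N) : SField N :=
  fun t => dTheta (X t) - Complex.I • (thetaBar N * deriv X t)
/-- `D̄_θ = -∂_θ̄ + i θ ∂_t`. -/
def DThetaBar (X : SField N) : SField N :=
  fun t => -dThetaBar (X t) + Complex.I • (theta N * deriv X t)
/-- `D_η = ∂_η - i η̄ ∂_t`. -/
def DEta (X : SField N) : SField N :=
  fun t => dEta (X t) - Complex.I • (etaBar N * deriv X t)
/-- `D̄_η = -∂_η̄ + i η ∂_t`. -/
def DEtaBar (X : SField N) : SField N :=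
  fun t => -dEtaBar (X t) + Complex.I • (eta N * deriv X t)

/-- `∫ dθ dθ̄ dη dη̄`. -/
def intFull (f : Gr (4 + N)) : Gr (4 + N) := dTheta (dThetaBar (dEta (dEtaBar f)))

/-- `∫ dθ dη dη̄`. It is applied to superfields annihilated by `D̄_θ`, for which the terms with `θ̄`
that remain after the integration are total time derivatives; they are dropped. The two integrals
below are treated in the same way. -/
def intThetaEtaEtaBar (f : Gr (4 + N)) : Gr (4 + N) := atZero (dTheta (dEta (dEtaBar f)))
/-- `∫ dθ dθ̄ dη`. -/
def intThetaThetaBarEta (f : Gr (4 + N)) : Gr (4 + N) := atZero (dTheta (dThetaBar (dEta f)))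
/-- `∫ dθ dθ̄ dη̄`. -/
def intThetaThetaBarEtaBar (f : Gr (4 + N)) : Gr (4 + N) := atZero (dTheta (dThetaBar (dEtaBar f)))

end Superspace

/-! ### Functions of superfields -/

section SuperEval

variable {K : ℕ} {J : Type} [Fintype J] [DecidableEq J]

/-- The real basis `e_j, i e_j` of `ℂ^J`. -/
def realDir (c : J × Fin 2) : J → ℂ := Pi.single c.1 (if c.2 = 0 then 1 else Complex.I)

/-- The nilpotent parts of the real and the imaginary part of `X j`. -/
def soulCoord (X : J → Gr K) (c : J × Fin 2) : Gr K :=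
  let s : Gr K := X c.1 - Gr.body (X c.1) • (1 : Gr K)
  if c.2 = 0 then (1 / 2 : ℂ) • (s + Gr.conj s) else (-Complex.I / 2) • (s - Gr.conj s)

/-- The value `f(X, X̄)` of a smooth function `f` on `ℂ^J` at even elements `X j`: the Taylor
expansion about the bodies in the nilpotent parts, which terminates. -/
def superEval (f : (J → ℂ) → ℂ) (X : J → Gr K) : Gr K :=
  ∑ k ∈ Finset.range (K + 1), ((k.factorial : ℂ)⁻¹) •
    ∑ c : Fin k → J × Fin 2,
      iteratedFDeriv ℝ k f (fun j => Gr.body (X j)) (fun l => realDir (c l)) •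
        (List.ofFn fun l => soulCoord X (c l)).prod

/-- `∂f/∂z^j`. -/
def wd (j : J) (f : (J → ℂ) → ℂ) (x : J → ℂ) : ℂ :=
  (fderiv ℝ f x (Pi.single j 1) - Complex.I * fderiv ℝ f x (Pi.single j Complex.I)) / 2

/-- `∂f/∂z̄^j`. -/
def wdBar (j : J) (f : (J → ℂ) → ℂ) (x : J → ℂ) : ℂ :=
  (fderiv ℝ f x (Pi.single j 1) + Complex.I * fderiv ℝ f x (Pi.single j Complex.I)) / 2

end SuperEval

/-! ### Lagrangians, total derivatives, Hamiltonian reduction -/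

section Mechanics

variable {X X' A Y : Type}
  [NormedAddCommGroup X] [NormedSpace ℝ X] [NormedAddCommGroup X'] [NormedSpace ℝ X']
  [NormedAddCommGroup A] [NormedSpace ℝ A] [NormedAddCommGroup Y] [NormedSpace ℝ Y]

/-- Two Lagrangians on the trajectories in `adm` differ by the total time derivative of a local
expression, that is, of a function of finitely many time derivatives of the trajectory. -/
def EquivLagr (adm : Set (ℝ → X)) (L L' : (ℝ → X) → ℝ → Y) : Prop :=
  ∃ (k : ℕ) (G : (Fin (k + 1) → X) → Y), ∀ F ∈ adm, ∀ t : ℝ,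
    HasDerivAt (fun s => G fun i => iteratedDeriv i F s) (L F t - L' F t) t

/-- The pairing `p · δ` of the canonical momentum `p = ∂ℓ/∂ẋ` at `(x, ẋ)` with a velocity `δ`. -/
def momentum (ℓ : X → X → Y) (x v δ : X) : Y := lineDeriv ℝ (ℓ x) v δ

/-- The phase-space point `(x, p)` is in the image of the Legendre map of `ℓ`, and the value of the
Hamiltonian `p · ẋ - ℓ` at it is `E`. -/
def HamiltonianAt (ℓ : X → X → Y) (x : X) (p : X → Y) (E : Y) : Prop :=
  ∃ v : X, (∀ δ, p δ = momentum ℓ x v δ) ∧ E = p v - ℓ x v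

/-- Hamiltonian reduction with respect to the coordinates along the fibres of `π : X → X'`: the
momenta conjugate to these coordinates are set to zero, which means that `p` is the pull-back of a
momentum `p'` on `X'`, and the coordinates are forgotten. -/
def ReducedHamiltonianAt (π : X → X') (ℓ : X → X → Y) (x' : X') (p' : X' → Y) (E : Y) : Prop :=
  ∃ (x : X) (p : X → Y), π x = x' ∧ (∀ δ, p δ = p' (π δ)) ∧ HamiltonianAt ℓ x p E

/-- The Hamiltonian of a Lagrangian `ℓ x' a ẋ'` with auxiliary variables `a`, which are eliminated
by their equations of motion `∂ℓ/∂a = 0`. -/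
def AuxHamiltonianAt (ℓ : X' → A → X' → Y) (x' : X') (p' : X' → Y) (E : Y) : Prop :=
  ∃ a : A, (∃ v : X', (∀ α, lineDeriv ℝ (fun b => ℓ x' b v) a α = 0) ∧
    (∀ δ, p' δ = momentum (fun x => ℓ x a) x' v δ) ∧ E = p' v - ℓ x' a v)

end Mechanics

/-! ### The bi-HKT model -/

section Models

variable {N n m : ℕ}

/-- Flavors: `n` ordinary (`inl`) and `m` mirror (`inr`) multiplets. -/
abbrev Flav (n m : ℕ) : Type := Fin n ⊕ Fin m

/-- Component fields of `n` ordinary and `m` mirror (4,4,0) multiplets at an instant: the bosons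
`v^1_a, v^2_a` and `w^1_α, w^2_α`, and the fermions `ψ^1_a, ψ^2_a` and `χ^1_α, χ^2_α`; the first
index is `0` or `1`. -/
abbrev HKTConf (N n m : ℕ) : Type := (Fin 2 → Flav n m → Ev N) × (Fin 2 → Flav n m → Od N)

/-- The chiral superfield `b + √2 θ f - i θ θ̄ ḃ` in the superspace `(t, θ, θ̄)`. -/
def chiral (b f : SField N) : SField N := fun t =>
  b t + (Real.sqrt 2 : ℂ) • (theta N * f t) - Complex.I • (theta N * thetaBar N * deriv b t)

/-- `ε^{mn}` with `ε^{12} = -1`. -/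
def epsUp : Fin 2 → Fin 2 → ℂ := ![![0, -1], ![1, 0]]

/-- `ε_{mn}` with `ε_{12} = 1`. -/
def epsDn : Fin 2 → Fin 2 → ℂ := ![![0, 1], ![-1, 0]]

/-- The chiral superfields `V^m_a` and `W^μ_α`. -/
def chiralHKT (F : ℝ → HKTConf N n m) (k : Fin 2) (i : Flav n m) : SField N :=
  chiral (fun t => ((F t).1 k i : Gr (4 + N))) (fun t => ((F t).2 k i : Gr (4 + N)))

/-- The (4,4,0) superfields: the ordinary `V^m + η ε^{mn} D̄ V̄^n - i η η̄ V̇^m` and the mirror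
`W^μ + η̄ ε^{μν} D̄ W̄^ν + i η η̄ Ẇ^μ`. -/
def superHKT (F : ℝ → HKTConf N n m) : Fin 2 × Flav n m → SField N
  | (k, .inl a) => fun t =>
      chiralHKT F k (.inl a) t
        + eta N * ∑ l, epsUp k l • DThetaBar (fun s => Gr.conj (chiralHKT F l (.inl a) s)) t
        - Complex.I • (eta N * etaBar N * deriv (chiralHKT F k (.inl a)) t)
  | (k, .inr α) => fun t =>
      chiralHKT F k (.inr α) t
        + etaBar N * ∑ l, epsUp k l • DThetaBar (fun s => Gr.conj (chiralHKT F l (.inr α) s)) t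
        + Complex.I • (eta N * etaBar N * deriv (chiralHKT F k (.inr α)) t)

/-- The Lagrangian `¼ ∫ dθ dθ̄ dη dη̄ 𝓛(V, V̄, W, W̄)` of the bi-HKT model with the
prepotential `𝓛`. -/
def lagrHKT (L : (Fin 2 × Flav n m → ℂ) → ℂ) (F : ℝ → HKTConf N n m) (t : ℝ) : Gr (4 + N) :=
  (1 / 4 : ℂ) • intFull (superEval L fun j => superHKT F j t)

/-- `Δ_{m n̄}^{ij} 𝓛 = ∂^i_m ∂̄^j_n 𝓛 + ε_{mk} ε_{nl} ∂̄^i_k ∂^j_l 𝓛`. -/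
def deltaOp (L : (Fin 2 × Flav n m → ℂ) → ℂ) (k : Fin 2) (i : Flav n m) (l : Fin 2)
    (j : Flav n m) (x : Fin 2 × Flav n m → ℂ) : ℂ :=
  wd (k, i) (wdBar (l, j) L) x +
    ∑ k' : Fin 2, ∑ l' : Fin 2, epsDn k k' * epsDn l l' * wdBar (k', i) (wd (l', j) L) x

/-- The Hermitian metric of the bi-HKT model: `Δ𝓛` in the ordinary sector, `-Δ𝓛` in the mirror
sector, no mixed components. -/
def metricHKT (L : (Fin 2 × Flav n m → ℂ) → ℂ) :
    Fin 2 × Flav n m → Fin 2 × Flav n m → (Fin 2 × Flav n m → ℂ) → ℂ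
  | (k, .inl a), (l, .inl b) => fun x => deltaOp L k (.inl a) l (.inl b) x
  | (k, .inr α), (l, .inr β) => fun x => -deltaOp L k (.inr α) l (.inr β) x
  | (_, .inl _), (_, .inr _) => fun _ => 0
  | (_, .inr _), (_, .inl _) => fun _ => 0

/-! ### The potentials and the quasicomplex bi-Kähler model -/

/-- `(z, u) ↦ (z, ū)`. -/
def conjMirror (q : Flav n m → ℂ) : Flav n m → ℂ
  | .inl a => q (.inl a)
  | .inr α => starRingEnd ℂ (q (.inr α))

/-- `(z, u) ↦ (z̄, u)`. -/
def conjOrdinary (q : Flav n m → ℂ) : Flav n m → ℂ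
  | .inl a => starRingEnd ℂ (q (.inl a))
  | .inr α => q (.inr α)

/-- The potentials, as functions of a point `(z, u)` of `ℂ^n × ℂ^m`; the arguments of `A2` and `B2`
are meant to be `(z, ū)` and `(z̄, u)`. -/
structure Potentials (n m : ℕ) where
  /-- the domain of `(z, u)` -/
  Ω : Set (Flav n m → ℂ)
  K : (Flav n m → ℂ) → ℝ
  A1 : Fin n → (Flav n m → ℂ) → ℂ
  A2 : Fin n → (Flav n m → ℂ) → ℂ
  B1 : Fin m → (Flav n m → ℂ) → ℂ
  B2 : Fin m → (Flav n m → ℂ) → ℂ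

/-- `Ω` is open, `K` is smooth, and `A1(z, u)`, `A2(z, ū)`, `B1(u, z)`, `B2(u, z̄)` are holomorphic (complex analytic)
functions of the displayed arguments. -/
structure Potentials.Regular (P : Potentials n m) : Prop where
  isOpen : IsOpen P.Ω
  smooth_K : ContDiffOn ℝ ∞ P.K P.Ω
  hol_A1 : ∀ a, AnalyticOnNhd ℂ (P.A1 a) P.Ω
  hol_A2 : ∀ a, AnalyticOnNhd ℂ (P.A2 a) {q | conjMirror q ∈ P.Ω}
  hol_B1 : ∀ α, AnalyticOnNhd ℂ (P.B1 α) P.Ω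
  hol_B2 : ∀ α, AnalyticOnNhd ℂ (P.B2 α) {q | conjOrdinary q ∈ P.Ω}

/-- The prepotential
`K + [A1 + A2] ξ + [Ā1 + Ā2] ξ̄ - [B1 + B2] σ - [B̄1 + B̄2] σ̄`
with `z = v^1`, `ξ = v̄^2`, `u = w^1`, `σ = w̄^2`. -/
def Potentials.prepotential (P : Potentials n m) (x : Fin 2 × Flav n m → ℂ) : ℂ :=
  let q : Flav n m → ℂ := fun i => x (0, i)
  let ξ : Fin n → ℂ := fun a => starRingEnd ℂ (x (1, .inl a))
  let σ : Fin m → ℂ := fun α => starRingEnd ℂ (x (1, .inr α))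
  (P.K q : ℂ)
    + ∑ a, (P.A1 a q + P.A2 a (conjMirror q)) * ξ a
    + ∑ a, starRingEnd ℂ (P.A1 a q + P.A2 a (conjMirror q)) * starRingEnd ℂ (ξ a)
    - ∑ α, (P.B1 α q + P.B2 α (conjOrdinary q)) * σ α
    - ∑ α, starRingEnd ℂ (P.B1 α q + P.B2 α (conjOrdinary q)) * starRingEnd ℂ (σ α)

/-- Dynamical component fields of `n` ordinary and `m` mirror (2,4,2) multiplets at an instant: the
bosons `z^a`, `u^α`; the fermions `φ^a`, `ρ^α` (index `0`) and `φ'^a`, `ρ'^α` (index `1`). -/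
abbrev KConf (N n m : ℕ) : Type := (Flav n m → Ev N) × (Fin 2 → Flav n m → Od N)

/-- The auxiliary bosons `A^a`, `B^α`. -/
abbrev KAux (N n m : ℕ) : Type := Flav n m → Ev N

/-- The chiral superfields `Z^a` and `U^α`, `Z = z + √2 θ φ - i θ θ̄ ż`. -/
def chiralZ (Q : ℝ → KConf N n m × KAux N n m) (i : Flav n m) : SField N :=
  chiral (fun t => ((Q t).1.1 i : Gr (4 + N))) (fun t => ((Q t).1.2 0 i : Gr (4 + N)))

/-- The fermionic chiral superfields `Φ^a` and `Ψ^α`, `Φ = φ' + √2 θ A - i θ θ̄ φ̇'`. -/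
def chiralPhi (Q : ℝ → KConf N n m × KAux N n m) (i : Flav n m) : SField N :=
  chiral (fun t => ((Q t).1.2 1 i : Gr (4 + N))) (fun t => ((Q t).2 i : Gr (4 + N)))

/-- The (2,4,2) superfields: the chiral `Z + √2 η Φ - i η η̄ Ż` and the twisted chiral
`U - √2 η̄ Ψ + i η η̄ U̇`. -/
def superK (Q : ℝ → KConf N n m × KAux N n m) : Flav n m → SField N
  | .inl a => fun t =>
      chiralZ Q (.inl a) t + (Real.sqrt 2 : ℂ) • (eta N * chiralPhi Q (.inl a) t)
        - Complex.I • (eta N * etaBar N * deriv (chiralZ Q (.inl a)) t)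
  | .inr α => fun t =>
      chiralZ Q (.inr α) t - (Real.sqrt 2 : ℂ) • (etaBar N * chiralPhi Q (.inr α) t)
        + Complex.I • (eta N * etaBar N * deriv (chiralZ Q (.inr α)) t)

/-- `(𝒵, 𝒰) ↦ (𝒵, 𝒰̄)` and `(𝒵, 𝒰) ↦ (𝒵̄, 𝒰)` for superfields. -/
def superConjMirror (X : Flav n m → Gr (4 + N)) : Flav n m → Gr (4 + N)
  | .inl a => X (.inl a)
  | .inr α => Gr.conj (X (.inr α))
def superConjOrdinary (X : Flav n m → Gr (4 + N)) : Flav n m → Gr (4 + N)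
  | .inl a => Gr.conj (X (.inl a))
  | .inr α => X (.inr α)

/-- `∫ dθ dη dη̄ A1_a(𝒵, 𝒰) D_η 𝒵^a - ∫ dθ dθ̄ dη A2_a(𝒵, 𝒰̄) D_θ 𝒵^a`. -/
def fTermA (P : Potentials n m) (Q : ℝ → KConf N n m × KAux N n m) (t : ℝ) : Gr (4 + N) :=
  let X : Flav n m → Gr (4 + N) := fun i => superK Q i t
  intThetaEtaEtaBar (∑ a, superEval (P.A1 a) X * DEta (superK Q (.inl a)) t)
    - intThetaThetaBarEta
        (∑ a, superEval (P.A2 a) (superConjMirror X) * DTheta (superK Q (.inl a)) t)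

/-- `∫ dθ dη dη̄ B1_α(𝒰, 𝒵) D̄_η 𝒰^α - ∫ dθ dθ̄ dη̄ B2_α(𝒰, 𝒵̄) D_θ 𝒰^α`. -/
def fTermB (P : Potentials n m) (Q : ℝ → KConf N n m × KAux N n m) (t : ℝ) : Gr (4 + N) :=
  let X : Flav n m → Gr (4 + N) := fun i => superK Q i t
  intThetaEtaEtaBar (∑ α, superEval (P.B1 α) X * DEtaBar (superK Q (.inr α)) t)
    - intThetaThetaBarEtaBar
        (∑ α, superEval (P.B2 α) (superConjOrdinary X) * DTheta (superK Q (.inr α)) t)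

/-- The Lagrangian of the quasicomplex bi-Kähler model,
`¼ ∫ dθ dθ̄ dη dη̄ K + {-(i/4) fTermA + (i/4) fTermB + c.c.}`. The factor `i` is inside the complex
conjugation, so that the Lagrangian is real. -/
def lagrK (P : Potentials n m) (Q : ℝ → KConf N n m × KAux N n m) (t : ℝ) : Gr (4 + N) :=
  let f : Gr (4 + N) := (-Complex.I / 4) • fTermA P Q t + (Complex.I / 4) • fTermB P Q t
  (1 / 4 : ℂ) • intFull (superEval (fun q => (P.K q : ℂ)) fun i => superK Q i t) + (f + Gr.conj f)

/-! ### The reduction -/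

/-- Forgetting the coordinates `ξ^a`, `σ^α`. The remaining fields are named
`z = v^1`, `φ = ψ^1`, `φ' = -i ψ̄^2` and `u = w^1`, `ρ = χ^1`, `ρ' = -i χ̄^2`. -/
def reduceConf (x : HKTConf N n m) : KConf N n m :=
  (fun i => x.1 0 i,
    fun k i => if k = 0 then x.2 0 i else (-Complex.I) • conjOd (x.2 1 i))

/-- The coordinates `ξ^a = v̄^2_a`, `σ^α = w̄^2_α` of a configuration. -/
def reducedCoord (x : HKTConf N n m) : KAux N n m := fun i => conjEv (x.1 1 i)

/-- The trajectory of the reduced model: the coordinates `ξ`, `σ` are forgotten, and their time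
derivatives are the auxiliary fields. -/
def reduceTraj (F : ℝ → HKTConf N n m) : ℝ → KConf N n m × KAux N n m :=
  fun t => (reduceConf (F t), reducedCoord (deriv F t))

/-- Values of `(z, u)` whose body lies in the domain of the potentials. -/
def Potentials.InDomain (P : Potentials n m) (q : Flav n m → Ev N) : Prop :=
  (fun i => Gr.body (q i : Gr (4 + N))) ∈ P.Ω

/-- Smooth trajectories of the bi-HKT model. -/
def Potentials.trajHKT (P : Potentials n m) (N : ℕ) : Set (ℝ → HKTConf N n m) :=
  {F | ContDiff ℝ ∞ F ∧ ∀ t, P.InDomain ((F t).1 0)}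

/-- Smooth trajectories of the bi-Kähler model, auxiliary fields included. -/
def Potentials.trajK (P : Potentials n m) (N : ℕ) : Set (ℝ → KConf N n m × KAux N n m) :=
  {Q | ContDiff ℝ ∞ Q ∧ ∀ t, P.InDomain (Q t).1.1}

end Models

end

end BiHKT

set_option linter.unusedSectionVars false
set_option linter.unusedSimpArgs false

/-! ### The Grassmann algebra: parity, supercommutativity, left derivatives, conjugation. -/

namespace BiHKT
namespace Gr

variable {K : ℕ}

/-! The link between the two models is the rotation `η ↦ iη`, `η̄ ↦ -iη̄`, an automorphism `rho`
that preserves the Berezin measure, conjugation and bodies. The superfield `D̄_θ V̄²` has the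
components `√2 ψ̄²` and `2iθ ξ̇`. After the rotation these sit in `𝒵` exactly where a chiral (2,4,2)
superfield has its second fermion and its auxiliary field; the same happens for `𝒰`. So `𝒵` and `𝒰`
are (2,4,2) superfields of the reduced trajectory (`rho_superHKT_zero`), and the `𝒦`-terms of the
two models agree exactly, without any total derivative.

The rest of the prepotential is linear in `Ξ`, `Σ` and their conjugates. In the full integral of a
potential times `Ξ` or `Σ`, one of the four odd derivatives of the measure is completed to the
covariant derivative that annihilates the potential; the completing term is a total time derivative
(`intFull_eq_chiralInt`). The covariant derivative then acts on `Ξ` or `Σ` alone, where the (4,4,0)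
constraints turn it into a covariant derivative of the first half of the multiplet: `D̄_θ Ξ = i D_η
𝒵`, `D̄_η Ξ = -i D_θ 𝒵`, `D̄_θ Σ = i D̄_η 𝒰`, `D_η Σ = -i D_θ 𝒰` (`ann_xiField`). What remains is
the integral over a subspace in the bi-Kähler action. The four kinds of coupling are handled
together through a label `τ`; the outcome is `hasDerivAt_couplingBdry`.

The bi-Kähler Lagrangian still contains accelerations, in the `θθ̄ηη̄` components of the
superfields, and the time derivative of the auxiliary fields. Both occur linearly and are integrated
by parts (`kinetic_eq`, `coupling_eq`). This gives a first-order Lagrangian of `x`, `a`, `ẋ`;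
substituting `a = ξ̇, σ̇` yields the first-order bi-HKT Lagrangian, so independence of `ξ`, `σ`
themselves is immediate. The Hamiltonian statement is then linear algebra: the fibre momenta vanish
exactly when the derivative with respect to `a` does (`reducedHamiltonianAt_iff`).

For the metric, the prepotential is affine in the second coordinates, and each potential is
holomorphic or antiholomorphic in `z` and in `u` separately. Hence `∂_i ∂̄_j` of a potential
vanishes when `i`, `j` lie in the same sector (`wirt_wirt_pot`), and `Δ𝓛` loses its dependence on
`ξ`, `σ`. For the bosonic Lagrangian, the odd-coordinate parts of the superfields are quadratic when
the fermions vanish, so Taylor expansions stop at second order and the coefficients can be compared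
with the metric (`lagrFirstHKT_boson`).

All of this rests on a calculus for functions of even Grassmann variables. The Taylor polynomial is
rewritten recursively in Wirtinger derivatives (`taylorTerm`), from which follow the chain rules for
derivations (`EvenDer.superEval`) and for curves (`hasDerivAt_superEval`). -/

theorem neg_apply (f : Gr K) (U : Finset (Fin K)) : (-f) U = -f U := rfl

theorem sum_apply {ι : Type*} (s : Finset ι) (f : ι → Gr K) (U : Finset (Fin K)) :
    (∑ i ∈ s, f i) U = ∑ i ∈ s, f i U := by
  classical
  induction s using Finset.induction_on with
  | empty => rfl
  | insert a s ha ih => rw [Finset.sum_insert ha, Finset.sum_insert ha, add_apply, ih]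

instance : IsScalarTower ℂ (Gr K) (Gr K) :=
  ⟨fun c f g => by
    funext U
    change (c • f * g) U = (c • (f * g)) U
    simp only [mul_apply, smul_apply, Finset.mul_sum]
    exact Finset.sum_congr rfl fun S _ => by ring⟩

instance : SMulCommClass ℂ (Gr K) (Gr K) :=
  ⟨fun c f g => by
    funext U
    change (c • (f * g)) U = (f * c • g) U
    simp only [mul_apply, smul_apply, Finset.mul_sum]
    exact Finset.sum_congr rfl fun S _ => by ring⟩

/-! ### Parity -/

/-- The parity automorphism. -/
def par (f : Gr K) : Gr K := fun S => (-1) ^ S.card * f S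

/-- Even elements. -/
def IsEven (f : Gr K) : Prop := ∀ S, ¬ Even S.card → f S = 0

/-- Odd elements. -/
def IsOdd (f : Gr K) : Prop := ∀ S, ¬ Odd S.card → f S = 0

theorem par_apply (f : Gr K) (S : Finset (Fin K)) : par f S = (-1) ^ S.card * f S := rfl

theorem par_add (f g : Gr K) : par (f + g) = par f + par g := by
  funext S; simp [par_apply, add_apply, mul_add]

theorem par_smul (c : ℂ) (f : Gr K) : par (c • f) = c • par f := by
  funext S; simp only [par_apply, smul_apply]; ring

theorem par_neg (f : Gr K) : par (-f) = -par f := by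
  funext S; simp [par_apply, neg_apply]

theorem par_sub (f g : Gr K) : par (f - g) = par f - par g := by
  rw [sub_eq_add_neg, par_add, par_neg, ← sub_eq_add_neg]

theorem par_par (f : Gr K) : par (par f) = f := by
  funext S
  rw [par_apply, par_apply, ← mul_assoc, ← pow_add, ← two_mul, pow_mul]
  simp

theorem IsEven.par_eq {f : Gr K} (hf : IsEven f) : par f = f := by
  funext S
  rw [par_apply]
  by_cases h : Even S.card
  · rw [h.neg_one_pow, one_mul]
  · rw [hf S h, mul_zero]

theorem IsOdd.par_eq {f : Gr K} (hf : IsOdd f) : par f = -f := by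
  funext S
  rw [par_apply, neg_apply]
  by_cases h : Odd S.card
  · rw [h.neg_one_pow, neg_one_mul]
  · rw [hf S h, mul_zero, neg_zero]

theorem isEven_iff {f : Gr K} : IsEven f ↔ par f = f := by
  refine ⟨fun h => h.par_eq, fun h S hS => ?_⟩
  have := congrFun h S
  rw [par_apply, (Nat.not_even_iff_odd.1 hS).neg_one_pow, neg_one_mul] at this
  exact CharZero.neg_eq_self_iff.1 this

theorem isOdd_iff {f : Gr K} : IsOdd f ↔ par f = -f := by
  refine ⟨fun h => h.par_eq, fun h S hS => ?_⟩
  have := congrFun h S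
  rw [par_apply, neg_apply, (Nat.not_odd_iff_even.1 hS).neg_one_pow, one_mul] at this
  exact CharZero.eq_neg_self_iff.1 this

theorem card_add_card_sdiff {S U : Finset (Fin K)} (h : S ⊆ U) :
    U.card = S.card + (U \ S).card := by
  rw [Finset.card_sdiff_of_subset h]
  have := Finset.card_le_card h
  omega

theorem par_mul (f g : Gr K) : par (f * g) = par f * par g := by
  funext U
  simp only [par_apply, mul_apply, Finset.mul_sum]
  refine Finset.sum_congr rfl fun S hS => ?_
  rw [card_add_card_sdiff (Finset.mem_powerset.1 hS), pow_add]
  ring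

theorem par_one : par (1 : Gr K) = 1 := by
  funext S
  rw [par_apply, one_apply]
  split_ifs with h <;> simp [h]

theorem isEven_one : IsEven (1 : Gr K) := isEven_iff.2 par_one

theorem IsEven.add {f g : Gr K} (hf : IsEven f) (hg : IsEven g) : IsEven (f + g) := by
  rw [isEven_iff, par_add, hf.par_eq, hg.par_eq]

theorem IsEven.sub {f g : Gr K} (hf : IsEven f) (hg : IsEven g) : IsEven (f - g) := by
  rw [isEven_iff, par_sub, hf.par_eq, hg.par_eq]

theorem IsEven.smul {f : Gr K} (c : ℂ) (hf : IsEven f) : IsEven (c • f) := by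
  rw [isEven_iff, par_smul, hf.par_eq]

theorem IsEven.mul {f g : Gr K} (hf : IsEven f) (hg : IsEven g) : IsEven (f * g) := by
  rw [isEven_iff, par_mul, hf.par_eq, hg.par_eq]

theorem IsEven.sum {ι : Type*} {s : Finset ι} {f : ι → Gr K} (h : ∀ i ∈ s, IsEven (f i)) :
    IsEven (∑ i ∈ s, f i) := fun S hS => by
  rw [sum_apply]
  exact Finset.sum_eq_zero fun i hi => h i hi S hS

/-! ### Supercommutativity -/

theorem sgn_mul_self (S T : Finset (Fin K)) : sgn S T * sgn S T = 1 := by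
  unfold sgn
  rw [← pow_add, ← two_mul, pow_mul]
  simp

/-- Each pair of `S × T` is an inversion in exactly one of the two orders, because disjointness
excludes equal entries. -/
theorem inv_add_inv {S T : Finset (Fin K)} (h : Disjoint S T) :
    inv S T + inv T S = S.card * T.card := by
  have e : inv T S = ((S ×ˢ T).filter fun p => ¬ p.2 < p.1).card := by
    unfold inv
    refine Finset.card_bij' (fun p _ => (p.2, p.1)) (fun p _ => (p.2, p.1)) ?_ ?_ ?_ ?_
    · rintro ⟨a, b⟩ hab
      simp only [Finset.mem_filter, Finset.mem_product] at hab ⊢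
      exact ⟨⟨hab.1.2, hab.1.1⟩, not_lt.2 hab.2.le⟩
    · rintro ⟨a, b⟩ hab
      simp only [Finset.mem_filter, Finset.mem_product] at hab ⊢
      refine ⟨⟨hab.1.2, hab.1.1⟩, lt_of_le_of_ne (not_lt.1 hab.2) ?_⟩
      rintro rfl
      exact Finset.disjoint_left.1 h hab.1.1 hab.1.2
    · rintro ⟨a, b⟩ _; rfl
    · rintro ⟨a, b⟩ _; rfl
  rw [e, inv, Finset.card_filter_add_card_filter_not, Finset.card_product]

theorem sgn_comm {S T : Finset (Fin K)} (h : Disjoint S T) :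
    sgn S T = (-1) ^ (S.card * T.card) * sgn T S := by
  have e : sgn S T * sgn T S = (-1) ^ (S.card * T.card) := by
    rw [← inv_add_inv h, pow_add]; rfl
  rw [← e, mul_assoc, sgn_mul_self, mul_one]

/-- Complementation inside `U` indexes the two products `f * g` and `g * f` by the same subsets, so
commutation rules can be checked term by term. -/
theorem mul_apply_swap (f g : Gr K) (U : Finset (Fin K)) :
    (g * f) U = ∑ S ∈ U.powerset, sgn (U \ S) S * g (U \ S) * f S := by
  rw [mul_apply]
  refine Finset.sum_bij' (fun S _ => U \ S) (fun S _ => U \ S) ?_ ?_ ?_ ?_ ?_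
  · intro S _; exact Finset.mem_powerset.2 Finset.sdiff_subset
  · intro S _; exact Finset.mem_powerset.2 Finset.sdiff_subset
  · intro S hS; exact Finset.sdiff_sdiff_eq_self (Finset.mem_powerset.1 hS)
  · intro S hS; exact Finset.sdiff_sdiff_eq_self (Finset.mem_powerset.1 hS)
  · intro S hS; rw [Finset.sdiff_sdiff_eq_self (Finset.mem_powerset.1 hS)]

theorem IsEven.comm {f : Gr K} (hf : IsEven f) (g : Gr K) : f * g = g * f := by
  funext U
  rw [mul_apply, mul_apply_swap]
  refine Finset.sum_congr rfl fun S _ => ?_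
  by_cases h : Even S.card
  · rw [sgn_comm Finset.disjoint_sdiff, (h.mul_right _).neg_one_pow]
    ring
  · rw [hf S h]; ring

theorem IsEven.comm' {f : Gr K} (hf : IsEven f) (g : Gr K) : g * f = f * g := (hf.comm g).symm

theorem IsOdd.comm {f : Gr K} (hf : IsOdd f) (g : Gr K) : f * g = par g * f := by
  funext U
  rw [mul_apply, mul_apply_swap]
  refine Finset.sum_congr rfl fun S _ => ?_
  by_cases h : Odd S.card
  · rw [sgn_comm Finset.disjoint_sdiff, par_apply, pow_mul, h.neg_one_pow]
    ring
  · rw [hf S h]; ring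

theorem IsOdd.mul_self {f : Gr K} (hf : IsOdd f) : f * f = 0 := by
  have h := hf.comm f
  rw [hf.par_eq, neg_mul] at h
  have h2 : (2 : ℂ) • (f * f) = 0 := by rw [two_smul]; nth_rewrite 1 [h]; simp
  exact (smul_eq_zero.1 h2).resolve_left two_ne_zero

theorem isOdd_gen (i : Fin K) : IsOdd (gen i) := by
  intro S hS
  unfold gen
  split_ifs with h
  · subst h; simp at hS
  · rfl

theorem IsOdd.add {f g : Gr K} (hf : IsOdd f) (hg : IsOdd g) : IsOdd (f + g) := by
  rw [isOdd_iff, par_add, hf.par_eq, hg.par_eq, neg_add]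

theorem IsOdd.smul {f : Gr K} (c : ℂ) (hf : IsOdd f) : IsOdd (c • f) := by
  rw [isOdd_iff, par_smul, hf.par_eq, smul_neg]

theorem IsOdd.sub {f g : Gr K} (hf : IsOdd f) (hg : IsOdd g) : IsOdd (f - g) := by
  rw [isOdd_iff, par_sub, hf.par_eq, hg.par_eq]; abel

/-! ### Left derivatives -/

theorem pd_apply (i : Fin K) (f : Gr K) (S : Finset (Fin K)) :
    pd i f S = if i ∈ S then 0 else sgn {i} S * f (insert i S) := rfl

theorem pd_add (i : Fin K) (f g : Gr K) : pd i (f + g) = pd i f + pd i g := by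
  funext S
  simp only [pd_apply, add_apply]
  split_ifs <;> ring

theorem pd_smul (i : Fin K) (c : ℂ) (f : Gr K) : pd i (c • f) = c • pd i f := by
  funext S
  simp only [pd_apply, smul_apply]
  split_ifs <;> ring

theorem sgn_insert_left {i : Fin K} {S T : Finset (Fin K)} (h : i ∉ S) :
    sgn (insert i S) T = sgn {i} T * sgn S T := by
  rw [Finset.insert_eq, sgn_union_left (Finset.disjoint_singleton_left.2 h)]

theorem sgn_insert_right {i : Fin K} {S T : Finset (Fin K)} (h : i ∉ S) :
    sgn T (insert i S) = sgn T {i} * sgn T S := by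
  rw [Finset.insert_eq, sgn_union_right (Finset.disjoint_singleton_left.2 h)]

theorem sgn_singleton_right {i : Fin K} {S : Finset (Fin K)} (h : i ∉ S) :
    sgn S {i} = (-1) ^ S.card * sgn {i} S := by
  rw [sgn_comm (Finset.disjoint_singleton_right.2 h), Finset.card_singleton, mul_one]

/-- The graded Leibniz rule, by comparing coefficients at `U`. If `i ∉ U`, the subsets of `insert i
U` without and with `i` give the two terms on the right. If `i ∈ U`, the left side vanishes and the
right side cancels in pairs. -/
theorem pd_mul (i : Fin K) (f g : Gr K) : pd i (f * g) = pd i f * g + par f * pd i g := by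
  funext U
  rw [add_apply, mul_apply, mul_apply]
  by_cases hU : i ∈ U
  · obtain ⟨V, hV, rfl⟩ : ∃ V, i ∉ V ∧ insert i V = U :=
      ⟨U.erase i, Finset.notMem_erase i U, Finset.insert_erase hU⟩
    rw [pd_apply, if_pos hU, Finset.sum_powerset_insert hV, Finset.sum_powerset_insert hV]
    have z1 : ∀ S ∈ V.powerset, sgn (insert i S) (insert i V \ insert i S) * pd i f (insert i S) *
        g (insert i V \ insert i S) = 0 := fun S _ => by simp [pd_apply]
    have z2 : ∀ S ∈ V.powerset, sgn S (insert i V \ S) * par f S * pd i g (insert i V \ S) = 0 := by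
      intro S hS
      have : i ∉ S := fun h => hV (Finset.mem_powerset.1 hS h)
      simp [pd_apply, this]
    rw [Finset.sum_eq_zero z1, Finset.sum_eq_zero z2, add_zero, zero_add, ← Finset.sum_add_distrib]
    -- What is left pairs the subset `S` in the first sum with `insert i S` in the second; the two
    -- contributions have opposite signs.
    symm
    refine Finset.sum_eq_zero fun S hS => ?_
    have hS' : i ∉ S := fun h => hV (Finset.mem_powerset.1 hS h)
    have e1 : insert i V \ S = insert i (V \ S) := Finset.insert_sdiff_of_notMem _ hS'
    have e2 : insert i V \ insert i S = V \ S := by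
      rw [Finset.insert_sdiff_insert, Finset.sdiff_insert_of_notMem hV]
    have hVS : i ∉ V \ S := fun h => hV (Finset.mem_sdiff.1 h).1
    rw [e1, e2, pd_apply, if_neg hS', pd_apply, if_neg hVS, par_apply,
      Finset.card_insert_of_notMem hS', sgn_insert_right hVS, sgn_singleton_right hS',
      sgn_insert_left hS', pow_succ]
    have q1 := sgn_mul_self {i} S
    have q2 := sgn_mul_self {i} (V \ S)
    linear_combination ((-1) ^ S.card * sgn S (V \ S) * f (insert i S) * g (insert i (V \ S))) *
      (q1 - q2)
  · rw [pd_apply, if_neg hU, mul_apply, Finset.sum_powerset_insert hU,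
      mul_add, Finset.mul_sum, Finset.mul_sum, add_comm]
    congr 1
    · refine Finset.sum_congr rfl fun S hS => ?_
      have hS' : i ∉ S := fun h => hU (Finset.mem_powerset.1 hS h)
      have e2 : insert i U \ insert i S = U \ S := by
        rw [Finset.insert_sdiff_insert, Finset.sdiff_insert_of_notMem hU]
      have e3 : sgn {i} U = sgn {i} S * sgn {i} (U \ S) := by
        rw [← sgn_union_right Finset.disjoint_sdiff,
          Finset.union_sdiff_of_subset (Finset.mem_powerset.1 hS)]
      rw [e2, pd_apply, if_neg hS', sgn_insert_left hS', e3]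
      have q2 := sgn_mul_self {i} (U \ S)
      linear_combination (sgn {i} S * sgn S (U \ S) * f (insert i S) * g (U \ S)) * q2
    · refine Finset.sum_congr rfl fun S hS => ?_
      have hS' : i ∉ S := fun h => hU (Finset.mem_powerset.1 hS h)
      have hVS : i ∉ U \ S := fun h => hU (Finset.mem_sdiff.1 h).1
      have e1 : insert i U \ S = insert i (U \ S) := Finset.insert_sdiff_of_notMem _ hS'
      have e3 : sgn {i} U = sgn {i} S * sgn {i} (U \ S) := by
        rw [← sgn_union_right Finset.disjoint_sdiff,
          Finset.union_sdiff_of_subset (Finset.mem_powerset.1 hS)]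
      rw [e1, pd_apply, if_neg hVS, par_apply, sgn_insert_right hVS, sgn_singleton_right hS', e3]
      have q1 := sgn_mul_self {i} S
      linear_combination ((-1) ^ S.card * sgn S (U \ S) * sgn {i} (U \ S) * f S *
        g (insert i (U \ S))) * q1

theorem pd_gen (i j : Fin K) : pd i (gen j) = if i = j then 1 else 0 := by
  funext S
  rw [pd_apply]
  by_cases hS : i ∈ S
  · rw [if_pos hS]
    split_ifs
    · rw [one_apply, if_neg]; rintro rfl; simp at hS
    · rfl
  · rw [if_neg hS]
    unfold gen
    by_cases hij : i = j
    · subst hij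
      rw [if_pos rfl, one_apply]
      by_cases h0 : S = ∅
      · subst h0; simp [sgn_empty_right]
      · rw [if_neg h0, if_neg, mul_zero]
        intro h
        apply h0
        apply Finset.eq_empty_of_forall_notMem
        intro x hx
        have : x ∈ ({i} : Finset (Fin K)) := h ▸ Finset.mem_insert_of_mem hx
        exact hS (Finset.mem_singleton.1 this ▸ hx)
    · rw [if_neg hij, if_neg, mul_zero]
      · rfl
      · intro h
        have : i ∈ ({j} : Finset (Fin K)) := h ▸ Finset.mem_insert_self i S
        exact hij (Finset.mem_singleton.1 this)

theorem pd_pd_self (i : Fin K) (f : Gr K) : pd i (pd i f) = 0 := by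
  funext S
  simp [pd_apply, zero_apply]

theorem pd_pd (i j : Fin K) (f : Gr K) : pd i (pd j f) = -pd j (pd i f) := by
  by_cases hij : i = j
  · subst hij; rw [pd_pd_self, neg_zero]
  · funext S
    rw [neg_apply]
    simp only [pd_apply, Finset.mem_insert, hij, Ne.symm hij, false_or]
    by_cases hi : i ∈ S <;> by_cases hj : j ∈ S <;> simp only [hi, hj, if_true, if_false, mul_zero,
      neg_zero]
    rw [sgn_insert_right hi, sgn_insert_right hj, Finset.insert_comm i j,
      sgn_comm (S := {i}) (T := {j}) (Finset.disjoint_singleton.2 hij)]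
    simp only [Finset.card_singleton]
    ring

theorem par_pd (i : Fin K) (f : Gr K) : par (pd i f) = -pd i (par f) := by
  funext S
  rw [neg_apply, par_apply, pd_apply, pd_apply]
  split_ifs with h
  · simp
  · rw [par_apply, Finset.card_insert_of_notMem h, pow_succ]; ring

/-! ### Conjugation -/

theorem conj_apply (f : Gr K) (S : Finset (Fin K)) :
    conj f S = (-1) ^ (S.card * (S.card - 1) / 2) * starRingEnd ℂ (f S) := rfl

theorem conj_add (f g : Gr K) : conj (f + g) = conj f + conj g := by
  funext S; simp [conj_apply, add_apply, mul_add]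

theorem conj_smul (c : ℂ) (f : Gr K) : conj (c • f) = starRingEnd ℂ c • conj f := by
  funext S; simp only [conj_apply, smul_apply, map_mul]; ring

theorem conj_neg (f : Gr K) : conj (-f) = -conj f := by
  funext S; simp [conj_apply, neg_apply]

theorem conj_sub (f g : Gr K) : conj (f - g) = conj f - conj g := by
  rw [sub_eq_add_neg, conj_add, conj_neg, ← sub_eq_add_neg]

theorem conj_zero : conj (0 : Gr K) = 0 := by
  funext S; simp [conj_apply, zero_apply]

theorem conj_sum {ι : Type*} (s : Finset ι) (f : ι → Gr K) :
    conj (∑ i ∈ s, f i) = ∑ i ∈ s, conj (f i) := by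
  classical
  induction s using Finset.induction_on with
  | empty => simp [conj_zero]
  | insert a s ha ih => rw [Finset.sum_insert ha, Finset.sum_insert ha, conj_add, ih]

theorem conj_conj (f : Gr K) : conj (conj f) = f := by
  funext S
  simp only [conj_apply, map_mul, map_pow, map_neg, map_one, Complex.conj_conj]
  rw [← mul_assoc, ← pow_add, ← two_mul, pow_mul]
  simp

theorem conj_par (f : Gr K) : conj (par f) = par (conj f) := by
  funext S
  simp only [conj_apply, par_apply, map_mul, map_pow, map_neg, map_one]
  ring

theorem conj_one : conj (1 : Gr K) = 1 := by
  funext S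
  rw [conj_apply, one_apply]
  split_ifs with h <;> simp [h]

theorem conj_gen (i : Fin K) : conj (gen i) = gen i := by
  funext S
  rw [conj_apply]
  unfold gen
  split_ifs with h <;> simp [h]

/-- The exponent in `conj` counts the transpositions that reverse a product of `k` generators.
Reversing a concatenation means reversing each block and exchanging the blocks, which costs `a * b`
more. -/
theorem triangle_add (a b : ℕ) :
    (a + b) * (a + b - 1) / 2 = a * (a - 1) / 2 + b * (b - 1) / 2 + a * b := by
  have h : ∀ k : ℕ, k * (k - 1) / 2 = k.choose 2 := fun k => (Nat.choose_two_right k).symm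
  rw [h, h, h]
  induction b with
  | zero => simp
  | succ b ih =>
    rw [← add_assoc, Nat.choose_succ_succ' (a + b) 1, Nat.choose_succ_succ' b 1, ih,
      Nat.choose_one_right, Nat.choose_one_right]
    ring

theorem conj_mul (f g : Gr K) : conj (f * g) = conj g * conj f := by
  funext U
  rw [mul_apply_swap, conj_apply, mul_apply, map_sum, Finset.mul_sum]
  refine Finset.sum_congr rfl fun S hS => ?_
  have h := card_add_card_sdiff (Finset.mem_powerset.1 hS)
  have hs : starRingEnd ℂ (sgn S (U \ S)) = sgn S (U \ S) := by simp [sgn]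
  rw [conj_apply, conj_apply, map_mul, map_mul, hs, sgn_comm Finset.disjoint_sdiff, h, triangle_add,
    pow_add, pow_add]
  have q : ((-1 : ℂ) ^ (S.card * (U \ S).card)) * (-1) ^ (S.card * (U \ S).card) = 1 := by
    rw [← pow_add, ← two_mul, pow_mul]; simp
  linear_combination ((-1) ^ (S.card * (S.card - 1) / 2) *
    (-1) ^ ((U \ S).card * ((U \ S).card - 1) / 2) * sgn (U \ S) S * starRingEnd ℂ (f S) *
    starRingEnd ℂ (g (U \ S))) * q

/-- Conjugation reverses products and so turns a left derivative into a right one; bringing it back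
to the left costs a sign given by the degree of what remains, one less than the degree seen by
`par`. -/
theorem conj_pd (i : Fin K) (f : Gr K) : conj (pd i f) = -pd i (par (conj f)) := by
  funext S
  rw [neg_apply, conj_apply, pd_apply, pd_apply]
  split_ifs with h
  · simp
  · have hs : starRingEnd ℂ (sgn {i} S) = sgn {i} S := by simp [sgn]
    rw [par_apply, conj_apply, Finset.card_insert_of_notMem h, triangle_add, map_mul, hs]
    simp only [pow_add, pow_one, mul_one, Nat.sub_self, mul_zero, Nat.zero_div, pow_zero]
    have q : ((-1 : ℂ) ^ S.card) * (-1) ^ S.card = 1 := by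
      rw [← pow_add, ← two_mul, pow_mul]; simp
    linear_combination (-(-1) ^ (S.card * (S.card - 1) / 2) * sgn {i} S *
      starRingEnd ℂ (f (insert i S))) * q

theorem IsEven.conj {f : Gr K} (hf : IsEven f) : IsEven (conj f) := by
  rw [isEven_iff, ← conj_par, hf.par_eq]

theorem IsOdd.conj {f : Gr K} (hf : IsOdd f) : IsOdd (conj f) := by
  rw [isOdd_iff, ← conj_par, hf.par_eq, conj_neg]

/-! ### The body and the degree filtration -/

theorem body_mul (f g : Gr K) : body (f * g) = body f * body g := by
  simp [body, mul_apply, sgn_empty_left]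

theorem body_conj (f : Gr K) : body (conj f) = starRingEnd ℂ (body f) := by
  simp [body, conj_apply]

/-- Elements all of whose monomials have degree at least `d`. -/
def DegGE (d : ℕ) (f : Gr K) : Prop := ∀ S, S.card < d → f S = 0

theorem DegGE.mul {d e : ℕ} {f g : Gr K} (hf : DegGE d f) (hg : DegGE e g) :
    DegGE (d + e) (f * g) := by
  intro U hU
  rw [mul_apply]
  refine Finset.sum_eq_zero fun S hS => ?_
  have h := card_add_card_sdiff (Finset.mem_powerset.1 hS)
  by_cases hd : S.card < d
  · rw [hf S hd]; ring
  · rw [hg (U \ S) (by omega)]; ring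

theorem DegGE.sum {ι : Type*} {s : Finset ι} {d : ℕ} {f : ι → Gr K}
    (h : ∀ i ∈ s, DegGE d (f i)) : DegGE d (∑ i ∈ s, f i) := fun S hS => by
  rw [sum_apply]
  exact Finset.sum_eq_zero fun i hi => h i hi S hS

theorem DegGE.eq_zero {d : ℕ} {f : Gr K} (hf : DegGE d f) (hd : K < d) : f = 0 := by
  funext S
  exact hf S (lt_of_le_of_lt (by simpa using Finset.card_le_univ S) hd)

theorem degGE_zero (f : Gr K) : DegGE 0 f := fun _ h => absurd h (Nat.not_lt_zero _)

/-- Degree one is excluded by parity. Each nilpotent even factor therefore raises the degree by two,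
which makes Taylor expansions terminate with room to spare. -/
theorem IsEven.degGE_two {f : Gr K} (hf : IsEven f) (h : body f = 0) : DegGE 2 f := by
  intro S hS
  interval_cases hc : S.card
  · rw [Finset.card_eq_zero.1 hc]; exact h
  · exact hf S (by rw [hc]; decide)

end Gr
end BiHKT

namespace BiHKT

noncomputable section

/-! ### Wirtinger derivatives -/

section Wirtinger

variable {J : Type} [Fintype J] [DecidableEq J]

/-- The Wirtinger derivatives: `∂/∂z^j` for `(j, 0)` and `∂/∂z̄^j` for `(j, 1)`. -/
def wirt (c : J × Fin 2) (f : (J → ℂ) → ℂ) : (J → ℂ) → ℂ :=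
  if c.2 = 0 then wd c.1 f else wdBar c.1 f

/-- The coefficient of the imaginary direction in a Wirtinger derivative. -/
def wirtSign (c : J × Fin 2) : ℂ := if c.2 = 0 then -Complex.I else Complex.I

/-- The coordinate `z^j` or `z̄^j` of a vector. -/
def coordC (h : J → ℂ) (c : J × Fin 2) : ℂ :=
  if c.2 = 0 then h c.1 else starRingEnd ℂ (h c.1)

theorem wirt_apply (c : J × Fin 2) (f : (J → ℂ) → ℂ) (x : J → ℂ) :
    wirt c f x = (fderiv ℝ f x (Pi.single c.1 1) +
      wirtSign c * fderiv ℝ f x (Pi.single c.1 Complex.I)) / 2 := by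
  unfold wirt wirtSign
  split_ifs
  · unfold wd; ring
  · rfl

variable {U : Set (J → ℂ)} {f g : (J → ℂ) → ℂ} {x : J → ℂ}

theorem contDiffOn_fderiv_apply (hU : IsOpen U) (hf : ContDiffOn ℝ ∞ f U) (e : J → ℂ) :
    ContDiffOn ℝ ∞ (fun y => fderiv ℝ f y e) U :=
  (hf.fderiv_of_isOpen hU (by simp)).clm_apply contDiffOn_const

theorem contDiffOn_wirt (hU : IsOpen U) (hf : ContDiffOn ℝ ∞ f U) (c : J × Fin 2) :
    ContDiffOn ℝ ∞ (wirt c f) U := by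
  have : wirt c f = fun x => (fderiv ℝ f x (Pi.single c.1 1) +
      wirtSign c * fderiv ℝ f x (Pi.single c.1 Complex.I)) / 2 := funext fun x => wirt_apply c f x
  rw [this]
  exact ((contDiffOn_fderiv_apply hU hf _).add
    (contDiffOn_const.mul (contDiffOn_fderiv_apply hU hf _))).div_const _

theorem fderiv_eq_of_eqOn (hU : IsOpen U) (h : Set.EqOn f g U) (hx : x ∈ U) :
    fderiv ℝ f x = fderiv ℝ g x :=
  Filter.EventuallyEq.fderiv_eq (Filter.eventuallyEq_of_mem (hU.mem_nhds hx) h)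

theorem wirt_eqOn (hU : IsOpen U) (h : Set.EqOn f g U) (c : J × Fin 2) :
    Set.EqOn (wirt c f) (wirt c g) U := fun x hx => by
  rw [wirt_apply, wirt_apply, fderiv_eq_of_eqOn hU h hx]

theorem differentiableAt_of_contDiffOn (hU : IsOpen U) (hf : ContDiffOn ℝ ∞ f U) (hx : x ∈ U) :
    DifferentiableAt ℝ f x :=
  (hf.differentiableOn (by simp)).differentiableAt (hU.mem_nhds hx)

theorem wirt_add (hf : DifferentiableAt ℝ f x) (hg : DifferentiableAt ℝ g x) (c : J × Fin 2) :
    wirt c (fun y => f y + g y) x = wirt c f x + wirt c g x := by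
  rw [wirt_apply, wirt_apply, wirt_apply, fderiv_fun_add hf hg]
  simp only [_root_.add_apply]
  ring

theorem wirt_mul (hf : DifferentiableAt ℝ f x) (hg : DifferentiableAt ℝ g x) (c : J × Fin 2) :
    wirt c (fun y => f y * g y) x = wirt c f x * g x + f x * wirt c g x := by
  rw [wirt_apply, wirt_apply, wirt_apply, fderiv_fun_mul hf hg]
  simp only [_root_.add_apply, _root_.smul_apply, smul_eq_mul]
  ring

theorem wirt_const (a : ℂ) (c : J × Fin 2) : wirt c (fun _ => a) x = 0 := by
  rw [wirt_apply]; simp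

theorem wirt_const_mul (a : ℂ) (hf : DifferentiableAt ℝ f x) (c : J × Fin 2) :
    wirt c (fun y => a * f y) x = a * wirt c f x := by
  rw [wirt_mul (differentiableAt_const a) hf, wirt_const, zero_mul, zero_add]

/-- The index of the conjugate derivative. -/
def flipC (c : J × Fin 2) : J × Fin 2 := (c.1, 1 - c.2)

theorem flipC_flipC (c : J × Fin 2) : flipC (flipC c) = c := by
  obtain ⟨j, b⟩ := c
  fin_cases b <;> simp [flipC]

theorem wirtSign_flipC (c : J × Fin 2) : wirtSign (flipC c) = starRingEnd ℂ (wirtSign c) := by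
  obtain ⟨j, b⟩ := c
  fin_cases b <;> simp [wirtSign, flipC]

theorem hasFDerivAt_conj (hf : DifferentiableAt ℝ f x) :
    HasFDerivAt (fun y => starRingEnd ℂ (f y))
      ((Complex.conjCLE : ℂ →L[ℝ] ℂ).comp (fderiv ℝ f x)) x :=
  (Complex.conjCLE : ℂ →L[ℝ] ℂ).hasFDerivAt.comp x hf.hasFDerivAt

theorem wirt_conj (hf : DifferentiableAt ℝ f x) (c : J × Fin 2) :
    wirt c (fun y => starRingEnd ℂ (f y)) x = starRingEnd ℂ (wirt (flipC c) f x) := by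
  rw [wirt_apply, wirt_apply, (hasFDerivAt_conj hf).fderiv, wirtSign_flipC]
  simp [flipC, Complex.conj_ofNat]

theorem vector_eq_sum_realDir (h : J → ℂ) :
    h = ∑ j, ((h j).re • (Pi.single j 1 : J → ℂ) + (h j).im • (Pi.single j Complex.I : J → ℂ)) := by
  funext k
  rw [Finset.sum_apply, Finset.sum_eq_single k]
  · simp
  · intro j _ hj
    simp [Pi.single_eq_of_ne (Ne.symm hj)]
  · simp

theorem sum_index (F : J × Fin 2 → ℂ) : ∑ c, F c = ∑ j, (F (j, 0) + F (j, 1)) := by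
  rw [Fintype.sum_prod_type]
  simp [Fin.sum_univ_two]

/-- The real differential in the complex frame, with `z^j` and `z̄^j` treated as independent
coordinates. This lets holomorphic and antiholomorphic dependence be handled by a single index `c`.
-/
theorem fderiv_eq_sum_wirt (f : (J → ℂ) → ℂ) (x h : J → ℂ) :
    fderiv ℝ f x h = ∑ c, wirt c f x * coordC h c := by
  rw [sum_index]
  conv_lhs => rw [vector_eq_sum_realDir h]
  rw [map_sum]
  refine Finset.sum_congr rfl fun j _ => ?_
  rw [wirt_apply, wirt_apply, map_add, map_smul, map_smul]
  simp only [coordC, wirtSign, if_true, Fin.reduceEq, if_false, Complex.real_smul, one_ne_zero]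
  have e : h j = (h j).re + (h j).im * Complex.I := (Complex.re_add_im _).symm
  have e2 : starRingEnd ℂ (h j) = (h j).re - (h j).im * Complex.I := by
    apply Complex.ext <;> simp
  rw [e2]
  conv_rhs => rw [e]
  simp only [Complex.add_re, Complex.ofReal_re, Complex.mul_re, Complex.I_re, mul_zero,
    Complex.ofReal_im, Complex.I_im, mul_one, sub_self, add_zero, Complex.add_im, Complex.mul_im,
    zero_add]
  linear_combination ((h j).im * fderiv ℝ f x (Pi.single j Complex.I)) * Complex.I_sq

theorem fderiv_wirt (hU : IsOpen U) (hf : ContDiffOn ℝ ∞ f U) (hx : x ∈ U) (c : J × Fin 2)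
    (h : J → ℂ) :
    fderiv ℝ (wirt c f) x h = (fderiv ℝ (fderiv ℝ f) x h (Pi.single c.1 1) +
      wirtSign c * fderiv ℝ (fderiv ℝ f) x h (Pi.single c.1 Complex.I)) / 2 := by
  have hd : DifferentiableAt ℝ (fderiv ℝ f) x :=
    ((hf.fderiv_of_isOpen hU (m := ∞) (by simp)).differentiableOn (by simp)).differentiableAt
      (hU.mem_nhds hx)
  have key : ∀ e : J → ℂ, HasFDerivAt (fun y => fderiv ℝ f y e)
      ((fderiv ℝ (fderiv ℝ f) x).flip e) x := fun e => by
    simpa using hd.hasFDerivAt.clm_apply (hasFDerivAt_const e x)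
  have : wirt c f = fun x => (2 : ℂ)⁻¹ * (fderiv ℝ f x (Pi.single c.1 1) +
      wirtSign c * fderiv ℝ f x (Pi.single c.1 Complex.I)) :=
    funext fun x => by rw [wirt_apply]; ring
  rw [this, (((key _).fun_add ((key _).const_mul (wirtSign c))).const_mul (2 : ℂ)⁻¹).fderiv]
  simp only [_root_.smul_apply, _root_.add_apply,
    ContinuousLinearMap.flip_apply, smul_eq_mul]
  ring

theorem wirt_comm (hU : IsOpen U) (hf : ContDiffOn ℝ ∞ f U) (c d : J × Fin 2) :
    Set.EqOn (wirt c (wirt d f)) (wirt d (wirt c f)) U := fun x hx => by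
  have hs : IsSymmSndFDerivAt ℝ f x := (hf.contDiffAt (hU.mem_nhds hx)).isSymmSndFDerivAt
    (by simpa using (WithTop.coe_le_coe.2 le_top : ((2 : ℕ∞) : ℕ∞ω) ≤ ∞))
  rw [wirt_apply, wirt_apply, fderiv_wirt hU hf hx, fderiv_wirt hU hf hx, fderiv_wirt hU hf hx,
    fderiv_wirt hU hf hx, hs (Pi.single d.1 1) (Pi.single c.1 1),
    hs (Pi.single d.1 1) (Pi.single c.1 Complex.I), hs (Pi.single d.1 Complex.I) (Pi.single c.1 1),
    hs (Pi.single d.1 Complex.I) (Pi.single c.1 Complex.I)]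
  ring

theorem contDiff_coordC (c : J × Fin 2) : ContDiff ℝ ∞ (fun y : J → ℂ => coordC y c) := by
  unfold coordC
  split_ifs
  · fun_prop
  · exact Complex.conjCLE.contDiff.comp (contDiff_apply ℝ ℂ c.1)

theorem wirt_coordC (c d : J × Fin 2) (x : J → ℂ) :
    wirt c (fun y => coordC y d) x = if c = d then 1 else 0 := by
  have hd : DifferentiableAt ℝ (fun y : J → ℂ => y d.1) x := by fun_prop
  have h0 : ∀ v : J → ℂ, fderiv ℝ (fun y : J → ℂ => y d.1) x v = v d.1 := fun v => by
    have : HasFDerivAt (fun y : J → ℂ => y d.1) (ContinuousLinearMap.proj (R := ℝ) (φ := fun _ : J => ℂ) d.1) x :=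
      (ContinuousLinearMap.proj (R := ℝ) (φ := fun _ : J => ℂ) d.1).hasFDerivAt
    rw [this.fderiv]; rfl
  have h1 : ∀ v : J → ℂ, fderiv ℝ (fun y : J → ℂ => coordC y d) x v = coordC v d := by
    intro v
    unfold coordC
    split_ifs
    · exact h0 v
    · rw [(hasFDerivAt_conj hd).fderiv]; simp [h0]
  rw [wirt_apply, h1, h1]
  obtain ⟨j, b⟩ := c
  obtain ⟨k, e⟩ := d
  by_cases hjk : j = k
  · subst hjk
    fin_cases b <;> fin_cases e <;> norm_num [coordC, wirtSign]
  · fin_cases b <;> fin_cases e <;> simp [coordC, Pi.single_eq_of_ne (Ne.symm hjk), hjk]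

end Wirtinger

end

end BiHKT

namespace BiHKT

noncomputable section

/-! ### Curves in the Grassmann algebra -/

namespace Gr

variable {K : ℕ}

theorem hasDerivAt_iff {f : ℝ → Gr K} {f' : Gr K} {t : ℝ} :
    HasDerivAt f f' t ↔ ∀ S, HasDerivAt (fun s => f s S) (f' S) t :=
  hasDerivAt_pi (E' := fun _ : Finset (Fin K) => ℂ)

theorem _root_.HasDerivAt.gr_mul {f g : ℝ → Gr K} {f' g' : Gr K} {t : ℝ} (hf : HasDerivAt f f' t)
    (hg : HasDerivAt g g' t) : HasDerivAt (fun s => f s * g s) (f' * g t + f t * g') t := by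
  rw [hasDerivAt_iff] at hf hg ⊢
  intro U
  simp only [mul_apply, add_apply, ← Finset.sum_add_distrib]
  refine HasDerivAt.fun_sum fun S _ => ?_
  have := ((hf S).const_mul (sgn S (U \ S))).fun_mul (hg (U \ S))
  exact this

theorem _root_.HasDerivAt.gr_const_mul {g : ℝ → Gr K} {g' : Gr K} {t : ℝ} (c : Gr K)
    (hg : HasDerivAt g g' t) : HasDerivAt (fun s => c * g s) (c * g') t := by
  simpa using (hasDerivAt_const t c).gr_mul hg

theorem _root_.HasDerivAt.gr_mul_const {g : ℝ → Gr K} {g' : Gr K} {t : ℝ} (hg : HasDerivAt g g' t)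
    (c : Gr K) : HasDerivAt (fun s => g s * c) (g' * c) t := by
  simpa using hg.gr_mul (hasDerivAt_const t c)

theorem _root_.HasDerivAt.gr_conj {f : ℝ → Gr K} {f' : Gr K} {t : ℝ} (hf : HasDerivAt f f' t) :
    HasDerivAt (fun s => conj (f s)) (conj f') t := by
  rw [hasDerivAt_iff] at hf ⊢
  exact fun S => (hf S).star.const_mul _

theorem _root_.HasDerivAt.gr_body {f : ℝ → Gr K} {f' : Gr K} {t : ℝ} (hf : HasDerivAt f f' t) :
    HasDerivAt (fun s => body (f s)) (body f') t := hasDerivAt_iff.1 hf ∅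

theorem _root_.HasDerivAt.gr_smul {c : ℝ → ℂ} {c' : ℂ} {f : ℝ → Gr K} {f' : Gr K} {t : ℝ}
    (hc : HasDerivAt c c' t) (hf : HasDerivAt f f' t) :
    HasDerivAt (fun s => c s • f s) (c' • f t + c t • f') t := by
  rw [hasDerivAt_iff] at hf ⊢
  exact fun S => hc.fun_mul (hf S)

theorem contDiff_iff {E : Type*} [NormedAddCommGroup E] [NormedSpace ℝ E] {f : E → Gr K} :
    ContDiff ℝ ∞ f ↔ ∀ S, ContDiff ℝ ∞ fun y => f y S :=
  contDiff_pi (F' := fun _ : Finset (Fin K) => ℂ)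

theorem _root_.ContDiff.gr_mul {E : Type*} [NormedAddCommGroup E] [NormedSpace ℝ E]
    {f g : E → Gr K} (hf : ContDiff ℝ ∞ f) (hg : ContDiff ℝ ∞ g) :
    ContDiff ℝ ∞ fun y => f y * g y := by
  rw [contDiff_iff] at hf hg ⊢
  intro U
  simp only [mul_apply]
  exact ContDiff.sum fun S _ => (contDiff_const.mul (hf S)).mul (hg _)

theorem _root_.ContDiff.gr_conj {E : Type*} [NormedAddCommGroup E] [NormedSpace ℝ E]
    {f : E → Gr K} (hf : ContDiff ℝ ∞ f) : ContDiff ℝ ∞ fun y => conj (f y) := by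
  rw [contDiff_iff] at hf ⊢
  intro S
  exact contDiff_const.mul (Complex.conjCLE.contDiff.comp (hf S))

theorem body_add (f g : Gr K) : body (f + g) = body f + body g := rfl

theorem body_sub (f g : Gr K) : body (f - g) = body f - body g := rfl

theorem body_smul (c : ℂ) (f : Gr K) : body (c • f) = c * body f := rfl

theorem body_one : body (1 : Gr K) = 1 := by simp [body, one_apply]

end Gr

/-! ### Taylor terms -/

section Taylor

variable {K : ℕ} {J : Type} [Fintype J] [DecidableEq J]

/-- The coordinate `X j` or its conjugate. -/
def coordG (X : J → Gr K) (c : J × Fin 2) : Gr K := if c.2 = 0 then X c.1 else Gr.conj (X c.1)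

/-- The nilpotent part of `coordG`. -/
def soul (X : J → Gr K) (c : J × Fin 2) : Gr K :=
  coordG X c - Gr.body (coordG X c) • (1 : Gr K)

/-- The bodies of a family. -/
abbrev bodies (X : J → Gr K) : J → ℂ := fun j => Gr.body (X j)

/-- The `k`-th derivative term (without the factor `1/k!`) in the Taylor expansion of `f(X, X̄)`. -/
def taylorTerm (X : J → Gr K) : ℕ → ((J → ℂ) → ℂ) → Gr K
  | 0, f => f (bodies X) • (1 : Gr K)
  | k + 1, f => ∑ c, taylorTerm X k (wirt c f) * soul X c

/-- The same term, in terms of real derivatives. -/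
def realTaylorTerm (X : J → Gr K) (k : ℕ) (f : (J → ℂ) → ℂ) : Gr K :=
  ∑ c : Fin k → J × Fin 2, iteratedFDeriv ℝ k f (bodies X) (fun l => realDir (c l)) •
    (List.ofFn fun l => soulCoord X (c l)).prod

variable {U : Set (J → ℂ)} {f g : (J → ℂ) → ℂ} {X : J → Gr K}

theorem body_coordG (X : J → Gr K) (c : J × Fin 2) :
    Gr.body (coordG X c) = coordC (bodies X) c := by
  unfold coordG coordC
  split_ifs
  · rfl
  · exact Gr.body_conj _

theorem body_soul (X : J → Gr K) (c : J × Fin 2) : Gr.body (soul X c) = 0 := by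
  rw [soul, Gr.body_sub, Gr.body_smul, Gr.body_one, mul_one, sub_self]

theorem isEven_coordG (hX : ∀ j, (X j).IsEven) (c : J × Fin 2) : (coordG X c).IsEven := by
  unfold coordG
  split_ifs
  · exact hX _
  · exact (hX _).conj

theorem isEven_soul (hX : ∀ j, (X j).IsEven) (c : J × Fin 2) : (soul X c).IsEven :=
  (isEven_coordG hX c).sub (Gr.isEven_one.smul _)

theorem contDiffAt_of_mem (hU : IsOpen U) (hf : ContDiffOn ℝ ∞ f U) {x : J → ℂ} (hx : x ∈ U)
    (k : ℕ) : ContDiffAt ℝ k f x :=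
  (hf.contDiffAt (hU.mem_nhds hx)).of_le (by exact_mod_cast le_top)

/-- Detaching one derivative and one nilpotent factor gives a recursion in the function, on which
all later inductions run. -/
theorem realTaylorTerm_succ (hU : IsOpen U) (hf : ContDiffOn ℝ ∞ f U) (hX : bodies X ∈ U) (k : ℕ) :
    realTaylorTerm X (k + 1) f =
      ∑ c, realTaylorTerm X k (fun y => fderiv ℝ f y (realDir c)) * soulCoord X c := by
  unfold realTaylorTerm
  simp only [Finset.sum_mul]
  -- The last index is split off, not the first: the innermost derivative then acts on `f` itself
  -- and its nilpotent factor stands at the right end of the ordered product.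
  rw [← (Fin.snocEquiv fun _ => J × Fin 2).sum_comp, Fintype.sum_prod_type]
  refine Finset.sum_congr rfl fun c _ => Finset.sum_congr rfl fun d _ => ?_
  rw [List.ofFn_succ', List.prod_concat, iteratedFDeriv_succ_apply_right]
  have hfd : ContDiffAt ℝ k (fderiv ℝ f) (bodies X) :=
    ((hf.fderiv_of_isOpen hU (m := ∞) (by simp)).contDiffAt (hU.mem_nhds hX)).of_le
      (by exact_mod_cast le_top)
  have e := (ContinuousLinearMap.apply ℝ ℂ (realDir c)).iteratedFDeriv_comp_left hfd le_rfl
  have e' := congrArg (fun L => L fun l => realDir (d l)) e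
  simp only [ContinuousLinearMap.compContinuousMultilinearMap_coe, Function.comp_def,
    ContinuousLinearMap.apply_apply] at e'
  simp only [Fin.snocEquiv_apply, Fin.snoc_castSucc, Fin.snoc_last, smul_mul_assoc]
  rw [e']
  congr 3
  funext l
  simp [Fin.init_def]

theorem realTaylorTerm_zero (f : (J → ℂ) → ℂ) :
    realTaylorTerm X 0 f = f (bodies X) • (1 : Gr K) := by
  simp [realTaylorTerm]

theorem realTaylorTerm_linear (hU : IsOpen U) (hf : ContDiffOn ℝ ∞ f U) (hg : ContDiffOn ℝ ∞ g U)
    (hX : bodies X ∈ U) (k : ℕ) (a b : ℂ) :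
    realTaylorTerm X k (fun y => a * f y + b * g y) =
      a • realTaylorTerm X k f + b • realTaylorTerm X k g := by
  unfold realTaylorTerm
  have h1 := contDiffAt_of_mem hU hf hX k
  have h2 := contDiffAt_of_mem hU hg hX k
  have e : iteratedFDeriv ℝ k (fun y => a * f y + b * g y) (bodies X) =
      a • iteratedFDeriv ℝ k f (bodies X) + b • iteratedFDeriv ℝ k g (bodies X) := by
    rw [← iteratedFDeriv_const_smul_apply h1, ← iteratedFDeriv_const_smul_apply h2]
    exact iteratedFDeriv_add_apply (h1.const_smul a) (h2.const_smul b)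
  rw [e, Finset.smul_sum, Finset.smul_sum, ← Finset.sum_add_distrib]
  refine Finset.sum_congr rfl fun c _ => ?_
  simp only [_root_.add_apply, _root_.smul_apply, add_smul,
    smul_assoc]

theorem soulCoord_zero (j : J) :
    soulCoord X (j, 0) = (1 / 2 : ℂ) • (soul X (j, 0) + soul X (j, 1)) := by
  simp [soulCoord, soul, coordG, Gr.conj_sub, Gr.conj_smul, Gr.conj_one, Gr.body_conj]

theorem soulCoord_one (j : J) :
    soulCoord X (j, 1) = (-Complex.I / 2) • (soul X (j, 0) - soul X (j, 1)) := by
  simp [soulCoord, soul, coordG, Gr.conj_sub, Gr.conj_smul, Gr.conj_one, Gr.body_conj]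

theorem sum_index_gr (F : J × Fin 2 → Gr K) : ∑ c, F c = ∑ j, (F (j, 0) + F (j, 1)) := by
  rw [Fintype.sum_prod_type]
  simp [Fin.sum_univ_two]

/-- The contraction of derivatives with nilpotent parts does not depend on the frame: the real and
imaginary parts transform inversely to the real derivatives, for each `j` separately. -/
theorem realTaylorTerm_succ_wirt (hU : IsOpen U) (hf : ContDiffOn ℝ ∞ f U) (hX : bodies X ∈ U)
    (k : ℕ) : realTaylorTerm X (k + 1) f = ∑ c, realTaylorTerm X k (wirt c f) * soul X c := by
  rw [realTaylorTerm_succ hU hf hX, sum_index_gr, sum_index_gr]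
  refine Finset.sum_congr rfl fun j _ => ?_
  have e : ∀ b : Fin 2, realTaylorTerm X k (wirt (j, b) f) =
      (1 / 2 : ℂ) • realTaylorTerm X k (fun y => fderiv ℝ f y (realDir (j, 0))) +
        (wirtSign (j, b) / 2) •
          realTaylorTerm X k (fun y => fderiv ℝ f y (realDir (j, 1))) := fun b => by
    rw [← realTaylorTerm_linear hU (contDiffOn_fderiv_apply hU hf _)
      (contDiffOn_fderiv_apply hU hf _) hX]
    congr 1
    funext y
    rw [wirt_apply]
    simp only [realDir, if_true, one_ne_zero, if_false]
    ring
  rw [e, e, soulCoord_zero, soulCoord_one]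
  simp only [wirtSign, if_true, one_ne_zero, if_false, mul_smul_comm, mul_add, mul_sub, add_mul,
    smul_mul_assoc]
  module

theorem taylorTerm_eq_real (hU : IsOpen U) (hf : ContDiffOn ℝ ∞ f U) (hX : bodies X ∈ U) (k : ℕ) :
    realTaylorTerm X k f = taylorTerm X k f := by
  induction k generalizing f with
  | zero => exact realTaylorTerm_zero f
  | succ k ih =>
    rw [realTaylorTerm_succ_wirt hU hf hX, taylorTerm]
    exact Finset.sum_congr rfl fun c _ => by rw [ih (contDiffOn_wirt hU hf c)]

theorem superEval_eq (hU : IsOpen U) (hf : ContDiffOn ℝ ∞ f U) (hX : bodies X ∈ U) :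
    superEval f X = ∑ k ∈ Finset.range (K + 1), ((k.factorial : ℂ)⁻¹) • taylorTerm X k f :=
  Finset.sum_congr rfl fun k _ => by rw [← taylorTerm_eq_real hU hf hX]; rfl

theorem taylorTerm_congr (hU : IsOpen U) (h : Set.EqOn f g U) (hX : bodies X ∈ U) (k : ℕ) :
    taylorTerm X k f = taylorTerm X k g := by
  induction k generalizing f g with
  | zero => rw [taylorTerm, taylorTerm, h hX]
  | succ k ih =>
    exact Finset.sum_congr rfl fun c _ => by rw [ih (wirt_eqOn hU h c)]

theorem taylorTerm_add (hU : IsOpen U) (hf : ContDiffOn ℝ ∞ f U) (hg : ContDiffOn ℝ ∞ g U)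
    (hX : bodies X ∈ U) (k : ℕ) :
    taylorTerm X k (fun y => f y + g y) = taylorTerm X k f + taylorTerm X k g := by
  rw [← taylorTerm_eq_real hU (hf.add hg) hX, ← taylorTerm_eq_real hU hf hX,
    ← taylorTerm_eq_real hU hg hX]
  simpa using realTaylorTerm_linear hU hf hg hX k 1 1

theorem taylorTerm_const_mul (hU : IsOpen U) (hf : ContDiffOn ℝ ∞ f U) (hX : bodies X ∈ U) (k : ℕ)
    (a : ℂ) : taylorTerm X k (fun y => a * f y) = a • taylorTerm X k f := by
  rw [← taylorTerm_eq_real hU (contDiffOn_const.mul hf) hX, ← taylorTerm_eq_real hU hf hX]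
  simpa using realTaylorTerm_linear hU hf hf hX k a 0

theorem taylorTerm_zero_fun (k : ℕ) : taylorTerm X k (fun _ => 0) = 0 := by
  induction k with
  | zero => simp [taylorTerm]
  | succ k ih =>
    refine Finset.sum_eq_zero fun c _ => ?_
    have : wirt c (fun _ : J → ℂ => (0 : ℂ)) = fun _ => 0 := funext fun x => wirt_const 0 c
    rw [this, ih, zero_mul]

theorem isEven_taylorTerm (hX : ∀ j, (X j).IsEven) (k : ℕ) (f : (J → ℂ) → ℂ) :
    (taylorTerm X k f).IsEven := by
  induction k generalizing f with
  | zero => exact Gr.isEven_one.smul _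
  | succ k ih => exact Gr.IsEven.sum fun c _ => (ih _).mul (isEven_soul hX c)

theorem degGE_taylorTerm (hX : ∀ j, (X j).IsEven) (k : ℕ) (f : (J → ℂ) → ℂ) :
    (taylorTerm X k f).DegGE (2 * k) := by
  induction k generalizing f with
  | zero => exact Gr.degGE_zero _
  | succ k ih =>
    exact Gr.DegGE.sum fun c _ => (ih _).mul ((isEven_soul hX c).degGE_two (body_soul X c))

theorem sum_flipC (F : J × Fin 2 → Gr K) : ∑ c, F (flipC c) = ∑ c, F c := by
  rw [sum_index_gr, sum_index_gr]
  exact Finset.sum_congr rfl fun j _ => by simp [flipC, add_comm]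

theorem conj_coordG (X : J → Gr K) (c : J × Fin 2) :
    Gr.conj (coordG X c) = coordG X (flipC c) := by
  obtain ⟨j, b⟩ := c
  fin_cases b <;> simp [coordG, flipC, Gr.conj_conj]

theorem conj_soul (X : J → Gr K) (c : J × Fin 2) : Gr.conj (soul X c) = soul X (flipC c) := by
  rw [soul, Gr.conj_sub, conj_coordG, Gr.conj_smul, Gr.conj_one, ← Gr.body_conj, conj_coordG]
  rfl

theorem contDiffOn_conj (hf : ContDiffOn ℝ ∞ f U) :
    ContDiffOn ℝ ∞ (fun y => starRingEnd ℂ (f y)) U :=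
  Complex.conjCLE.contDiff.comp_contDiffOn hf

theorem taylorTerm_conj (hU : IsOpen U) (hf : ContDiffOn ℝ ∞ f U) (hX : bodies X ∈ U)
    (hXe : ∀ j, (X j).IsEven) (k : ℕ) :
    taylorTerm X k (fun y => starRingEnd ℂ (f y)) = Gr.conj (taylorTerm X k f) := by
  induction k generalizing f with
  | zero => rw [taylorTerm, taylorTerm, Gr.conj_smul, Gr.conj_one]
  | succ k ih =>
    rw [taylorTerm, taylorTerm, Gr.conj_sum, ← sum_flipC]
    refine Finset.sum_congr rfl fun c _ => ?_
    rw [Gr.conj_mul, conj_soul, ← ih (contDiffOn_wirt hU hf c), (isEven_soul hXe _).comm]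
    congr 1
    refine taylorTerm_congr hU (fun y hy => ?_) hX k
    rw [wirt_conj (differentiableAt_of_contDiffOn hU hf hy), flipC_flipC]

/-- A homomorphism that respects the coordinates, their conjugates and the bodies passes through the
Taylor polynomial. The cases of interest are restriction to the origin of the odd directions and the
rotation of `η`. -/
theorem taylorTerm_map {K' : ℕ} {X' : J → Gr K'} (R : Gr K → Gr K')
    (hadd : ∀ a b, R (a + b) = R a + R b) (hsmul : ∀ (c : ℂ) a, R (c • a) = c • R a)
    (hmul : ∀ a b, R (a * b) = R a * R b) (hone : R 1 = 1)
    (hc : ∀ c, R (coordG X c) = coordG X' c) (hb : ∀ j, Gr.body (X' j) = Gr.body (X j)) (k : ℕ)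
    (f : (J → ℂ) → ℂ) : R (taylorTerm X k f) = taylorTerm X' k f := by
  have hbb : bodies X' = bodies X := funext hb
  have hs : ∀ c, R (soul X c) = soul X' c := fun c => by
    rw [soul, sub_eq_add_neg, ← neg_smul, hadd, hsmul, hone, hc, body_coordG, ← hbb,
      ← body_coordG, neg_smul, ← sub_eq_add_neg]
    rfl
  have hsum : ∀ F : J × Fin 2 → Gr K, R (∑ c, F c) = ∑ c, R (F c) := fun F =>
    map_sum (⟨⟨R, by simpa using hsmul 0 0⟩, hadd⟩ : Gr K →+ Gr K') F Finset.univ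
  induction k generalizing f with
  | zero => rw [taylorTerm, taylorTerm, hsmul, hone, hbb]
  | succ k ih =>
    rw [taylorTerm, taylorTerm, hsum]
    exact Finset.sum_congr rfl fun c _ => by rw [hmul, ih, hs]

/-- A coordinate has only first derivatives, so at most one of the `k` derivatives falls on it, and
there are `k` choices for that one. Together with its body this is the Leibniz rule for the factor
`coordC y d`. -/
theorem taylorTerm_mul_coord (hU : IsOpen U) (hf : ContDiffOn ℝ ∞ f U) (hX : bodies X ∈ U)
    (hXe : ∀ j, (X j).IsEven) (d : J × Fin 2) (k : ℕ) :
    taylorTerm X k (fun y => f y * coordC y d) =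
      coordC (bodies X) d • taylorTerm X k f + (k : ℂ) • (taylorTerm X (k - 1) f * soul X d) := by
  induction k generalizing f with
  | zero => simp [taylorTerm, smul_smul, mul_comm]
  | succ k ih =>
    have hw : ∀ c, taylorTerm X k (wirt c fun y => f y * coordC y d) =
        coordC (bodies X) d • taylorTerm X k (wirt c f) +
          (k : ℂ) • (taylorTerm X (k - 1) (wirt c f) * soul X d) +
          (if c = d then 1 else 0 : ℂ) • taylorTerm X k f := fun c => by
      have hcd : ContDiffOn ℝ ∞ (fun y : J → ℂ => coordC y d) U := (contDiff_coordC d).contDiffOn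
      rw [← ih (contDiffOn_wirt hU hf c), ← taylorTerm_const_mul hU hf hX,
        ← taylorTerm_add hU ((contDiffOn_wirt hU hf c).mul hcd) (contDiffOn_const.mul hf) hX]
      refine taylorTerm_congr hU (fun y hy => ?_) hX k
      rw [wirt_mul (differentiableAt_of_contDiffOn hU hf hy)
        (differentiableAt_of_contDiffOn hU hcd hy), wirt_coordC]
      ring
    rw [taylorTerm, taylorTerm]
    simp only [hw, add_mul, Finset.sum_add_distrib, smul_mul_assoc, ← Finset.smul_sum, ite_smul,
      one_smul, zero_smul, ite_mul, zero_mul, Finset.sum_ite_eq', Finset.mem_univ, if_true,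
      Finset.sum_ite_eq]
    rw [add_assoc]
    congr 1
    rw [Nat.cast_succ, add_smul, one_smul, Nat.add_sub_cancel]
    congr 1
    rcases k with _ | k
    · simp
    · congr 1
      rw [Nat.add_sub_cancel, taylorTerm, Finset.sum_mul]
      refine Finset.sum_congr rfl fun c _ => ?_
      rw [mul_assoc, mul_assoc, (isEven_soul hXe c).comm]

/-- A change of variables that relabels coordinates and conjugates some of them. -/
structure CoordChange (I J : Type) where
  /-- the coordinate that is read off -/
  idx : I → J
  /-- whether it is conjugated -/
  flip : I → Fin 2

namespace CoordChange

variable {I : Type} [Fintype I] [DecidableEq I] (σ : CoordChange I J)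

/-- The action on numerical vectors. -/
def mapC (x : J → ℂ) (i : I) : ℂ := coordC x (σ.idx i, σ.flip i)

/-- The action on vectors over the Grassmann algebra. -/
def mapG (X : J → Gr K) (i : I) : Gr K := coordG X (σ.idx i, σ.flip i)

/-- The action on indices. -/
def mapIdx (d : I × Fin 2) : J × Fin 2 := (σ.idx d.1, σ.flip d.1 + d.2)

theorem bodies_mapG (X : J → Gr K) : bodies (σ.mapG X) = σ.mapC (bodies X) :=
  funext fun i => body_coordG X (σ.idx i, σ.flip i)

theorem coordC_mapC (x : J → ℂ) (d : I × Fin 2) : coordC (σ.mapC x) d = coordC x (σ.mapIdx d) := by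
  obtain ⟨i, b⟩ := d
  simp only [coordC, mapC, mapIdx]
  have he : σ.flip i = 0 ∨ σ.flip i = 1 := by omega
  rcases he with he | he <;> fin_cases b <;> simp [he]

theorem coordG_mapG (X : J → Gr K) (d : I × Fin 2) :
    coordG (σ.mapG X) d = coordG X (σ.mapIdx d) := by
  obtain ⟨i, b⟩ := d
  simp only [coordG, mapG, mapIdx]
  have he : σ.flip i = 0 ∨ σ.flip i = 1 := by omega
  rcases he with he | he <;> fin_cases b <;> simp [he, Gr.conj_conj]

theorem soul_mapG (X : J → Gr K) (d : I × Fin 2) :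
    soul (σ.mapG X) d = soul X (σ.mapIdx d) := by
  rw [soul, coordG_mapG]; rfl

theorem contDiff_mapC : ContDiff ℝ ∞ (σ.mapC : (J → ℂ) → I → ℂ) :=
  contDiff_pi.2 fun _ => contDiff_coordC _

theorem contDiffOn_comp {V : Set (I → ℂ)} {h : (I → ℂ) → ℂ} (hh : ContDiffOn ℝ ∞ h V) :
    ContDiffOn ℝ ∞ (fun y => h (σ.mapC y)) (σ.mapC ⁻¹' V) :=
  hh.comp σ.contDiff_mapC.contDiffOn (Set.mapsTo_preimage _ _)

theorem isOpen_preimage {V : Set (I → ℂ)} (hV : IsOpen V) : IsOpen (σ.mapC ⁻¹' V : Set (J → ℂ)) :=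
  hV.preimage σ.contDiff_mapC.continuous

theorem wirt_comp {V : Set (I → ℂ)} (hV : IsOpen V) {h : (I → ℂ) → ℂ} (hh : ContDiffOn ℝ ∞ h V)
    (c : J × Fin 2) {x : J → ℂ} (hx : σ.mapC x ∈ V) :
    wirt c (fun y => h (σ.mapC y)) x =
      ∑ d, (if c = σ.mapIdx d then 1 else 0) * wirt d h (σ.mapC x) := by
  have hd := (differentiableAt_of_contDiffOn hV hh hx).hasFDerivAt
  have hm : HasFDerivAt (σ.mapC : (J → ℂ) → I → ℂ) (fderiv ℝ σ.mapC x) x :=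
    (σ.contDiff_mapC.differentiable (by simp) x).hasFDerivAt
  have hcomp := hd.comp x hm
  have e : ∀ (v : J → ℂ) (d : I × Fin 2), coordC (fderiv ℝ σ.mapC x v) d =
      fderiv ℝ (fun y => coordC y (σ.mapIdx d)) x v := fun v d => by
    have h1 : HasFDerivAt (fun y => coordC (σ.mapC y) d)
        ((fderiv ℝ (fun y : I → ℂ => coordC y d) (σ.mapC x)).comp (fderiv ℝ σ.mapC x)) x :=
      ((contDiff_coordC d).differentiable (by simp) _).hasFDerivAt.comp x hm
    have h2 : ∀ w : I → ℂ, fderiv ℝ (fun y : I → ℂ => coordC y d) (σ.mapC x) w = coordC w d :=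
      fun w => by
        rw [fderiv_eq_sum_wirt]
        simp [wirt_coordC]
    have h3 : (fun y => coordC (σ.mapC y) d) = fun y => coordC y (σ.mapIdx d) :=
      funext fun y => σ.coordC_mapC y d
    rw [h3] at h1
    rw [h1.fderiv]
    exact (h2 _).symm
  have h4 : ∀ v, fderiv ℝ (fun y => h (σ.mapC y)) x v =
      ∑ d, wirt d h (σ.mapC x) * fderiv ℝ (fun y => coordC y (σ.mapIdx d)) x v := fun v => by
    have : fderiv ℝ (fun y => h (σ.mapC y)) x = _ := hcomp.fderiv
    rw [this, ContinuousLinearMap.comp_apply, fderiv_eq_sum_wirt]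
    exact Finset.sum_congr rfl fun d _ => by rw [e]
  rw [wirt_apply, h4, h4, Finset.mul_sum, ← Finset.sum_add_distrib, Finset.sum_div]
  refine Finset.sum_congr rfl fun d _ => ?_
  rw [← wirt_coordC c (σ.mapIdx d) x, wirt_apply c fun y => coordC y (σ.mapIdx d)]
  ring

end CoordChange

theorem taylorTerm_sum {ι : Type*} (s : Finset ι) (hU : IsOpen U) {F : ι → (J → ℂ) → ℂ}
    (hF : ∀ i ∈ s, ContDiffOn ℝ ∞ (F i) U) (hX : bodies X ∈ U) (k : ℕ) :
    taylorTerm X k (fun y => ∑ i ∈ s, F i y) = ∑ i ∈ s, taylorTerm X k (F i) := by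
  classical
  induction s using Finset.induction_on with
  | empty => simpa using taylorTerm_zero_fun k
  | insert a s ha ih =>
    simp only [Finset.sum_insert ha]
    rw [taylorTerm_add hU (hF a (Finset.mem_insert_self a s))
      (ContDiffOn.sum fun i hi => hF i (Finset.mem_insert_of_mem hi)) hX,
      ih fun i hi => hF i (Finset.mem_insert_of_mem hi)]

theorem taylorTerm_comp {I : Type} [Fintype I] [DecidableEq I] (σ : CoordChange I J)
    {V : Set (I → ℂ)} (hV : IsOpen V) {h : (I → ℂ) → ℂ} (hh : ContDiffOn ℝ ∞ h V)
    (hX : σ.mapC (bodies X) ∈ V) (k : ℕ) :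
    taylorTerm X k (fun y => h (σ.mapC y)) = taylorTerm (σ.mapG X) k h := by
  have hO : IsOpen (σ.mapC ⁻¹' V : Set (J → ℂ)) := σ.isOpen_preimage hV
  induction k generalizing h with
  | zero => rw [taylorTerm, taylorTerm, σ.bodies_mapG]
  | succ k ih =>
    have e : ∀ c, taylorTerm X k (wirt c fun y => h (σ.mapC y)) =
        ∑ d, (if c = σ.mapIdx d then 1 else 0 : ℂ) • taylorTerm (σ.mapG X) k (wirt d h) := by
      intro c
      have hs : ∀ d, ContDiffOn ℝ ∞ (fun y => wirt d h (σ.mapC y)) (σ.mapC ⁻¹' V) := fun d =>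
        σ.contDiffOn_comp (contDiffOn_wirt hV hh d)
      rw [taylorTerm_congr hO (fun y hy => σ.wirt_comp hV hh c hy) hX,
        taylorTerm_sum _ hO (fun d _ => contDiffOn_const.mul (hs d)) hX]
      refine Finset.sum_congr rfl fun d _ => ?_
      rw [taylorTerm_const_mul hO (hs d) hX, ih (contDiffOn_wirt hV hh d)]
    rw [taylorTerm, taylorTerm]
    simp only [e, Finset.sum_mul]
    rw [Finset.sum_comm]
    refine Finset.sum_congr rfl fun d _ => ?_
    simp only [ite_smul, one_smul, zero_smul, ite_mul, zero_mul, Finset.sum_ite_eq',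
      Finset.mem_univ, if_true, σ.soul_mapG]

end Taylor

end

end BiHKT

namespace BiHKT

noncomputable section

/-! ### Calculus of superfunctions -/

section SuperCalculus

variable {K : ℕ} {J : Type} [Fintype J] [DecidableEq J]
variable {U : Set (J → ℂ)} {f g : (J → ℂ) → ℂ} {X : J → Gr K}

theorem superEval_congr (hU : IsOpen U) (hf : ContDiffOn ℝ ∞ f U) (h : Set.EqOn f g U)
    (hX : bodies X ∈ U) : superEval f X = superEval g X := by
  rw [superEval_eq hU hf hX, superEval_eq hU (hf.congr fun y hy => (h hy).symm) hX]
  exact Finset.sum_congr rfl fun k _ => by rw [taylorTerm_congr hU h hX]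

theorem superEval_zero : superEval (fun _ : J → ℂ => 0) X = 0 := by
  rw [superEval_eq isOpen_univ contDiffOn_const (Set.mem_univ _)]
  simp [taylorTerm_zero_fun]

theorem superEval_eq_zero (hU : IsOpen U) (h : ∀ y ∈ U, f y = 0) (hX : bodies X ∈ U) :
    superEval f X = 0 := by
  rw [← superEval_zero (X := X)]
  exact (superEval_congr hU contDiffOn_const (fun y hy => (h y hy).symm) hX).symm

theorem superEval_add (hU : IsOpen U) (hf : ContDiffOn ℝ ∞ f U) (hg : ContDiffOn ℝ ∞ g U)
    (hX : bodies X ∈ U) :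
    superEval (fun y => f y + g y) X = superEval f X + superEval g X := by
  rw [superEval_eq hU (hf.add hg) hX, superEval_eq hU hf hX, superEval_eq hU hg hX,
    ← Finset.sum_add_distrib]
  exact Finset.sum_congr rfl fun k _ => by rw [taylorTerm_add hU hf hg hX, smul_add]

theorem superEval_sum {ι : Type*} (s : Finset ι) (hU : IsOpen U) {F : ι → (J → ℂ) → ℂ}
    (hF : ∀ i ∈ s, ContDiffOn ℝ ∞ (F i) U) (hX : bodies X ∈ U) :
    superEval (fun y => ∑ i ∈ s, F i y) X = ∑ i ∈ s, superEval (F i) X := by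
  rw [superEval_eq hU (ContDiffOn.sum hF) hX,
    Finset.sum_congr rfl fun i hi => superEval_eq hU (hF i hi) hX, Finset.sum_comm]
  exact Finset.sum_congr rfl fun k _ => by rw [taylorTerm_sum s hU hF hX, Finset.smul_sum]

theorem superEval_const_mul (hU : IsOpen U) (hf : ContDiffOn ℝ ∞ f U) (hX : bodies X ∈ U)
    (a : ℂ) : superEval (fun y => a * f y) X = a • superEval f X := by
  rw [superEval_eq hU (contDiffOn_const.mul hf) hX, superEval_eq hU hf hX, Finset.smul_sum]
  exact Finset.sum_congr rfl fun k _ => by rw [taylorTerm_const_mul hU hf hX, smul_comm]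

theorem superEval_neg (hU : IsOpen U) (hf : ContDiffOn ℝ ∞ f U) (hX : bodies X ∈ U) :
    superEval (fun y => -f y) X = -superEval f X := by
  simpa using superEval_const_mul hU hf hX (-1)

theorem superEval_sub (hU : IsOpen U) (hf : ContDiffOn ℝ ∞ f U) (hg : ContDiffOn ℝ ∞ g U)
    (hX : bodies X ∈ U) :
    superEval (fun y => f y - g y) X = superEval f X - superEval g X := by
  simp only [sub_eq_add_neg]
  rw [superEval_add hU hf hg.neg hX, superEval_neg hU hg hX]

theorem isEven_superEval (hU : IsOpen U) (hf : ContDiffOn ℝ ∞ f U) (hX : bodies X ∈ U)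
    (hXe : ∀ j, (X j).IsEven) : (superEval f X).IsEven := by
  rw [superEval_eq hU hf hX]
  exact Gr.IsEven.sum fun k _ => (isEven_taylorTerm hXe k f).smul _

theorem superEval_conj (hU : IsOpen U) (hf : ContDiffOn ℝ ∞ f U) (hX : bodies X ∈ U)
    (hXe : ∀ j, (X j).IsEven) :
    superEval (fun y => starRingEnd ℂ (f y)) X = Gr.conj (superEval f X) := by
  rw [superEval_eq hU (contDiffOn_conj hf) hX, superEval_eq hU hf hX, Gr.conj_sum]
  exact Finset.sum_congr rfl fun k _ => by
    rw [taylorTerm_conj hU hf hX hXe, Gr.conj_smul, map_inv₀, Complex.conj_natCast]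

theorem superEval_map (hU : IsOpen U) (hf : ContDiffOn ℝ ∞ f U) (hX : bodies X ∈ U)
    {X' : J → Gr K} (R : Gr K → Gr K)
    (hadd : ∀ a b, R (a + b) = R a + R b) (hsmul : ∀ (c : ℂ) a, R (c • a) = c • R a)
    (hmul : ∀ a b, R (a * b) = R a * R b) (hone : R 1 = 1)
    (hc : ∀ c, R (coordG X c) = coordG X' c) (hb : ∀ j, Gr.body (X' j) = Gr.body (X j)) :
    R (superEval f X) = superEval f X' := by
  have hX' : bodies X' ∈ U := by rwa [show bodies X' = bodies X from funext hb]
  rw [superEval_eq hU hf hX, superEval_eq hU hf hX']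
  have hsum : ∀ F : ℕ → Gr K, R (∑ k ∈ Finset.range (K + 1), F k) =
      ∑ k ∈ Finset.range (K + 1), R (F k) := fun F =>
    map_sum (⟨⟨R, by simpa using hsmul 0 0⟩, hadd⟩ : Gr K →+ Gr K) F _
  rw [hsum]
  exact Finset.sum_congr rfl fun k _ => by rw [hsmul, taylorTerm_map R hadd hsmul hmul hone hc hb]

theorem superEval_comp {I : Type} [Fintype I] [DecidableEq I] (σ : CoordChange I J)
    {V : Set (I → ℂ)} (hV : IsOpen V) {h : (I → ℂ) → ℂ} (hh : ContDiffOn ℝ ∞ h V)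
    (hX : σ.mapC (bodies X) ∈ V) :
    superEval (fun y => h (σ.mapC y)) X = superEval h (σ.mapG X) := by
  have hX' : bodies (σ.mapG X) ∈ V := by rwa [σ.bodies_mapG]
  rw [superEval_eq (σ.isOpen_preimage hV) (σ.contDiffOn_comp hh) hX, superEval_eq hV hh hX']
  exact Finset.sum_congr rfl fun k _ => by rw [taylorTerm_comp σ hV hh hX]

/-- Reindexing of the exponential series. -/
theorem sum_range_factorial_shift (M : ℕ) (F : ℕ → Gr K) :
    ∑ k ∈ Finset.range (M + 1), ((k.factorial : ℂ)⁻¹) • (k : ℂ) • F (k - 1) =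
      ∑ k ∈ Finset.range M, ((k.factorial : ℂ)⁻¹) • F k := by
  rw [Finset.sum_range_succ']
  simp only [Nat.cast_zero, zero_smul, smul_zero, add_zero, Nat.add_sub_cancel]
  refine Finset.sum_congr rfl fun k _ => ?_
  rw [smul_smul]
  congr 1
  have h1 : ((k + 1 : ℕ) : ℂ) ≠ 0 := Nat.cast_ne_zero.2 (Nat.succ_ne_zero k)
  have h2 : ((k.factorial : ℕ) : ℂ) ≠ 0 := Nat.cast_ne_zero.2 (Nat.factorial_ne_zero k)
  rw [Nat.factorial_succ, Nat.cast_mul]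
  field_simp

/-- The degree is at least `2K`, which exceeds `K`. The sum in `superEval` thus has at least one
vanishing term at the end, and this slack absorbs the shift of index in the product and chain rules.
-/
theorem taylorTerm_top (hK : 0 < K) (hXe : ∀ j, (X j).IsEven) (f : (J → ℂ) → ℂ) :
    taylorTerm X K f = 0 :=
  (degGE_taylorTerm hXe K f).eq_zero (by omega)

theorem superEval_eq' (hK : 0 < K) (hU : IsOpen U) (hf : ContDiffOn ℝ ∞ f U) (hX : bodies X ∈ U)
    (hXe : ∀ j, (X j).IsEven) :
    superEval f X = ∑ k ∈ Finset.range K, ((k.factorial : ℂ)⁻¹) • taylorTerm X k f := by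
  rw [superEval_eq hU hf hX, Finset.sum_range_succ, taylorTerm_top hK hXe, smul_zero, add_zero]

/-- The only case of multiplicativity that is needed, since the prepotential is affine in `Ξ`, `Σ`
and their conjugates. The body of the coordinate contributes at order `k`, its nilpotent part at
order `k - 1`. -/
theorem superEval_mul_coord (hK : 0 < K) (hU : IsOpen U) (hf : ContDiffOn ℝ ∞ f U)
    (hX : bodies X ∈ U) (hXe : ∀ j, (X j).IsEven) (d : J × Fin 2) :
    superEval (fun y => f y * coordC y d) X = superEval f X * coordG X d := by
  have hcd : ContDiffOn ℝ ∞ (fun y : J → ℂ => coordC y d) U := (contDiff_coordC d).contDiffOn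
  have e : coordG X d = coordC (bodies X) d • (1 : Gr K) + soul X d := by
    rw [soul, body_coordG]; abel
  rw [e, mul_add, mul_smul_comm, mul_one, superEval_eq hU (hf.mul hcd) hX]
  simp only [taylorTerm_mul_coord hU hf hX hXe, smul_add, Finset.sum_add_distrib]
  congr 1
  · rw [superEval_eq hU hf hX, Finset.smul_sum]
    exact Finset.sum_congr rfl fun k _ => smul_comm _ _ _
  · rw [sum_range_factorial_shift K fun k => taylorTerm X k f * soul X d,
      superEval_eq' hK hU hf hX hXe, Finset.sum_mul]
    exact Finset.sum_congr rfl fun k _ => (smul_mul_assoc _ _ _).symm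

/-- A linear map that satisfies the Leibniz rule for products of even elements. -/
structure EvenDer (δ : Gr K → Gr K) : Prop where
  add : ∀ a b, δ (a + b) = δ a + δ b
  smul : ∀ (c : ℂ) a, δ (c • a) = c • δ a
  mul : ∀ a b, a.IsEven → b.IsEven → δ (a * b) = δ a * b + a * δ b
  one : δ 1 = 0

theorem EvenDer.map_sum {δ : Gr K → Gr K} (hδ : EvenDer δ) {ι : Type*} (s : Finset ι)
    (F : ι → Gr K) : δ (∑ i ∈ s, F i) = ∑ i ∈ s, δ (F i) :=
  _root_.map_sum (⟨⟨δ, by simpa using hδ.smul 0 0⟩, hδ.add⟩ : Gr K →+ Gr K) F s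

theorem EvenDer.soul {δ : Gr K → Gr K} (hδ : EvenDer δ) (X : J → Gr K) (c : J × Fin 2) :
    δ (soul X c) = δ (coordG X c) := by
  rw [BiHKT.soul, sub_eq_add_neg, ← neg_smul, hδ.add, hδ.smul, hδ.one, smul_zero, add_zero]

/-- The derivation may hit any of the `k` nilpotent factors. Commuting the Wirtinger derivatives and
the even factors brings the one that is hit to the outside, and the `k` contributions coincide. -/
theorem EvenDer.taylorTerm {δ : Gr K → Gr K} (hδ : EvenDer δ) (hU : IsOpen U)
    (hf : ContDiffOn ℝ ∞ f U) (hX : bodies X ∈ U) (hXe : ∀ j, (X j).IsEven) (k : ℕ) :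
    δ (taylorTerm X k f) = (k : ℂ) • ∑ c, taylorTerm X (k - 1) (wirt c f) * δ (coordG X c) := by
  induction k generalizing f with
  | zero => simp [BiHKT.taylorTerm, hδ.smul, hδ.one]
  | succ k ih =>
    rw [BiHKT.taylorTerm, hδ.map_sum]
    simp only [hδ.mul _ _ (isEven_taylorTerm hXe _ _) (isEven_soul hXe _), hδ.soul,
      Finset.sum_add_distrib]
    rw [Nat.cast_succ, add_smul, one_smul, Nat.add_sub_cancel]
    congr 1
    rw [Finset.sum_congr rfl fun c _ => by rw [ih (contDiffOn_wirt hU hf c)]]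
    rcases k with _ | k
    · simp
    · simp only [smul_mul_assoc, ← Finset.smul_sum, Nat.add_sub_cancel]
      congr 1
      simp only [Finset.sum_mul, BiHKT.taylorTerm]
      rw [Finset.sum_comm]
      refine Finset.sum_congr rfl fun d _ => Finset.sum_congr rfl fun c _ => ?_
      rw [taylorTerm_congr hU (wirt_comm hU hf d c) hX, mul_assoc, mul_assoc,
        (isEven_soul hXe c).comm]

/-- The chain rule. Only products of even elements are differentiated, so odd derivations such as
`∂_θ` are covered as well. -/
theorem EvenDer.superEval (hK : 0 < K) {δ : Gr K → Gr K} (hδ : EvenDer δ) (hU : IsOpen U)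
    (hf : ContDiffOn ℝ ∞ f U) (hX : bodies X ∈ U) (hXe : ∀ j, (X j).IsEven) :
    δ (superEval f X) = ∑ c, superEval (wirt c f) X * δ (coordG X c) := by
  rw [superEval_eq hU hf hX, hδ.map_sum]
  simp only [hδ.smul, hδ.taylorTerm hU hf hX hXe]
  rw [sum_range_factorial_shift K fun k => ∑ c, BiHKT.taylorTerm X k (wirt c f) * δ (coordG X c)]
  simp only [superEval_eq' hK hU (contDiffOn_wirt hU hf _) hX hXe, Finset.sum_mul, Finset.smul_sum,
    smul_mul_assoc]
  rw [Finset.sum_comm]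

/-! Derivatives along curves -/

variable {X' : J → Gr K} {Xt : ℝ → J → Gr K} {t : ℝ}

theorem hasDerivAt_coordG (hd : ∀ j, HasDerivAt (fun s => Xt s j) (X' j) t) (c : J × Fin 2) :
    HasDerivAt (fun s => coordG (Xt s) c) (coordG X' c) t := by
  unfold coordG
  split_ifs
  · exact hd _
  · exact (hd _).gr_conj

theorem hasDerivAt_soul (hd : ∀ j, HasDerivAt (fun s => Xt s j) (X' j) t) (c : J × Fin 2) :
    HasDerivAt (fun s => soul (Xt s) c) (soul X' c) t := by
  unfold soul
  refine (hasDerivAt_coordG hd c).fun_sub ?_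
  simpa using (hasDerivAt_coordG hd c).gr_body.gr_smul (hasDerivAt_const t (1 : Gr K))

theorem hasDerivAt_comp_bodies (hU : IsOpen U) (hf : ContDiffOn ℝ ∞ f U) (hX : bodies (Xt t) ∈ U)
    (hd : ∀ j, HasDerivAt (fun s => Xt s j) (X' j) t) :
    HasDerivAt (fun s => f (bodies (Xt s))) (∑ c, wirt c f (bodies (Xt t)) * Gr.body (coordG X' c))
      t := by
  have h1 : HasDerivAt (fun s => bodies (Xt s)) (bodies X') t :=
    hasDerivAt_pi.2 fun j => (hd j).gr_body
  have h2 := (differentiableAt_of_contDiffOn hU hf hX).hasFDerivAt.comp_hasDerivAt t h1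
  rw [fderiv_eq_sum_wirt] at h2
  simp only [body_coordG]
  exact h2

/-- Moving the bodies differentiates the coefficients and keeps the order; moving the nilpotent
parts removes one factor and lowers the order by one. -/
theorem hasDerivAt_taylorTerm (hU : IsOpen U) (hf : ContDiffOn ℝ ∞ f U) (hX : bodies (Xt t) ∈ U)
    (hXe : ∀ j, (Xt t j).IsEven) (hd : ∀ j, HasDerivAt (fun s => Xt s j) (X' j) t) (k : ℕ) :
    HasDerivAt (fun s => taylorTerm (Xt s) k f)
      (∑ c, Gr.body (coordG X' c) • taylorTerm (Xt t) k (wirt c f) +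
        (k : ℂ) • ∑ c, taylorTerm (Xt t) (k - 1) (wirt c f) * soul X' c) t := by
  induction k generalizing f with
  | zero =>
    simp only [taylorTerm]
    refine ((hasDerivAt_comp_bodies hU hf hX hd).gr_smul
      (hasDerivAt_const t (1 : Gr K))).congr_deriv ?_
    simp [Finset.sum_smul, smul_smul, mul_comm]
  | succ k ih =>
    simp only [taylorTerm]
    have := HasDerivAt.fun_sum (u := Finset.univ) fun c _ =>
      (ih (contDiffOn_wirt hU hf c)).gr_mul (hasDerivAt_soul hd c)
    refine this.congr_deriv (Eq.symm ?_)
    simp only [add_mul, Finset.sum_add_distrib, Finset.sum_mul, smul_mul_assoc, Finset.smul_sum]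
    rw [Nat.cast_succ, Nat.add_sub_cancel, add_assoc]
    congr 1
    · rw [Finset.sum_comm]
      refine Finset.sum_congr rfl fun d _ => Finset.sum_congr rfl fun c _ => ?_
      rw [taylorTerm_congr hU (wirt_comm hU hf d c) hX]
    · simp only [add_smul, one_smul, Finset.sum_add_distrib]
      congr 1
      rcases k with _ | k
      · simp
      · simp only [Nat.add_sub_cancel, taylorTerm, Finset.smul_sum, Finset.sum_mul]
        rw [Finset.sum_comm]
        refine Finset.sum_congr rfl fun d _ => Finset.sum_congr rfl fun c _ => ?_
        rw [taylorTerm_congr hU (wirt_comm hU hf c d) hX, mul_assoc, mul_assoc,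
          (isEven_soul hXe d).comm]

theorem hasDerivAt_superEval (hK : 0 < K) (hU : IsOpen U) (hf : ContDiffOn ℝ ∞ f U)
    (hX : ∀ s, bodies (Xt s) ∈ U) (hXe : ∀ s j, (Xt s j).IsEven)
    (hd : ∀ j, HasDerivAt (fun s => Xt s j) (X' j) t) :
    HasDerivAt (fun s => superEval f (Xt s)) (∑ c, superEval (wirt c f) (Xt t) * coordG X' c) t := by
  simp only [superEval_eq hU hf (hX _)]
  have := HasDerivAt.fun_sum (u := Finset.range (K + 1)) fun k _ =>
    (hasDerivAt_taylorTerm hU hf (hX t) (hXe t) hd k).const_smul ((k.factorial : ℂ)⁻¹)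
  refine this.congr_deriv (Eq.symm ?_)
  simp only [smul_add, Finset.sum_add_distrib]
  rw [sum_range_factorial_shift K fun k => ∑ c, taylorTerm (Xt t) k (wirt c f) * soul X' c]
  simp only [Finset.smul_sum]
  rw [Finset.sum_comm, Finset.sum_comm (s := Finset.range K), ← Finset.sum_add_distrib]
  refine Finset.sum_congr rfl fun c _ => ?_
  -- After the shift of the exponential series the two contributions carry the same coefficient and
  -- combine to the full velocity.
  have e : coordG X' c = Gr.body (coordG X' c) • (1 : Gr K) + soul X' c := by rw [soul]; abel
  conv_lhs => rw [e]
  rw [mul_add, mul_smul_comm, mul_one]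
  congr 1
  · rw [superEval_eq hU (contDiffOn_wirt hU hf c) (hX t), Finset.smul_sum]
    exact Finset.sum_congr rfl fun k _ => smul_comm _ _ _
  · rw [superEval_eq' hK hU (contDiffOn_wirt hU hf c) (hX t) (hXe t), Finset.sum_mul]
    exact Finset.sum_congr rfl fun k _ => smul_mul_assoc _ _ _

/-! Smooth dependence on the soul -/

/-- With the bodies fixed, the Taylor sum is a polynomial in the nilpotent parts and their
conjugates. Smoothness is needed only in this form, because the Lagrangians are differentiated in
velocities at a fixed configuration. -/
theorem contDiff_superEval {E : Type*} [NormedAddCommGroup E] [NormedSpace ℝ E] (hU : IsOpen U)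
    (hf : ContDiffOn ℝ ∞ f U) {x : J → ℂ} (hx : x ∈ U) {Y : E → J → Gr K}
    (hb : ∀ e, bodies (Y e) = x) (hY : ∀ j, ContDiff ℝ ∞ fun e => Y e j) :
    ContDiff ℝ ∞ fun e => superEval f (Y e) := by
  have hs : ∀ c, ContDiff ℝ ∞ fun e => soul (Y e) c := fun c => by
    simp only [soul, body_coordG, hb]
    refine ContDiff.sub ?_ contDiff_const
    unfold coordG
    split_ifs
    · exact hY _
    · exact (hY _).gr_conj
  have hT : ∀ (k : ℕ) (h : (J → ℂ) → ℂ), ContDiff ℝ ∞ fun e => taylorTerm (Y e) k h := by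
    intro k
    induction k with
    | zero => intro h; simp only [taylorTerm, hb]; exact contDiff_const
    | succ k ih => exact fun h => ContDiff.sum fun c _ => (ih _).gr_mul (hs c)
  have : (fun e => superEval f (Y e)) = fun e => ∑ k ∈ Finset.range (K + 1),
      ((k.factorial : ℂ)⁻¹) • taylorTerm (Y e) k f :=
    funext fun e => superEval_eq hU hf (by rw [hb]; exact hx)
  rw [this]
  exact ContDiff.sum fun k _ => (hT k f).const_smul _

/-! Taylor expansion about a point that need not be numerical -/

variable {s : J → Gr K}

theorem coordG_ofReal_smul (r : ℝ) (X : J → Gr K) (c : J × Fin 2) :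
    coordG (fun j => (r : ℂ) • X j) c = (r : ℂ) • coordG X c := by
  unfold coordG
  split_ifs
  · rfl
  · rw [Gr.conj_smul, Complex.conj_ofReal]

theorem eq_of_hasDerivAt_zero {F : ℝ → Gr K} (h : ∀ r, HasDerivAt F 0 r) : F 1 = F 0 :=
  is_const_of_deriv_eq_zero (fun r => (h r).differentiableAt) (fun r => (h r).deriv) 1 0

theorem hasDerivAt_superEval_line (hK : 0 < K) (hU : IsOpen U) (hf : ContDiffOn ℝ ∞ f U)
    (hX : bodies X ∈ U) (hXe : ∀ j, (X j).IsEven) (hs : ∀ j, (s j).IsEven)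
    (hsb : ∀ j, Gr.body (s j) = 0) (r : ℝ) :
    HasDerivAt (fun r : ℝ => superEval f fun j => X j + (r : ℂ) • s j)
      (∑ c, superEval (wirt c f) (fun j => X j + (r : ℂ) • s j) * coordG s c) r := by
  have hb : ∀ r : ℝ, bodies (fun j => X j + (r : ℂ) • s j) = bodies X := fun r => funext fun j => by
    simp only [bodies, Gr.body_add, Gr.body_smul, hsb, mul_zero, add_zero]
  refine hasDerivAt_superEval hK hU hf (fun r => by rw [hb]; exact hX)
    (fun r j => (hXe j).add ((hs j).smul _)) fun j => ?_
  simpa using ((Complex.ofRealCLM.hasDerivAt (x := r)).gr_smul (hasDerivAt_const r (s j))).const_add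
    (X j)

/-- Along the segment `r ↦ X + r s` every term of the derivative contains a factor `coordG s c`,
which `y` kills, so the value at `r = 1` is the value at `r = 0`. The factor `y` is what makes the
next two expansions follow by iteration. -/
theorem superEval_taylor_zero (hK : 0 < K) (hU : IsOpen U) (hf : ContDiffOn ℝ ∞ f U)
    (hX : bodies X ∈ U) (hXe : ∀ j, (X j).IsEven) (hs : ∀ j, (s j).IsEven)
    (hsb : ∀ j, Gr.body (s j) = 0) (y : Gr K) (hy : ∀ c, coordG s c * y = 0) :
    superEval f (fun j => X j + s j) * y = superEval f X * y := by
  have := eq_of_hasDerivAt_zero (F := fun r : ℝ => superEval f (fun j => X j + (r : ℂ) • s j) * y)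
    fun r => by
      refine ((hasDerivAt_superEval_line hK hU hf hX hXe hs hsb r).gr_mul_const y).congr_deriv ?_
      simp [Finset.sum_mul, mul_assoc, hy]
  simpa using this

/-- The difference of the two sides is differentiated along the segment; the result vanishes by the
expansion of order zero with `coordG s c * y` in place of `y`. -/
theorem superEval_taylor_one (hK : 0 < K) (hU : IsOpen U) (hf : ContDiffOn ℝ ∞ f U)
    (hX : bodies X ∈ U) (hXe : ∀ j, (X j).IsEven) (hs : ∀ j, (s j).IsEven)
    (hsb : ∀ j, Gr.body (s j) = 0) (y : Gr K)
    (hy : ∀ c d, coordG s c * (coordG s d * y) = 0) :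
    superEval f (fun j => X j + s j) * y =
      superEval f X * y + ∑ c, superEval (wirt c f) X * (coordG s c * y) := by
  have := eq_of_hasDerivAt_zero (F := fun r : ℝ =>
    superEval f (fun j => X j + (r : ℂ) • s j) * y -
      (r : ℂ) • ∑ c, superEval (wirt c f) X * (coordG s c * y))
    fun r => by
      refine (((hasDerivAt_superEval_line hK hU hf hX hXe hs hsb r).gr_mul_const y).fun_sub
        ((Complex.ofRealCLM.hasDerivAt (x := r)).gr_smul (hasDerivAt_const r
          (∑ c, superEval (wirt c f) X * (coordG s c * y))))).congr_deriv ?_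
      simp only [Finset.sum_mul, mul_assoc, smul_zero, add_zero, Complex.ofRealCLM_apply,
        Complex.ofReal_one, one_smul]
      rw [← Finset.sum_sub_distrib]
      refine Finset.sum_eq_zero fun c _ => sub_eq_zero.2 ?_
      refine superEval_taylor_zero hK hU (contDiffOn_wirt hU hf c) hX hXe (fun j => (hs j).smul _)
        (fun j => by rw [Gr.body_smul, hsb, mul_zero]) _ fun d => ?_
      rw [coordG_ofReal_smul, smul_mul_assoc, hy, smul_zero]
  simp only [Complex.ofReal_one, one_smul, Complex.ofReal_zero, zero_smul, add_zero, sub_zero]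
    at this
  rw [← this, sub_add_cancel]

/-- Same argument, with the expansion of order one applied to the first derivatives and `y = coordG
s c`. -/
theorem superEval_taylor_two (hK : 0 < K) (hU : IsOpen U) (hf : ContDiffOn ℝ ∞ f U)
    (hX : bodies X ∈ U) (hXe : ∀ j, (X j).IsEven) (hs : ∀ j, (s j).IsEven)
    (hsb : ∀ j, Gr.body (s j) = 0)
    (hy : ∀ c d e, coordG s c * (coordG s d * coordG s e) = 0) :
    superEval f (fun j => X j + s j) =
      superEval f X + ∑ c, superEval (wirt c f) X * coordG s c +
        (1 / 2 : ℂ) • ∑ c, ∑ d, superEval (wirt d (wirt c f)) X * (coordG s d * coordG s c) := by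
  have hsq : ∀ r : ℝ, HasDerivAt (fun r : ℝ => ((r : ℂ) ^ 2) / 2) (r : ℂ) r := fun r => by
    refine (((Complex.ofRealCLM.hasDerivAt (x := r)).fun_pow 2).div_const 2).congr_deriv ?_
    simp
  have := eq_of_hasDerivAt_zero (F := fun r : ℝ =>
    superEval f (fun j => X j + (r : ℂ) • s j) -
      (r : ℂ) • (∑ c, superEval (wirt c f) X * coordG s c) - (((r : ℂ) ^ 2) / 2) •
        ∑ c, ∑ d, superEval (wirt d (wirt c f)) X * (coordG s d * coordG s c))
    fun r => by
      refine (((hasDerivAt_superEval_line hK hU hf hX hXe hs hsb r).fun_sub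
        ((Complex.ofRealCLM.hasDerivAt (x := r)).gr_smul (hasDerivAt_const r
          (∑ c, superEval (wirt c f) X * coordG s c)))).fun_sub
        ((hsq r).gr_smul (hasDerivAt_const r
          (∑ c, ∑ d, superEval (wirt d (wirt c f)) X * (coordG s d * coordG s c))))).congr_deriv ?_
      simp only [smul_zero, add_zero, Complex.ofRealCLM_apply, Complex.ofReal_one, one_smul,
        Finset.smul_sum]
      rw [← Finset.sum_sub_distrib, ← Finset.sum_sub_distrib]
      refine Finset.sum_eq_zero fun c _ => ?_
      rw [superEval_taylor_one hK hU (contDiffOn_wirt hU hf c) hX hXe (fun j => (hs j).smul _)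
        (fun j => by rw [Gr.body_smul, hsb, mul_zero]) _ fun d e => by
          rw [coordG_ofReal_smul, coordG_ofReal_smul, smul_mul_assoc, smul_mul_assoc,
            mul_smul_comm, hy, smul_zero, smul_zero]]
      simp only [coordG_ofReal_smul, smul_mul_assoc, mul_smul_comm]
      abel
  simp only [Complex.ofReal_one, one_smul, Complex.ofReal_zero, zero_smul, add_zero, sub_zero,
    one_pow, zero_pow (two_ne_zero), zero_div] at this
  rw [← this]
  abel

end SuperCalculus

end

end BiHKT

namespace BiHKT

noncomputable section

/-! ### Algebra of the odd coordinates -/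

namespace Gr

variable {K : ℕ}

/-- Odd derivations of the Grassmann algebra. -/
structure IsOddDer (D : Gr K → Gr K) : Prop where
  add : ∀ f g, D (f + g) = D f + D g
  smul : ∀ (c : ℂ) f, D (c • f) = c • D f
  mul : ∀ f g, D (f * g) = D f * g + par f * D g

theorem isOddDer_pd (i : Fin K) : IsOddDer (pd i) := ⟨pd_add i, pd_smul i, pd_mul i⟩

namespace IsOddDer

variable {D D' : Gr K → Gr K}

theorem combination (hD : IsOddDer D) (hD' : IsOddDer D') (a b : ℂ) :
    IsOddDer fun f => a • (D f + b • D' f) where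
  add f g := by rw [hD.add, hD'.add]; module
  smul c f := by rw [hD.smul, hD'.smul]; module
  mul f g := by
    rw [hD.mul, hD'.mul]
    simp only [mul_smul_comm, smul_mul_assoc, mul_add, add_mul]
    module

theorem zero (hD : IsOddDer D) : D 0 = 0 := by simpa using hD.smul 0 0

theorem neg (hD : IsOddDer D) (f : Gr K) : D (-f) = -D f := by simpa using hD.smul (-1) f

theorem sub (hD : IsOddDer D) (f g : Gr K) : D (f - g) = D f - D g := by
  rw [sub_eq_add_neg, hD.add, hD.neg, ← sub_eq_add_neg]

theorem sum (hD : IsOddDer D) {ι : Type*} (s : Finset ι) (F : ι → Gr K) :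
    D (∑ i ∈ s, F i) = ∑ i ∈ s, D (F i) :=
  map_sum (⟨⟨D, hD.zero⟩, hD.add⟩ : Gr K →+ Gr K) F s

theorem one (hD : IsOddDer D) : D 1 = 0 := by
  have h := hD.mul 1 1
  rw [par_one, one_mul, mul_one, one_mul] at h
  simpa using h

theorem evenDer (hD : IsOddDer D) : EvenDer D :=
  ⟨hD.add, hD.smul, fun a b ha _ => by rw [hD.mul, ha.par_eq], hD.one⟩

theorem odd_mul (hD : IsOddDer D) {e : Gr K} (he : IsOdd e) (f : Gr K) :
    D (e * f) = D e * f - e * D f := by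
  rw [hD.mul, he.par_eq, neg_mul, sub_eq_add_neg]

end IsOddDer

/-- Stated for arbitrary combinations so that it yields every anticommutator of `∂_θ`, `∂_θ̄`,
`∂_η`, `∂_η̄`; equal operators give a square equal to its own negative. -/
theorem pd_combination_anticomm (i j k l : Fin K) (b d : ℂ) (f : Gr K) :
    (1 / 2 : ℂ) • (pd i ((1 / 2 : ℂ) • (pd k f + d • pd l f)) +
        b • pd j ((1 / 2 : ℂ) • (pd k f + d • pd l f))) =
      -((1 / 2 : ℂ) • (pd k ((1 / 2 : ℂ) • (pd i f + b • pd j f)) +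
        d • pd l ((1 / 2 : ℂ) • (pd i f + b • pd j f)))) := by
  simp only [pd_smul, pd_add]
  rw [pd_pd i k, pd_pd i l, pd_pd j k, pd_pd j l]
  module

/-- Rescaling of an odd coordinate `e` with derivative `D`. -/
def rescale (e : Gr K) (D : Gr K → Gr K) (c : ℂ) (f : Gr K) : Gr K := f + (c - 1) • (e * D f)

/-- The only term that could spoil multiplicativity is `e D f · e D g`, which contains `e` twice. -/
theorem rescale_mul {e : Gr K} {D : Gr K → Gr K} (he : IsOdd e) (hD : IsOddDer D) (c : ℂ)
    (f g : Gr K) : rescale e D c (f * g) = rescale e D c f * rescale e D c g := by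
  have h0 : e * D f * (e * D g) = 0 := by
    have : D f * e = e * par (D f) := by rw [he.comm, par_par]
    rw [mul_assoc, ← mul_assoc (D f), this, mul_assoc e, ← mul_assoc e, he.mul_self, zero_mul]
  have h1 : e * (par f * D g) = f * (e * D g) := by
    rw [← mul_assoc, he.comm, par_par, mul_assoc]
  unfold rescale
  rw [hD.mul, mul_add, h1, add_mul, mul_add, mul_add, smul_mul_smul_comm, h0, smul_zero, add_zero,
    smul_mul_assoc, mul_smul_comm, mul_assoc e, smul_add]
  abel

end Gr

section Superspace

open Gr

variable {N : ℕ}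

theorem isOdd_theta : IsOdd (theta N) := (isOdd_gen _).add ((isOdd_gen _).smul _)

theorem isOdd_thetaBar : IsOdd (thetaBar N) := (isOdd_gen _).sub ((isOdd_gen _).smul _)

theorem isOdd_eta : IsOdd (eta N) := (isOdd_gen _).add ((isOdd_gen _).smul _)

theorem isOdd_etaBar : IsOdd (etaBar N) := (isOdd_gen _).sub ((isOdd_gen _).smul _)

theorem dTheta_eq (f : Gr (4 + N)) :
    dTheta f = (1 / 2 : ℂ) • (pd (Fin.castAdd N 0) f + (-Complex.I) • pd (Fin.castAdd N 1) f) := by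
  simp [dTheta, pdTau, sub_eq_add_neg]

theorem isOddDer_dTheta : IsOddDer (dTheta : Gr (4 + N) → Gr (4 + N)) := by
  rw [show (dTheta : Gr (4 + N) → Gr (4 + N)) = _ from funext dTheta_eq]
  exact (isOddDer_pd _).combination (isOddDer_pd _) _ _

theorem dThetaBar_eq (f : Gr (4 + N)) :
    dThetaBar f = (1 / 2 : ℂ) • (pd (Fin.castAdd N 0) f + (Complex.I) • pd (Fin.castAdd N 1) f) := by
  simp [dThetaBar, pdTau, sub_eq_add_neg]

theorem isOddDer_dThetaBar : IsOddDer (dThetaBar : Gr (4 + N) → Gr (4 + N)) := by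
  rw [show (dThetaBar : Gr (4 + N) → Gr (4 + N)) = _ from funext dThetaBar_eq]
  exact (isOddDer_pd _).combination (isOddDer_pd _) _ _

theorem dEta_eq (f : Gr (4 + N)) :
    dEta f = (1 / 2 : ℂ) • (pd (Fin.castAdd N 2) f + (-Complex.I) • pd (Fin.castAdd N 3) f) := by
  simp [dEta, pdTau, sub_eq_add_neg]

theorem isOddDer_dEta : IsOddDer (dEta : Gr (4 + N) → Gr (4 + N)) := by
  rw [show (dEta : Gr (4 + N) → Gr (4 + N)) = _ from funext dEta_eq]
  exact (isOddDer_pd _).combination (isOddDer_pd _) _ _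

theorem dEtaBar_eq (f : Gr (4 + N)) :
    dEtaBar f = (1 / 2 : ℂ) • (pd (Fin.castAdd N 2) f + (Complex.I) • pd (Fin.castAdd N 3) f) := by
  simp [dEtaBar, pdTau, sub_eq_add_neg]

theorem isOddDer_dEtaBar : IsOddDer (dEtaBar : Gr (4 + N) → Gr (4 + N)) := by
  rw [show (dEtaBar : Gr (4 + N) → Gr (4 + N)) = _ from funext dEtaBar_eq]
  exact (isOddDer_pd _).combination (isOddDer_pd _) _ _

theorem pd_castAdd_tau (k l : Fin 4) :
    pd (Fin.castAdd N k) (tau N l) = if k = l then 1 else 0 := by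
  rw [tau, pd_gen]
  simp only [Fin.castAdd_inj]

@[simp] theorem dTheta_theta : dTheta (theta N) = 1 := by
  simp only [dTheta_eq, theta, pd_add, sub_eq_add_neg, ← neg_smul, pd_smul, pd_castAdd_tau,
    Fin.reduceEq, if_true, if_false, smul_zero, add_zero, smul_smul, zero_add, ← add_smul]
  norm_num [mul_assoc, smul_smul, ← add_smul]
  rw [← one_add_one_eq_two (R := Gr (4 + N))]; module

@[simp] theorem dTheta_thetaBar : dTheta (thetaBar N) = 0 := by
  simp only [dTheta_eq, thetaBar, pd_add, sub_eq_add_neg, ← neg_smul, pd_smul, pd_castAdd_tau,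
    Fin.reduceEq, if_true, if_false, smul_zero, add_zero, smul_smul, zero_add, ← add_smul]
  norm_num [mul_assoc, smul_smul, ← add_smul]

@[simp] theorem dTheta_eta : dTheta (eta N) = 0 := by
  simp only [dTheta_eq, eta, pd_add, sub_eq_add_neg, ← neg_smul, pd_smul, pd_castAdd_tau,
    Fin.reduceEq, if_true, if_false, smul_zero, add_zero, smul_smul, zero_add, ← add_smul]

@[simp] theorem dTheta_etaBar : dTheta (etaBar N) = 0 := by
  simp only [dTheta_eq, etaBar, pd_add, sub_eq_add_neg, ← neg_smul, pd_smul, pd_castAdd_tau,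
    Fin.reduceEq, if_true, if_false, smul_zero, add_zero, smul_smul, zero_add, ← add_smul]

@[simp] theorem dThetaBar_theta : dThetaBar (theta N) = 0 := by
  simp only [dThetaBar_eq, theta, pd_add, sub_eq_add_neg, ← neg_smul, pd_smul, pd_castAdd_tau,
    Fin.reduceEq, if_true, if_false, smul_zero, add_zero, smul_smul, zero_add, ← add_smul]
  norm_num [mul_assoc, smul_smul, ← add_smul]

@[simp] theorem dThetaBar_thetaBar : dThetaBar (thetaBar N) = 1 := by
  simp only [dThetaBar_eq, thetaBar, pd_add, sub_eq_add_neg, ← neg_smul, pd_smul, pd_castAdd_tau,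
    Fin.reduceEq, if_true, if_false, smul_zero, add_zero, smul_smul, zero_add, ← add_smul]
  norm_num [mul_assoc, smul_smul, ← add_smul]
  rw [← one_add_one_eq_two (R := Gr (4 + N))]; module

@[simp] theorem dThetaBar_eta : dThetaBar (eta N) = 0 := by
  simp only [dThetaBar_eq, eta, pd_add, sub_eq_add_neg, ← neg_smul, pd_smul, pd_castAdd_tau,
    Fin.reduceEq, if_true, if_false, smul_zero, add_zero, smul_smul, zero_add, ← add_smul]

@[simp] theorem dThetaBar_etaBar : dThetaBar (etaBar N) = 0 := by
  simp only [dThetaBar_eq, etaBar, pd_add, sub_eq_add_neg, ← neg_smul, pd_smul, pd_castAdd_tau,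
    Fin.reduceEq, if_true, if_false, smul_zero, add_zero, smul_smul, zero_add, ← add_smul]

@[simp] theorem dEta_theta : dEta (theta N) = 0 := by
  simp only [dEta_eq, theta, pd_add, sub_eq_add_neg, ← neg_smul, pd_smul, pd_castAdd_tau,
    Fin.reduceEq, if_true, if_false, smul_zero, add_zero, smul_smul, zero_add, ← add_smul]

@[simp] theorem dEta_thetaBar : dEta (thetaBar N) = 0 := by
  simp only [dEta_eq, thetaBar, pd_add, sub_eq_add_neg, ← neg_smul, pd_smul, pd_castAdd_tau,
    Fin.reduceEq, if_true, if_false, smul_zero, add_zero, smul_smul, zero_add, ← add_smul]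

@[simp] theorem dEta_eta : dEta (eta N) = 1 := by
  simp only [dEta_eq, eta, pd_add, sub_eq_add_neg, ← neg_smul, pd_smul, pd_castAdd_tau,
    Fin.reduceEq, if_true, if_false, smul_zero, add_zero, smul_smul, zero_add, ← add_smul]
  norm_num [mul_assoc, smul_smul, ← add_smul]
  rw [← one_add_one_eq_two (R := Gr (4 + N))]; module

@[simp] theorem dEta_etaBar : dEta (etaBar N) = 0 := by
  simp only [dEta_eq, etaBar, pd_add, sub_eq_add_neg, ← neg_smul, pd_smul, pd_castAdd_tau,
    Fin.reduceEq, if_true, if_false, smul_zero, add_zero, smul_smul, zero_add, ← add_smul]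
  norm_num [mul_assoc, smul_smul, ← add_smul]

@[simp] theorem dEtaBar_theta : dEtaBar (theta N) = 0 := by
  simp only [dEtaBar_eq, theta, pd_add, sub_eq_add_neg, ← neg_smul, pd_smul, pd_castAdd_tau,
    Fin.reduceEq, if_true, if_false, smul_zero, add_zero, smul_smul, zero_add, ← add_smul]

@[simp] theorem dEtaBar_thetaBar : dEtaBar (thetaBar N) = 0 := by
  simp only [dEtaBar_eq, thetaBar, pd_add, sub_eq_add_neg, ← neg_smul, pd_smul, pd_castAdd_tau,
    Fin.reduceEq, if_true, if_false, smul_zero, add_zero, smul_smul, zero_add, ← add_smul]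

@[simp] theorem dEtaBar_eta : dEtaBar (eta N) = 0 := by
  simp only [dEtaBar_eq, eta, pd_add, sub_eq_add_neg, ← neg_smul, pd_smul, pd_castAdd_tau,
    Fin.reduceEq, if_true, if_false, smul_zero, add_zero, smul_smul, zero_add, ← add_smul]
  norm_num [mul_assoc, smul_smul, ← add_smul]

@[simp] theorem dEtaBar_etaBar : dEtaBar (etaBar N) = 1 := by
  simp only [dEtaBar_eq, etaBar, pd_add, sub_eq_add_neg, ← neg_smul, pd_smul, pd_castAdd_tau,
    Fin.reduceEq, if_true, if_false, smul_zero, add_zero, smul_smul, zero_add, ← add_smul]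
  norm_num [mul_assoc, smul_smul, ← add_smul]
  rw [← one_add_one_eq_two (R := Gr (4 + N))]; module

@[simp] theorem dTheta_add (f g : Gr (4 + N)) : dTheta (f + g) = dTheta f + dTheta g := isOddDer_dTheta.add f g
@[simp] theorem dTheta_sub (f g : Gr (4 + N)) : dTheta (f - g) = dTheta f - dTheta g := isOddDer_dTheta.sub f g
@[simp] theorem dTheta_neg (f : Gr (4 + N)) : dTheta (-f) = -dTheta f := isOddDer_dTheta.neg f
@[simp] theorem dTheta_smul (c : ℂ) (f : Gr (4 + N)) : dTheta (c • f) = c • dTheta f := isOddDer_dTheta.smul c f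
@[simp] theorem dTheta_zero : dTheta (0 : Gr (4 + N)) = 0 := isOddDer_dTheta.zero
@[simp] theorem dTheta_sum {ι : Type*} (s : Finset ι) (F : ι → Gr (4 + N)) :
    dTheta (∑ i ∈ s, F i) = ∑ i ∈ s, dTheta (F i) := isOddDer_dTheta.sum s F

@[simp] theorem dTheta_theta_mul (f : Gr (4 + N)) : dTheta (theta N * f) = f - theta N * dTheta f := by
  rw [isOddDer_dTheta.odd_mul isOdd_theta, dTheta_theta]; simp

@[simp] theorem dTheta_thetaBar_mul (f : Gr (4 + N)) : dTheta (thetaBar N * f) = -(thetaBar N * dTheta f) := by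
  rw [isOddDer_dTheta.odd_mul isOdd_thetaBar, dTheta_thetaBar]; simp

@[simp] theorem dTheta_eta_mul (f : Gr (4 + N)) : dTheta (eta N * f) = -(eta N * dTheta f) := by
  rw [isOddDer_dTheta.odd_mul isOdd_eta, dTheta_eta]; simp

@[simp] theorem dTheta_etaBar_mul (f : Gr (4 + N)) : dTheta (etaBar N * f) = -(etaBar N * dTheta f) := by
  rw [isOddDer_dTheta.odd_mul isOdd_etaBar, dTheta_etaBar]; simp

@[simp] theorem dThetaBar_add (f g : Gr (4 + N)) : dThetaBar (f + g) = dThetaBar f + dThetaBar g := isOddDer_dThetaBar.add f g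
@[simp] theorem dThetaBar_sub (f g : Gr (4 + N)) : dThetaBar (f - g) = dThetaBar f - dThetaBar g := isOddDer_dThetaBar.sub f g
@[simp] theorem dThetaBar_neg (f : Gr (4 + N)) : dThetaBar (-f) = -dThetaBar f := isOddDer_dThetaBar.neg f
@[simp] theorem dThetaBar_smul (c : ℂ) (f : Gr (4 + N)) : dThetaBar (c • f) = c • dThetaBar f := isOddDer_dThetaBar.smul c f
@[simp] theorem dThetaBar_zero : dThetaBar (0 : Gr (4 + N)) = 0 := isOddDer_dThetaBar.zero
@[simp] theorem dThetaBar_sum {ι : Type*} (s : Finset ι) (F : ι → Gr (4 + N)) :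
    dThetaBar (∑ i ∈ s, F i) = ∑ i ∈ s, dThetaBar (F i) := isOddDer_dThetaBar.sum s F

@[simp] theorem dThetaBar_theta_mul (f : Gr (4 + N)) : dThetaBar (theta N * f) = -(theta N * dThetaBar f) := by
  rw [isOddDer_dThetaBar.odd_mul isOdd_theta, dThetaBar_theta]; simp

@[simp] theorem dThetaBar_thetaBar_mul (f : Gr (4 + N)) : dThetaBar (thetaBar N * f) = f - thetaBar N * dThetaBar f := by
  rw [isOddDer_dThetaBar.odd_mul isOdd_thetaBar, dThetaBar_thetaBar]; simp

@[simp] theorem dThetaBar_eta_mul (f : Gr (4 + N)) : dThetaBar (eta N * f) = -(eta N * dThetaBar f) := by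
  rw [isOddDer_dThetaBar.odd_mul isOdd_eta, dThetaBar_eta]; simp

@[simp] theorem dThetaBar_etaBar_mul (f : Gr (4 + N)) : dThetaBar (etaBar N * f) = -(etaBar N * dThetaBar f) := by
  rw [isOddDer_dThetaBar.odd_mul isOdd_etaBar, dThetaBar_etaBar]; simp

@[simp] theorem dEta_add (f g : Gr (4 + N)) : dEta (f + g) = dEta f + dEta g := isOddDer_dEta.add f g
@[simp] theorem dEta_sub (f g : Gr (4 + N)) : dEta (f - g) = dEta f - dEta g := isOddDer_dEta.sub f g
@[simp] theorem dEta_neg (f : Gr (4 + N)) : dEta (-f) = -dEta f := isOddDer_dEta.neg f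
@[simp] theorem dEta_smul (c : ℂ) (f : Gr (4 + N)) : dEta (c • f) = c • dEta f := isOddDer_dEta.smul c f
@[simp] theorem dEta_zero : dEta (0 : Gr (4 + N)) = 0 := isOddDer_dEta.zero
@[simp] theorem dEta_sum {ι : Type*} (s : Finset ι) (F : ι → Gr (4 + N)) :
    dEta (∑ i ∈ s, F i) = ∑ i ∈ s, dEta (F i) := isOddDer_dEta.sum s F

@[simp] theorem dEta_theta_mul (f : Gr (4 + N)) : dEta (theta N * f) = -(theta N * dEta f) := by
  rw [isOddDer_dEta.odd_mul isOdd_theta, dEta_theta]; simp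

@[simp] theorem dEta_thetaBar_mul (f : Gr (4 + N)) : dEta (thetaBar N * f) = -(thetaBar N * dEta f) := by
  rw [isOddDer_dEta.odd_mul isOdd_thetaBar, dEta_thetaBar]; simp

@[simp] theorem dEta_eta_mul (f : Gr (4 + N)) : dEta (eta N * f) = f - eta N * dEta f := by
  rw [isOddDer_dEta.odd_mul isOdd_eta, dEta_eta]; simp

@[simp] theorem dEta_etaBar_mul (f : Gr (4 + N)) : dEta (etaBar N * f) = -(etaBar N * dEta f) := by
  rw [isOddDer_dEta.odd_mul isOdd_etaBar, dEta_etaBar]; simp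

@[simp] theorem dEtaBar_add (f g : Gr (4 + N)) : dEtaBar (f + g) = dEtaBar f + dEtaBar g := isOddDer_dEtaBar.add f g
@[simp] theorem dEtaBar_sub (f g : Gr (4 + N)) : dEtaBar (f - g) = dEtaBar f - dEtaBar g := isOddDer_dEtaBar.sub f g
@[simp] theorem dEtaBar_neg (f : Gr (4 + N)) : dEtaBar (-f) = -dEtaBar f := isOddDer_dEtaBar.neg f
@[simp] theorem dEtaBar_smul (c : ℂ) (f : Gr (4 + N)) : dEtaBar (c • f) = c • dEtaBar f := isOddDer_dEtaBar.smul c f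
@[simp] theorem dEtaBar_sum {ι : Type*} (s : Finset ι) (F : ι → Gr (4 + N)) :
    dEtaBar (∑ i ∈ s, F i) = ∑ i ∈ s, dEtaBar (F i) := isOddDer_dEtaBar.sum s F

@[simp] theorem dEtaBar_theta_mul (f : Gr (4 + N)) : dEtaBar (theta N * f) = -(theta N * dEtaBar f) := by
  rw [isOddDer_dEtaBar.odd_mul isOdd_theta, dEtaBar_theta]; simp

@[simp] theorem dEtaBar_thetaBar_mul (f : Gr (4 + N)) : dEtaBar (thetaBar N * f) = -(thetaBar N * dEtaBar f) := by
  rw [isOddDer_dEtaBar.odd_mul isOdd_thetaBar, dEtaBar_thetaBar]; simp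

@[simp] theorem dEtaBar_eta_mul (f : Gr (4 + N)) : dEtaBar (eta N * f) = -(eta N * dEtaBar f) := by
  rw [isOddDer_dEtaBar.odd_mul isOdd_eta, dEtaBar_eta]; simp

@[simp] theorem dEtaBar_etaBar_mul (f : Gr (4 + N)) : dEtaBar (etaBar N * f) = f - etaBar N * dEtaBar f := by
  rw [isOddDer_dEtaBar.odd_mul isOdd_etaBar, dEtaBar_etaBar]; simp

@[simp] theorem theta_sq : theta N * theta N = 0 := isOdd_theta.mul_self
@[simp] theorem theta_sq_mul (f : Gr (4 + N)) : theta N * (theta N * f) = 0 := by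
  rw [← mul_assoc, theta_sq, zero_mul]

@[simp] theorem thetaBar_sq : thetaBar N * thetaBar N = 0 := isOdd_thetaBar.mul_self
@[simp] theorem thetaBar_sq_mul (f : Gr (4 + N)) : thetaBar N * (thetaBar N * f) = 0 := by
  rw [← mul_assoc, thetaBar_sq, zero_mul]

@[simp] theorem thetaBar_mul_theta : thetaBar N * theta N = -(theta N * thetaBar N) := by
  rw [isOdd_thetaBar.comm, isOdd_theta.par_eq, neg_mul]
@[simp] theorem thetaBar_mul_theta_mul (f : Gr (4 + N)) :
    thetaBar N * (theta N * f) = -(theta N * (thetaBar N * f)) := by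
  rw [← mul_assoc, thetaBar_mul_theta, neg_mul, mul_assoc]

@[simp] theorem eta_sq : eta N * eta N = 0 := isOdd_eta.mul_self
@[simp] theorem eta_sq_mul (f : Gr (4 + N)) : eta N * (eta N * f) = 0 := by
  rw [← mul_assoc, eta_sq, zero_mul]

@[simp] theorem eta_mul_theta : eta N * theta N = -(theta N * eta N) := by
  rw [isOdd_eta.comm, isOdd_theta.par_eq, neg_mul]
@[simp] theorem eta_mul_theta_mul (f : Gr (4 + N)) :
    eta N * (theta N * f) = -(theta N * (eta N * f)) := by
  rw [← mul_assoc, eta_mul_theta, neg_mul, mul_assoc]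

@[simp] theorem eta_mul_thetaBar : eta N * thetaBar N = -(thetaBar N * eta N) := by
  rw [isOdd_eta.comm, isOdd_thetaBar.par_eq, neg_mul]
@[simp] theorem eta_mul_thetaBar_mul (f : Gr (4 + N)) :
    eta N * (thetaBar N * f) = -(thetaBar N * (eta N * f)) := by
  rw [← mul_assoc, eta_mul_thetaBar, neg_mul, mul_assoc]

@[simp] theorem etaBar_sq : etaBar N * etaBar N = 0 := isOdd_etaBar.mul_self
@[simp] theorem etaBar_sq_mul (f : Gr (4 + N)) : etaBar N * (etaBar N * f) = 0 := by
  rw [← mul_assoc, etaBar_sq, zero_mul]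

@[simp] theorem etaBar_mul_theta : etaBar N * theta N = -(theta N * etaBar N) := by
  rw [isOdd_etaBar.comm, isOdd_theta.par_eq, neg_mul]
@[simp] theorem etaBar_mul_theta_mul (f : Gr (4 + N)) :
    etaBar N * (theta N * f) = -(theta N * (etaBar N * f)) := by
  rw [← mul_assoc, etaBar_mul_theta, neg_mul, mul_assoc]

@[simp] theorem etaBar_mul_thetaBar : etaBar N * thetaBar N = -(thetaBar N * etaBar N) := by
  rw [isOdd_etaBar.comm, isOdd_thetaBar.par_eq, neg_mul]
@[simp] theorem etaBar_mul_thetaBar_mul (f : Gr (4 + N)) :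
    etaBar N * (thetaBar N * f) = -(thetaBar N * (etaBar N * f)) := by
  rw [← mul_assoc, etaBar_mul_thetaBar, neg_mul, mul_assoc]

@[simp] theorem etaBar_mul_eta : etaBar N * eta N = -(eta N * etaBar N) := by
  rw [isOdd_etaBar.comm, isOdd_eta.par_eq, neg_mul]
@[simp] theorem etaBar_mul_eta_mul (f : Gr (4 + N)) :
    etaBar N * (eta N * f) = -(eta N * (etaBar N * f)) := by
  rw [← mul_assoc, etaBar_mul_eta, neg_mul, mul_assoc]

theorem eq_zero_of_eq_neg {f : Gr (4 + N)} (h : f = -f) : f = 0 := by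
  have h2 : (2 : ℂ) • f = 0 := by rw [two_smul]; nth_rewrite 1 [h]; simp
  exact (smul_eq_zero.1 h2).resolve_left two_ne_zero

@[simp] theorem dTheta_dTheta (f : Gr (4 + N)) : dTheta (dTheta f) = 0 := by
  refine eq_zero_of_eq_neg ?_
  simp only [dTheta_eq]; exact pd_combination_anticomm _ _ _ _ _ _ f

@[simp] theorem dThetaBar_dTheta (f : Gr (4 + N)) :
    dThetaBar (dTheta f) = -dTheta (dThetaBar f) := by
  simp only [dThetaBar_eq, dTheta_eq]; exact pd_combination_anticomm _ _ _ _ _ _ f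

@[simp] theorem dThetaBar_dThetaBar (f : Gr (4 + N)) : dThetaBar (dThetaBar f) = 0 := by
  refine eq_zero_of_eq_neg ?_
  simp only [dThetaBar_eq]; exact pd_combination_anticomm _ _ _ _ _ _ f

@[simp] theorem dEta_dTheta (f : Gr (4 + N)) :
    dEta (dTheta f) = -dTheta (dEta f) := by
  simp only [dEta_eq, dTheta_eq]; exact pd_combination_anticomm _ _ _ _ _ _ f

@[simp] theorem dEta_dThetaBar (f : Gr (4 + N)) :
    dEta (dThetaBar f) = -dThetaBar (dEta f) := by
  simp only [dEta_eq, dThetaBar_eq]; exact pd_combination_anticomm _ _ _ _ _ _ f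

@[simp] theorem dEta_dEta (f : Gr (4 + N)) : dEta (dEta f) = 0 := by
  refine eq_zero_of_eq_neg ?_
  simp only [dEta_eq]; exact pd_combination_anticomm _ _ _ _ _ _ f

@[simp] theorem dEtaBar_dTheta (f : Gr (4 + N)) :
    dEtaBar (dTheta f) = -dTheta (dEtaBar f) := by
  simp only [dEtaBar_eq, dTheta_eq]; exact pd_combination_anticomm _ _ _ _ _ _ f

@[simp] theorem dEtaBar_dThetaBar (f : Gr (4 + N)) :
    dEtaBar (dThetaBar f) = -dThetaBar (dEtaBar f) := by
  simp only [dEtaBar_eq, dThetaBar_eq]; exact pd_combination_anticomm _ _ _ _ _ _ f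

@[simp] theorem dEtaBar_dEta (f : Gr (4 + N)) :
    dEtaBar (dEta f) = -dEta (dEtaBar f) := by
  simp only [dEtaBar_eq, dEta_eq]; exact pd_combination_anticomm _ _ _ _ _ _ f

@[simp] theorem dEtaBar_dEtaBar (f : Gr (4 + N)) : dEtaBar (dEtaBar f) = 0 := by
  refine eq_zero_of_eq_neg ?_
  simp only [dEtaBar_eq]; exact pd_combination_anticomm _ _ _ _ _ _ f

@[simp] theorem conj_theta : conj (theta N) = thetaBar N := by
  simp [theta, thetaBar, tau, conj_add, conj_sub, conj_smul, conj_gen, sub_eq_add_neg, conj_neg]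
@[simp] theorem par_theta_mul (f : Gr (4 + N)) : par (theta N * f) = -(theta N * par f) := by
  rw [par_mul, isOdd_theta.par_eq, neg_mul]
@[simp] theorem conj_theta_mul (f : Gr (4 + N)) : conj (theta N * f) = thetaBar N * par (conj f) := by
  rw [conj_mul, conj_theta, isOdd_thetaBar.comm, par_par]
@[simp] theorem body_theta_mul (f : Gr (4 + N)) : body (theta N * f) = 0 := by
  rw [body_mul, show body (theta N) = 0 from isOdd_theta ∅ (by simp), zero_mul]

@[simp] theorem conj_thetaBar : conj (thetaBar N) = theta N := by
  simp [thetaBar, theta, tau, conj_add, conj_sub, conj_smul, conj_gen, sub_eq_add_neg, conj_neg]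
@[simp] theorem par_thetaBar_mul (f : Gr (4 + N)) : par (thetaBar N * f) = -(thetaBar N * par f) := by
  rw [par_mul, isOdd_thetaBar.par_eq, neg_mul]
@[simp] theorem conj_thetaBar_mul (f : Gr (4 + N)) : conj (thetaBar N * f) = theta N * par (conj f) := by
  rw [conj_mul, conj_thetaBar, isOdd_theta.comm, par_par]
@[simp] theorem body_thetaBar_mul (f : Gr (4 + N)) : body (thetaBar N * f) = 0 := by
  rw [body_mul, show body (thetaBar N) = 0 from isOdd_thetaBar ∅ (by simp), zero_mul]

@[simp] theorem conj_eta : conj (eta N) = etaBar N := by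
  simp [eta, etaBar, tau, conj_add, conj_sub, conj_smul, conj_gen, sub_eq_add_neg, conj_neg]
@[simp] theorem par_eta_mul (f : Gr (4 + N)) : par (eta N * f) = -(eta N * par f) := by
  rw [par_mul, isOdd_eta.par_eq, neg_mul]
@[simp] theorem conj_eta_mul (f : Gr (4 + N)) : conj (eta N * f) = etaBar N * par (conj f) := by
  rw [conj_mul, conj_eta, isOdd_etaBar.comm, par_par]
@[simp] theorem body_eta_mul (f : Gr (4 + N)) : body (eta N * f) = 0 := by
  rw [body_mul, show body (eta N) = 0 from isOdd_eta ∅ (by simp), zero_mul]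

@[simp] theorem conj_etaBar : conj (etaBar N) = eta N := by
  simp [etaBar, eta, tau, conj_add, conj_sub, conj_smul, conj_gen, sub_eq_add_neg, conj_neg]
@[simp] theorem par_etaBar_mul (f : Gr (4 + N)) : par (etaBar N * f) = -(etaBar N * par f) := by
  rw [par_mul, isOdd_etaBar.par_eq, neg_mul]
@[simp] theorem conj_etaBar_mul (f : Gr (4 + N)) : conj (etaBar N * f) = eta N * par (conj f) := by
  rw [conj_mul, conj_etaBar, isOdd_eta.comm, par_par]
@[simp] theorem body_etaBar_mul (f : Gr (4 + N)) : body (etaBar N * f) = 0 := by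
  rw [body_mul, show body (etaBar N) = 0 from isOdd_etaBar ∅ (by simp), zero_mul]

theorem conj_dTheta (f : Gr (4 + N)) : conj (dTheta f) = -dThetaBar (par (conj f)) := by
  simp only [dTheta_eq, dThetaBar_eq, conj_smul, conj_add, conj_pd, map_neg, Complex.conj_I, map_div₀, map_one,
    Complex.conj_ofNat, neg_neg]
  module
theorem par_dTheta (f : Gr (4 + N)) : par (dTheta f) = -dTheta (par f) := by
  simp only [dTheta_eq, par_smul, par_add, par_pd]
  module

theorem conj_dThetaBar (f : Gr (4 + N)) : conj (dThetaBar f) = -dTheta (par (conj f)) := by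
  simp only [dThetaBar_eq, dTheta_eq, conj_smul, conj_add, conj_pd, map_neg, Complex.conj_I, map_div₀, map_one,
    Complex.conj_ofNat, neg_neg]
  module

theorem conj_dEta (f : Gr (4 + N)) : conj (dEta f) = -dEtaBar (par (conj f)) := by
  simp only [dEta_eq, dEtaBar_eq, conj_smul, conj_add, conj_pd, map_neg, Complex.conj_I, map_div₀, map_one,
    Complex.conj_ofNat, neg_neg]
  module
theorem par_dEta (f : Gr (4 + N)) : par (dEta f) = -dEta (par f) := by
  simp only [dEta_eq, par_smul, par_add, par_pd]
  module

theorem conj_dEtaBar (f : Gr (4 + N)) : conj (dEtaBar f) = -dEta (par (conj f)) := by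
  simp only [dEtaBar_eq, dEta_eq, conj_smul, conj_add, conj_pd, map_neg, Complex.conj_I, map_div₀, map_one,
    Complex.conj_ofNat, neg_neg]
  module
theorem par_dEtaBar (f : Gr (4 + N)) : par (dEtaBar f) = -dEtaBar (par f) := by
  simp only [dEtaBar_eq, par_smul, par_add, par_pd]
  module

/-! ### Restriction to the origin of the odd directions -/

theorem atZero_apply (f : Gr (4 + N)) (S : Finset (Fin (4 + N))) :
    atZero f S = if ∃ k : Fin 4, Fin.castAdd N k ∈ S then 0 else f S := rfl

@[simp] theorem atZero_add (f g : Gr (4 + N)) : atZero (f + g) = atZero f + atZero g := by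
  funext S; simp only [atZero_apply, add_apply]; split_ifs <;> simp

@[simp] theorem atZero_smul (c : ℂ) (f : Gr (4 + N)) : atZero (c • f) = c • atZero f := by
  funext S; simp only [atZero_apply, smul_apply]; split_ifs <;> simp

@[simp] theorem atZero_zero : atZero (0 : Gr (4 + N)) = 0 := by simpa using atZero_smul 0 (0 : Gr (4 + N))

@[simp] theorem atZero_neg (f : Gr (4 + N)) : atZero (-f) = -atZero f := by
  simpa using atZero_smul (-1) f

@[simp] theorem atZero_sub (f g : Gr (4 + N)) : atZero (f - g) = atZero f - atZero g := by
  rw [sub_eq_add_neg, atZero_add, atZero_neg, ← sub_eq_add_neg]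

@[simp] theorem atZero_sum {ι : Type*} (s : Finset ι) (F : ι → Gr (4 + N)) :
    atZero (∑ i ∈ s, F i) = ∑ i ∈ s, atZero (F i) :=
  map_sum (⟨⟨atZero, atZero_zero⟩, atZero_add⟩ : Gr (4 + N) →+ Gr (4 + N)) F s

theorem atZero_mul (f g : Gr (4 + N)) : atZero (f * g) = atZero f * atZero g := by
  funext U
  rw [atZero_apply]
  split_ifs with h
  · obtain ⟨k, hk⟩ := h
    rw [mul_apply]
    symm
    refine Finset.sum_eq_zero fun S _ => ?_
    by_cases hS : Fin.castAdd N k ∈ S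
    · rw [atZero_apply, if_pos ⟨k, hS⟩]; ring
    · rw [atZero_apply g, if_pos ⟨k, Finset.mem_sdiff.2 ⟨hk, hS⟩⟩]; ring
  · rw [mul_apply, mul_apply]
    refine Finset.sum_congr rfl fun S hS => ?_
    rw [atZero_apply, if_neg, atZero_apply g, if_neg]
    · rintro ⟨k, hk⟩; exact h ⟨k, (Finset.mem_sdiff.1 hk).1⟩
    · rintro ⟨k, hk⟩; exact h ⟨k, Finset.mem_powerset.1 hS hk⟩

theorem atZero_one : atZero (1 : Gr (4 + N)) = 1 := by
  funext S
  rw [atZero_apply, one_apply]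
  split_ifs with h1 h2 <;> simp_all

@[simp] theorem atZero_conj (f : Gr (4 + N)) : atZero (conj f) = conj (atZero f) := by
  funext S
  simp only [atZero_apply, conj_apply]
  split_ifs <;> simp

theorem atZero_tau (k : Fin 4) : atZero (tau N k) = 0 := by
  funext S
  rw [atZero_apply]
  split_ifs with h
  · rfl
  · simp only [tau, gen]
    rw [if_neg]
    · rfl
    · rintro rfl
      exact h ⟨k, Finset.mem_singleton_self _⟩

theorem atZero_eq_self_iff {f : Gr (4 + N)} :
    atZero f = f ↔ ∀ k : Fin 4, pd (Fin.castAdd N k) f = 0 := by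
  constructor
  · intro h k
    funext S
    rw [pd_apply]
    split_ifs
    · rfl
    · rw [← h, atZero_apply, if_pos ⟨k, Finset.mem_insert_self _ _⟩, mul_zero]; rfl
  · intro h
    funext S
    rw [atZero_apply]
    split_ifs with hS
    · obtain ⟨k, hk⟩ := hS
      have := congrFun (h k) (S.erase (Fin.castAdd N k))
      rw [pd_apply, if_neg (Finset.notMem_erase _ _), Finset.insert_erase hk, zero_apply] at this
      rcases mul_eq_zero.1 this with h0 | h0
      · exact absurd h0 (pow_ne_zero _ (by norm_num))
      · exact h0.symm
    · rfl

theorem atZero_eq_self_of {f : Gr (4 + N)} (h1 : dTheta f = 0) (h2 : dThetaBar f = 0)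
    (h3 : dEta f = 0) (h4 : dEtaBar f = 0) : atZero f = f := by
  rw [atZero_eq_self_iff]
  have e0 : pd (Fin.castAdd N 0) f = dTheta f + dThetaBar f := by
    rw [dTheta_eq, dThetaBar_eq]; module
  have e1 : pd (Fin.castAdd N 1) f = Complex.I • (dTheta f - dThetaBar f) := by
    rw [dTheta_eq, dThetaBar_eq, ← smul_sub]
    have : ∀ a b : Gr (4 + N), a + -Complex.I • b - (a + Complex.I • b) = (-2 * Complex.I) • b :=
      fun a b => by module
    rw [this, smul_smul, smul_smul]
    ring_nf
    rw [Complex.I_sq]; norm_num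
  have e2 : pd (Fin.castAdd N 2) f = dEta f + dEtaBar f := by
    rw [dEta_eq, dEtaBar_eq]; module
  have e3 : pd (Fin.castAdd N 3) f = Complex.I • (dEta f - dEtaBar f) := by
    rw [dEta_eq, dEtaBar_eq, ← smul_sub]
    have : ∀ a b : Gr (4 + N), a + -Complex.I • b - (a + Complex.I • b) = (-2 * Complex.I) • b :=
      fun a b => by module
    rw [this, smul_smul, smul_smul]
    ring_nf
    rw [Complex.I_sq]; norm_num
  intro k
  fin_cases k
  · exact e0.trans (by rw [h1, h2, add_zero])
  · exact e1.trans (by rw [h1, h2, sub_zero, smul_zero])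
  · exact e2.trans (by rw [h3, h4, add_zero])
  · exact e3.trans (by rw [h3, h4, sub_zero, smul_zero])

theorem derivatives_eq_zero {f : Gr (4 + N)} (h : atZero f = f) :
    dTheta f = 0 ∧ dThetaBar f = 0 ∧ dEta f = 0 ∧ dEtaBar f = 0 := by
  rw [atZero_eq_self_iff] at h
  simp only [dTheta_eq, dThetaBar_eq, dEta_eq, dEtaBar_eq, h, smul_zero, add_zero, and_self]

@[simp] theorem atZero_theta_mul (f : Gr (4 + N)) : atZero (theta N * f) = 0 := by
  rw [atZero_mul]; simp [theta, atZero_tau]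

@[simp] theorem atZero_theta : atZero (theta N) = 0 := by simp [theta, atZero_tau]

@[simp] theorem atZero_thetaBar_mul (f : Gr (4 + N)) : atZero (thetaBar N * f) = 0 := by
  rw [atZero_mul]; simp [thetaBar, atZero_tau]

@[simp] theorem atZero_thetaBar : atZero (thetaBar N) = 0 := by simp [thetaBar, atZero_tau]

@[simp] theorem atZero_eta_mul (f : Gr (4 + N)) : atZero (eta N * f) = 0 := by
  rw [atZero_mul]; simp [eta, atZero_tau]

@[simp] theorem atZero_eta : atZero (eta N) = 0 := by simp [eta, atZero_tau]

@[simp] theorem atZero_etaBar_mul (f : Gr (4 + N)) : atZero (etaBar N * f) = 0 := by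
  rw [atZero_mul]; simp [etaBar, atZero_tau]

@[simp] theorem atZero_etaBar : atZero (etaBar N) = 0 := by simp [etaBar, atZero_tau]

/-! ### Component fields -/

theorem atZero_ev (x : Ev N) : atZero (x : Gr (4 + N)) = x := by
  funext S
  rw [atZero_apply]
  split_ifs with h
  · exact (x.2 S (Or.inr h)).symm
  · rfl

theorem atZero_od (x : Od N) : atZero (x : Gr (4 + N)) = x := by
  funext S
  rw [atZero_apply]
  split_ifs with h
  · exact (x.2 S (Or.inr h)).symm
  · rfl

theorem isEven_ev (x : Ev N) : IsEven (x : Gr (4 + N)) := fun S hS => x.2 S (Or.inl hS)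

theorem isOdd_od (x : Od N) : IsOdd (x : Gr (4 + N)) := fun S hS => x.2 S (Or.inl hS)

theorem mem_ev {f : Gr (4 + N)} (he : IsEven f) (h0 : atZero f = f) : f ∈ Ev N := by
  intro S hS
  rcases hS with hS | hS
  · exact he S hS
  · rw [← h0, atZero_apply, if_pos hS]

@[simp] theorem coe_conjEv (x : Ev N) : (conjEv x : Gr (4 + N)) = conj (x : Gr (4 + N)) := rfl

@[simp] theorem coe_conjOd (x : Od N) : (conjOd x : Gr (4 + N)) = conj (x : Gr (4 + N)) := rfl

@[simp] theorem par_ev (x : Ev N) : par (x : Gr (4 + N)) = x := (isEven_ev x).par_eq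

@[simp] theorem par_od (x : Od N) : par (x : Gr (4 + N)) = -x := (isOdd_od x).par_eq

@[simp] theorem par_conj_ev (x : Ev N) : par (conj (x : Gr (4 + N))) = conj x :=
  (isEven_ev x).conj.par_eq

@[simp] theorem par_conj_od (x : Od N) : par (conj (x : Gr (4 + N))) = -conj x :=
  (isOdd_od x).conj.par_eq

@[simp] theorem atZero_coe_ev (x : Ev N) : atZero (x : Gr (4 + N)) = x := atZero_ev x

@[simp] theorem atZero_coe_od (x : Od N) : atZero (x : Gr (4 + N)) = x := atZero_od x

@[simp] theorem dTheta_ev (x : Ev N) : dTheta (x : Gr (4 + N)) = 0 :=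
  (derivatives_eq_zero (atZero_ev x)).1
@[simp] theorem dTheta_conj_ev (x : Ev N) : dTheta (conj (x : Gr (4 + N))) = 0 := dTheta_ev (conjEv x)
@[simp] theorem dTheta_od (x : Od N) : dTheta (x : Gr (4 + N)) = 0 :=
  (derivatives_eq_zero (atZero_od x)).1
@[simp] theorem dTheta_conj_od (x : Od N) : dTheta (conj (x : Gr (4 + N))) = 0 := dTheta_od (conjOd x)
@[simp] theorem dThetaBar_ev (x : Ev N) : dThetaBar (x : Gr (4 + N)) = 0 :=
  (derivatives_eq_zero (atZero_ev x)).2.1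
@[simp] theorem dThetaBar_conj_ev (x : Ev N) : dThetaBar (conj (x : Gr (4 + N))) = 0 := dThetaBar_ev (conjEv x)
@[simp] theorem dThetaBar_od (x : Od N) : dThetaBar (x : Gr (4 + N)) = 0 :=
  (derivatives_eq_zero (atZero_od x)).2.1
@[simp] theorem dThetaBar_conj_od (x : Od N) : dThetaBar (conj (x : Gr (4 + N))) = 0 := dThetaBar_od (conjOd x)
@[simp] theorem dEta_ev (x : Ev N) : dEta (x : Gr (4 + N)) = 0 :=
  (derivatives_eq_zero (atZero_ev x)).2.2.1
@[simp] theorem dEta_conj_ev (x : Ev N) : dEta (conj (x : Gr (4 + N))) = 0 := dEta_ev (conjEv x)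
@[simp] theorem dEta_od (x : Od N) : dEta (x : Gr (4 + N)) = 0 :=
  (derivatives_eq_zero (atZero_od x)).2.2.1
@[simp] theorem dEta_conj_od (x : Od N) : dEta (conj (x : Gr (4 + N))) = 0 := dEta_od (conjOd x)
@[simp] theorem dEtaBar_ev (x : Ev N) : dEtaBar (x : Gr (4 + N)) = 0 :=
  (derivatives_eq_zero (atZero_ev x)).2.2.2
@[simp] theorem dEtaBar_conj_ev (x : Ev N) : dEtaBar (conj (x : Gr (4 + N))) = 0 := dEtaBar_ev (conjEv x)
@[simp] theorem dEtaBar_od (x : Od N) : dEtaBar (x : Gr (4 + N)) = 0 :=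
  (derivatives_eq_zero (atZero_od x)).2.2.2
@[simp] theorem dEtaBar_conj_od (x : Od N) : dEtaBar (conj (x : Gr (4 + N))) = 0 := dEtaBar_od (conjOd x)

/-! ### Berezin integrals -/

theorem atZero_intFull (f : Gr (4 + N)) : atZero (intFull f) = intFull f := by
  apply atZero_eq_self_of <;> simp [intFull]

theorem intFull_add (f g : Gr (4 + N)) : intFull (f + g) = intFull f + intFull g := by
  simp [intFull]

theorem intFull_sub (f g : Gr (4 + N)) : intFull (f - g) = intFull f - intFull g := by
  simp [intFull]

theorem intFull_smul (c : ℂ) (f : Gr (4 + N)) : intFull (c • f) = c • intFull f := by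
  simp [intFull]

theorem intFull_sum {ι : Type*} (s : Finset ι) (F : ι → Gr (4 + N)) :
    intFull (∑ i ∈ s, F i) = ∑ i ∈ s, intFull (F i) := by
  simp [intFull]

/-- Conjugation exchanges `θ` with `θ̄` and `η` with `η̄`; the signs from the four derivatives and
from restoring their order cancel. The full measure is thus real. -/
theorem conj_intFull (f : Gr (4 + N)) : conj (intFull f) = intFull (conj f) := by
  simp [intFull, conj_dTheta, conj_dThetaBar, conj_dEta, conj_dEtaBar, par_dTheta,
    par_dEta, par_dEtaBar, par_neg, par_par]

/-- The integral of a multiple of `θ θ̄ η η̄`. -/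
theorem intFull_top (f : Gr (4 + N)) :
    intFull (theta N * (thetaBar N * (eta N * (etaBar N * f)))) = atZero f := by
  rw [← atZero_intFull]
  simp [intFull]

/-! ### The rotation of `η` -/

/-- The automorphism `η ↦ i η`, `η̄ ↦ -i η̄`. -/
def rho (f : Gr (4 + N)) : Gr (4 + N) :=
  rescale (eta N) dEta Complex.I (rescale (etaBar N) dEtaBar (-Complex.I) f)

theorem rho_eq (f : Gr (4 + N)) : rho f = f + (Complex.I - 1) • (eta N * dEta f) +
    (-Complex.I - 1) • (etaBar N * dEtaBar f) -
      (2 : ℂ) • (eta N * (etaBar N * dEta (dEtaBar f))) := by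
  have h : (Complex.I - 1) * (-Complex.I - 1) = 2 := by
    linear_combination -Complex.I_sq
  simp only [rho, rescale, dEta_add, dEta_smul, dEta_etaBar_mul, mul_add, mul_smul_comm, smul_neg,
    smul_smul, mul_neg, smul_add, h]
  abel

@[simp] theorem rho_add (f g : Gr (4 + N)) : rho (f + g) = rho f + rho g := by
  simp only [rho_eq, dEta_add, dEtaBar_add, mul_add]; module

@[simp] theorem rho_smul (c : ℂ) (f : Gr (4 + N)) : rho (c • f) = c • rho f := by
  simp only [rho_eq, dEta_smul, dEtaBar_smul, mul_smul_comm]; module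

theorem rho_mul (f g : Gr (4 + N)) : rho (f * g) = rho f * rho g := by
  rw [rho, rescale_mul isOdd_etaBar isOddDer_dEtaBar, rescale_mul isOdd_eta isOddDer_dEta]
  rfl

@[simp] theorem rho_neg (f : Gr (4 + N)) : rho (-f) = -rho f := by simpa using rho_smul (-1) f

@[simp] theorem rho_sub (f g : Gr (4 + N)) : rho (f - g) = rho f - rho g := by
  rw [sub_eq_add_neg, rho_add, rho_neg, ← sub_eq_add_neg]

theorem rho_one : rho (1 : Gr (4 + N)) = 1 := by
  simp [rho_eq, isOddDer_dEta.one, isOddDer_dEtaBar.one]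

@[simp] theorem rho_theta_mul (f : Gr (4 + N)) : rho (theta N * f) = theta N * rho f := by
  rw [rho_mul]; congr 1; simp [rho_eq]

@[simp] theorem rho_thetaBar_mul (f : Gr (4 + N)) : rho (thetaBar N * f) = thetaBar N * rho f := by
  rw [rho_mul]; congr 1; simp [rho_eq]

@[simp] theorem rho_eta_mul (f : Gr (4 + N)) :
    rho (eta N * f) = Complex.I • (eta N * rho f) := by
  rw [rho_mul, ← smul_mul_assoc]
  congr 1
  simp [rho_eq, isOddDer_dEta.one, isOddDer_dEtaBar.one]
  module

@[simp] theorem rho_etaBar_mul (f : Gr (4 + N)) :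
    rho (etaBar N * f) = -(Complex.I • (etaBar N * rho f)) := by
  rw [rho_mul, ← smul_mul_assoc, ← neg_mul]
  congr 1
  simp [rho_eq, isOddDer_dEta.one, isOddDer_dEtaBar.one]
  module

theorem rho_of_field {f : Gr (4 + N)} (h : atZero f = f) : rho f = f := by
  obtain ⟨_, _, h3, h4⟩ := derivatives_eq_zero h
  simp [rho_eq, h3, h4]

@[simp] theorem rho_ev (x : Ev N) : rho (x : Gr (4 + N)) = x := rho_of_field (atZero_ev x)
@[simp] theorem rho_od (x : Od N) : rho (x : Gr (4 + N)) = x := rho_of_field (atZero_od x)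
@[simp] theorem rho_conj_ev (x : Ev N) : rho (conj (x : Gr (4 + N))) = conj x := rho_ev (conjEv x)
@[simp] theorem rho_conj_od (x : Od N) : rho (conj (x : Gr (4 + N))) = conj x := rho_od (conjOd x)

theorem body_rho (f : Gr (4 + N)) : body (rho f) = body f := by
  rw [rho_eq, body_sub, body_add, body_add, body_smul, body_smul, body_smul]
  simp

/-- The factors `i` and `-i` are conjugate to each other, so the rotation keeps `η̄` the conjugate
of `η`. -/
theorem conj_rho (f : Gr (4 + N)) : conj (rho f) = rho (conj f) := by
  simp only [rho_eq, conj_sub, conj_add, conj_smul, conj_eta_mul, conj_etaBar_mul, conj_dEta,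
    conj_dEtaBar, par_neg, par_dEta, par_dEtaBar, par_par, neg_neg, par_etaBar_mul, par_eta_mul,
    dEta_dEta, dEtaBar_dEta, dEta_neg, dEtaBar_neg, map_sub, Complex.conj_I, map_one, map_neg,
    Complex.conj_ofNat, etaBar_mul_eta_mul, mul_neg]
  module

/-- The integral sees only the coefficient of `ηη̄`, which the rotation multiplies by `i · (-i) =
1`. -/
theorem intFull_rho (f : Gr (4 + N)) : intFull (rho f) = intFull f := by
  have h : dEta (dEtaBar (rho f)) = dEta (dEtaBar f) := by
    simp only [rho_eq, dEta_add, dEtaBar_add, dEta_sub, dEtaBar_sub, dEta_smul, dEtaBar_smul]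
    simp
    module
  rw [intFull, h, intFull]

end Superspace

end

end BiHKT

namespace BiHKT

noncomputable section

/-! ### Superfields as functions of jets -/

section Jets

open Gr

variable {N n m : ℕ}

/-- `√2` as a complex number. -/
local notation "r2" => ((Real.sqrt 2 : ℝ) : ℂ)

theorem sqrt_two_mul_self : r2 * r2 = 2 := by
  rw [← Complex.ofReal_mul, Real.mul_self_sqrt (by norm_num)]; norm_num

theorem sqrt_two_smul_smul (x : Gr (4 + N)) : r2 • r2 • x = (2 : ℂ) • x := by
  rw [smul_smul, sqrt_two_mul_self]

theorem I_smul_I_smul (x : Gr (4 + N)) : Complex.I • Complex.I • x = -x := by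
  rw [smul_smul, Complex.I_mul_I, neg_one_smul]

/-- The ordinary (2,4,2) superfield with given components. -/
def ordSF (z z₁ z₂ A φ φ₁ φ' φ'₁ : Gr (4 + N)) : Gr (4 + N) :=
  z + r2 • (theta N * φ) - Complex.I • (theta N * (thetaBar N * z₁)) + r2 • (eta N * φ')
    + (2 : ℂ) • (eta N * (theta N * A))
    - (Complex.I * r2) • (eta N * (theta N * (thetaBar N * φ'₁)))
    - Complex.I • (eta N * (etaBar N * z₁)) - (Complex.I * r2) • (eta N * (etaBar N * (theta N * φ₁)))
    - eta N * (etaBar N * (theta N * (thetaBar N * z₂)))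

/-- The mirror (2,4,2) superfield with given components. -/
def mirSF (z z₁ z₂ A φ φ₁ φ' φ'₁ : Gr (4 + N)) : Gr (4 + N) :=
  z + r2 • (theta N * φ) - Complex.I • (theta N * (thetaBar N * z₁)) - r2 • (etaBar N * φ')
    - (2 : ℂ) • (etaBar N * (theta N * A))
    + (Complex.I * r2) • (etaBar N * (theta N * (thetaBar N * φ'₁)))
    + Complex.I • (eta N * (etaBar N * z₁)) + (Complex.I * r2) • (eta N * (etaBar N * (theta N * φ₁)))
    + eta N * (etaBar N * (theta N * (thetaBar N * z₂)))

/-- The (2,4,2) superfields as functions of the jet of a trajectory. -/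
def superKJ (x v w : KConf N n m) (a : KAux N n m) : Flav n m → Gr (4 + N)
  | .inl i => ordSF (x.1 (.inl i)) (v.1 (.inl i)) (w.1 (.inl i)) (a (.inl i)) (x.2 0 (.inl i))
      (v.2 0 (.inl i)) (x.2 1 (.inl i)) (v.2 1 (.inl i))
  | .inr i => mirSF (x.1 (.inr i)) (v.1 (.inr i)) (w.1 (.inr i)) (a (.inr i)) (x.2 0 (.inr i))
      (v.2 0 (.inr i)) (x.2 1 (.inr i)) (v.2 1 (.inr i))

section Derivatives

variable {z z₁ z₂ A φ φ₁ φ' φ'₁ : ℝ → Gr (4 + N)} {dz dz₁ dz₂ dA dφ dφ₁ dφ' dφ'₁ : Gr (4 + N)}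
  {t : ℝ}

theorem hasDerivAt_ordSF (hz : HasDerivAt z dz t) (hz₁ : HasDerivAt z₁ dz₁ t)
    (hz₂ : HasDerivAt z₂ dz₂ t) (hA : HasDerivAt A dA t) (hφ : HasDerivAt φ dφ t)
    (hφ₁ : HasDerivAt φ₁ dφ₁ t) (hφ' : HasDerivAt φ' dφ' t) (hφ'₁ : HasDerivAt φ'₁ dφ'₁ t) :
    HasDerivAt (fun s => ordSF (z s) (z₁ s) (z₂ s) (A s) (φ s) (φ₁ s) (φ' s) (φ'₁ s))
      (ordSF dz dz₁ dz₂ dA dφ dφ₁ dφ' dφ'₁) t :=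
  ((((((((hz.fun_add ((hφ.gr_const_mul _).fun_const_smul _)).fun_sub
    (((hz₁.gr_const_mul _).gr_const_mul _).fun_const_smul _)).fun_add
    ((hφ'.gr_const_mul _).fun_const_smul _)).fun_add
    (((hA.gr_const_mul _).gr_const_mul _).fun_const_smul _)).fun_sub
    ((((hφ'₁.gr_const_mul _).gr_const_mul _).gr_const_mul _).fun_const_smul _)).fun_sub
    (((hz₁.gr_const_mul _).gr_const_mul _).fun_const_smul _)).fun_sub
    ((((hφ₁.gr_const_mul _).gr_const_mul _).gr_const_mul _).fun_const_smul _)).fun_sub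
    ((((hz₂.gr_const_mul _).gr_const_mul _).gr_const_mul _).gr_const_mul _))

theorem hasDerivAt_mirSF (hz : HasDerivAt z dz t) (hz₁ : HasDerivAt z₁ dz₁ t)
    (hz₂ : HasDerivAt z₂ dz₂ t) (hA : HasDerivAt A dA t) (hφ : HasDerivAt φ dφ t)
    (hφ₁ : HasDerivAt φ₁ dφ₁ t) (hφ' : HasDerivAt φ' dφ' t) (hφ'₁ : HasDerivAt φ'₁ dφ'₁ t) :
    HasDerivAt (fun s => mirSF (z s) (z₁ s) (z₂ s) (A s) (φ s) (φ₁ s) (φ' s) (φ'₁ s))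
      (mirSF dz dz₁ dz₂ dA dφ dφ₁ dφ' dφ'₁) t :=
  ((((((((hz.fun_add ((hφ.gr_const_mul _).fun_const_smul _)).fun_sub
    (((hz₁.gr_const_mul _).gr_const_mul _).fun_const_smul _)).fun_sub
    ((hφ'.gr_const_mul _).fun_const_smul _)).fun_sub
    (((hA.gr_const_mul _).gr_const_mul _).fun_const_smul _)).fun_add
    ((((hφ'₁.gr_const_mul _).gr_const_mul _).gr_const_mul _).fun_const_smul _)).fun_add
    (((hz₁.gr_const_mul _).gr_const_mul _).fun_const_smul _)).fun_add
    ((((hφ₁.gr_const_mul _).gr_const_mul _).gr_const_mul _).fun_const_smul _)).fun_add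
    ((((hz₂.gr_const_mul _).gr_const_mul _).gr_const_mul _).gr_const_mul _))

theorem hasDerivAt_chiral {b b₁ f : ℝ → Gr (4 + N)} {b₂ f₁ : Gr (4 + N)}
    (hb : ∀ s, HasDerivAt b (b₁ s) s) (hb₁ : HasDerivAt b₁ b₂ t) (hf : HasDerivAt f f₁ t) :
    HasDerivAt (chiral b f) (b₁ t + r2 • (theta N * f₁) -
      Complex.I • (theta N * thetaBar N * b₂)) t := by
  have e : chiral b f = fun s => b s + r2 • (theta N * f s) -
      Complex.I • (theta N * thetaBar N * b₁ s) := by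
    funext s
    rw [chiral, (hb s).deriv]
  rw [e]
  exact (((hb t).fun_add ((hf.gr_const_mul _).fun_const_smul _)).fun_sub
    ((hb₁.gr_const_mul _).fun_const_smul _))

end Derivatives

/-! Component fields along a trajectory -/

theorem hasDerivAt_ev {x : ℝ → Ev N} {x' : Ev N} {t : ℝ} (h : HasDerivAt x x' t) :
    HasDerivAt (fun s => (x s : Gr (4 + N))) (x' : Gr (4 + N)) t :=
  ((Ev N).subtypeL.restrictScalars ℝ).hasFDerivAt.comp_hasDerivAt t h

theorem hasDerivAt_od {x : ℝ → Od N} {x' : Od N} {t : ℝ} (h : HasDerivAt x x' t) :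
    HasDerivAt (fun s => (x s : Gr (4 + N))) (x' : Gr (4 + N)) t :=
  ((Od N).subtypeL.restrictScalars ℝ).hasFDerivAt.comp_hasDerivAt t h

theorem hasDerivAt_fst {E F : Type*} [NormedAddCommGroup E] [NormedSpace ℝ E]
    [NormedAddCommGroup F] [NormedSpace ℝ F] {x : ℝ → E × F} {x' : E × F} {t : ℝ}
    (h : HasDerivAt x x' t) : HasDerivAt (fun s => (x s).1) x'.1 t :=
  (ContinuousLinearMap.fst ℝ E F).hasFDerivAt.comp_hasDerivAt t h

theorem hasDerivAt_snd {E F : Type*} [NormedAddCommGroup E] [NormedSpace ℝ E]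
    [NormedAddCommGroup F] [NormedSpace ℝ F] {x : ℝ → E × F} {x' : E × F} {t : ℝ}
    (h : HasDerivAt x x' t) : HasDerivAt (fun s => (x s).2) x'.2 t :=
  (ContinuousLinearMap.snd ℝ E F).hasFDerivAt.comp_hasDerivAt t h

section KFields

variable {x : ℝ → KConf N n m} {x' : KConf N n m} {a : ℝ → KAux N n m} {a' : KAux N n m} {t : ℝ}

theorem hasDerivAt_kBoson (h : HasDerivAt x x' t) (i : Flav n m) :
    HasDerivAt (fun s => ((x s).1 i : Gr (4 + N))) (x'.1 i : Gr (4 + N)) t :=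
  hasDerivAt_ev (hasDerivAt_pi.1 (hasDerivAt_fst h) i)

theorem hasDerivAt_kFermion (h : HasDerivAt x x' t) (k : Fin 2) (i : Flav n m) :
    HasDerivAt (fun s => ((x s).2 k i : Gr (4 + N))) (x'.2 k i : Gr (4 + N)) t :=
  hasDerivAt_od (hasDerivAt_pi.1 (hasDerivAt_pi.1 (hasDerivAt_snd h) k) i)

theorem hasDerivAt_aux (h : HasDerivAt a a' t) (i : Flav n m) :
    HasDerivAt (fun s => (a s i : Gr (4 + N))) (a' i : Gr (4 + N)) t :=
  hasDerivAt_ev (hasDerivAt_pi.1 h i)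

end KFields

/-- The superfield is linear in the jet, so differentiation in time merely shifts the jet. -/
theorem hasDerivAt_superKJ {x v w : ℝ → KConf N n m} {a : ℝ → KAux N n m}
    {x' v' w' : KConf N n m} {a' : KAux N n m} {t : ℝ} (hx : HasDerivAt x x' t)
    (hv : HasDerivAt v v' t) (hw : HasDerivAt w w' t) (ha : HasDerivAt a a' t) (i : Flav n m) :
    HasDerivAt (fun s => superKJ (x s) (v s) (w s) (a s) i) (superKJ x' v' w' a' i) t := by
  rcases i with i | i
  · exact hasDerivAt_ordSF (hasDerivAt_kBoson hx _) (hasDerivAt_kBoson hv _)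
      (hasDerivAt_kBoson hw _) (hasDerivAt_aux ha _) (hasDerivAt_kFermion hx _ _)
      (hasDerivAt_kFermion hv _ _) (hasDerivAt_kFermion hx _ _) (hasDerivAt_kFermion hv _ _)
  · exact hasDerivAt_mirSF (hasDerivAt_kBoson hx _) (hasDerivAt_kBoson hv _)
      (hasDerivAt_kBoson hw _) (hasDerivAt_aux ha _) (hasDerivAt_kFermion hx _ _)
      (hasDerivAt_kFermion hv _ _) (hasDerivAt_kFermion hx _ _) (hasDerivAt_kFermion hv _ _)

theorem hasDerivAt_iteratedDeriv {E : Type*} [NormedAddCommGroup E] [NormedSpace ℝ E] {F : ℝ → E}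
    (hF : ContDiff ℝ ∞ F) (k : ℕ) (t : ℝ) :
    HasDerivAt (iteratedDeriv k F) (iteratedDeriv (k + 1) F t) t := by
  rw [iteratedDeriv_succ]
  exact ((hF.differentiable_iteratedDeriv k (by exact_mod_cast ENat.natCast_lt_top k)) t).hasDerivAt

section Trajectory

variable {Q : ℝ → KConf N n m × KAux N n m} (hQ : ContDiff ℝ ∞ Q)
include hQ

theorem hasDerivAt_conf (k : ℕ) (t : ℝ) :
    HasDerivAt (fun s => (iteratedDeriv k Q s).1) (iteratedDeriv (k + 1) Q t).1 t :=
  hasDerivAt_fst (hasDerivAt_iteratedDeriv hQ k t)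

theorem hasDerivAt_confAux (k : ℕ) (t : ℝ) :
    HasDerivAt (fun s => (iteratedDeriv k Q s).2) (iteratedDeriv (k + 1) Q t).2 t :=
  hasDerivAt_snd (hasDerivAt_iteratedDeriv hQ k t)

/-- Only two time derivatives of the dynamical fields occur, and none of the auxiliary fields.
Expressions in superfields are therefore functions of finite jets, as boundary terms must be. -/
theorem superK_eq_superKJ (i : Flav n m) (t : ℝ) :
    superK Q i t = superKJ (Q t).1 (iteratedDeriv 1 Q t).1 (iteratedDeriv 2 Q t).1 (Q t).2 i := by
  have hz : ∀ i s, HasDerivAt (fun s => ((Q s).1.1 i : Gr (4 + N)))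
      ((iteratedDeriv 1 Q s).1.1 i : Gr (4 + N)) s := fun i s => by
    simpa using hasDerivAt_kBoson (hasDerivAt_conf hQ 0 s) i
  have hf : ∀ k i s, HasDerivAt (fun s => ((Q s).1.2 k i : Gr (4 + N)))
      ((iteratedDeriv 1 Q s).1.2 k i : Gr (4 + N)) s := fun k i s => by
    simpa using hasDerivAt_kFermion (hasDerivAt_conf hQ 0 s) k i
  have hZ : ∀ i, deriv (chiralZ Q i) t = _ := fun i =>
    (hasDerivAt_chiral (hz i) (hasDerivAt_kBoson (hasDerivAt_conf hQ 1 t) i) (hf 0 i t)).deriv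
  rcases i with i | i
  · simp only [superK, superKJ, hZ]
    simp only [chiralZ, chiralPhi, chiral, (hz _ _).deriv, (hf _ _ _).deriv, ordSF, mul_add, mul_sub,
      mul_smul_comm, smul_add, smul_sub, mul_assoc, sqrt_two_smul_smul, I_smul_I_smul, smul_smul]
    simp only [← smul_smul, sqrt_two_smul_smul, I_smul_I_smul]
    module
  · simp only [superK, superKJ, hZ]
    simp only [chiralZ, chiralPhi, chiral, (hz _ _).deriv, (hf _ _ _).deriv, mirSF, mul_add, mul_sub,
      mul_smul_comm, smul_add, smul_sub, mul_assoc, sqrt_two_smul_smul, I_smul_I_smul, smul_smul]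
    simp only [← smul_smul, sqrt_two_smul_smul, I_smul_I_smul]
    module

theorem hasDerivAt_superK (i : Flav n m) (t : ℝ) :
    HasDerivAt (superK Q i) (superKJ (iteratedDeriv 1 Q t).1 (iteratedDeriv 2 Q t).1
      (iteratedDeriv 3 Q t).1 (iteratedDeriv 1 Q t).2 i) t := by
  rw [show superK Q i = _ from funext fun s => superK_eq_superKJ hQ i s]
  refine hasDerivAt_superKJ ?_ (hasDerivAt_conf hQ 1 t) (hasDerivAt_conf hQ 2 t) ?_ i
  · simpa using hasDerivAt_conf hQ 0 t
  · simpa using hasDerivAt_confAux hQ 0 t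

/-- Each component proportional to `θ̄` carries the time derivative that cancels the contribution of
`iθ∂_t`. The next two statements hold in the same way in the `η` directions, where the sign of the
`ηη̄` term decides between `D̄_η` and `D_η`. -/
theorem DThetaBar_superK (i : Flav n m) : DThetaBar (superK Q i) = 0 := by
  funext t
  rw [DThetaBar, (hasDerivAt_superK hQ i t).deriv, superK_eq_superKJ hQ i t]
  rcases i with i | i
  · simp [superKJ, ordSF, mul_add, mul_sub, mul_smul_comm, smul_add, smul_sub, smul_smul,
      ← mul_assoc Complex.I, -Complex.coe_smul]
    module
  · simp [superKJ, mirSF, mul_add, mul_sub, mul_smul_comm, smul_add, smul_sub, smul_smul,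
      ← mul_assoc Complex.I, -Complex.coe_smul]
    module

theorem DEtaBar_superK_inl (i : Fin n) : DEtaBar (superK Q (.inl i)) = 0 := by
  funext t
  rw [DEtaBar, (hasDerivAt_superK hQ _ t).deriv, superK_eq_superKJ hQ _ t]
  simp [superKJ, ordSF, mul_add, mul_sub, mul_smul_comm, smul_add, smul_sub, smul_smul,
      ← mul_assoc Complex.I, -Complex.coe_smul]
  module

theorem DEta_superK_inr (i : Fin m) : DEta (superK Q (.inr i)) = 0 := by
  funext t
  rw [DEta, (hasDerivAt_superK hQ _ t).deriv, superK_eq_superKJ hQ _ t]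
  simp [superKJ, mirSF, mul_add, mul_sub, mul_smul_comm, smul_add, smul_sub, smul_smul,
      ← mul_assoc Complex.I, -Complex.coe_smul]

end Trajectory

end Jets

end

end BiHKT

namespace BiHKT

noncomputable section

/-! ### The (4,4,0) superfields in terms of the (2,4,2) superfields -/

section HKT

open Gr

variable {N n m : ℕ}

local notation "r2" => ((Real.sqrt 2 : ℝ) : ℂ)

instance (K : ℕ) : FiniteDimensional ℂ (Gr K) :=
  inferInstanceAs (FiniteDimensional ℂ (Finset (Fin K) → ℂ))

instance : FiniteDimensional ℝ (Ev N) := FiniteDimensional.complexToReal (Ev N)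

instance : FiniteDimensional ℝ (Od N) := FiniteDimensional.complexToReal (Od N)

theorem conj_real_smul {K : ℕ} (r : ℝ) (f : Gr K) : conj (r • f) = r • conj f := by
  change conj ((r : ℂ) • f) = (r : ℂ) • conj f
  rw [conj_smul, Complex.conj_ofReal]

/-- `reduceConf` as a continuous real linear map. -/
def reduceConfL (N n m : ℕ) : HKTConf N n m →L[ℝ] KConf N n m :=
  LinearMap.toContinuousLinearMap
    { toFun := reduceConf
      map_add' := fun x y => by
        refine Prod.ext (funext fun i => rfl) (funext fun k => funext fun i => ?_)
        fin_cases k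
        · rfl
        · apply Subtype.ext
          change (-Complex.I) • conj ((x.2 1 i : Gr (4 + N)) + (y.2 1 i : Gr (4 + N))) =
            (-Complex.I) • conj (x.2 1 i : Gr (4 + N)) + (-Complex.I) • conj (y.2 1 i : Gr (4 + N))
          rw [conj_add, smul_add]
      map_smul' := fun r x => by
        refine Prod.ext (funext fun i => rfl) (funext fun k => funext fun i => ?_)
        fin_cases k
        · rfl
        · apply Subtype.ext
          change (-Complex.I) • conj (r • (x.2 1 i : Gr (4 + N))) =
            r • (-Complex.I) • conj (x.2 1 i : Gr (4 + N))
          rw [conj_real_smul, smul_comm] }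

/-- `reducedCoord` as a continuous real linear map. -/
def reducedCoordL (N n m : ℕ) : HKTConf N n m →L[ℝ] KAux N n m :=
  LinearMap.toContinuousLinearMap
    { toFun := reducedCoord
      map_add' := fun _ _ => funext fun _ => Subtype.ext (conj_add _ _)
      map_smul' := fun _ _ => funext fun _ => Subtype.ext (conj_real_smul _ _) }

section Trajectory

variable {F : ℝ → HKTConf N n m}

theorem contDiff_reduceTraj (hF : ContDiff ℝ ∞ F) : ContDiff ℝ ∞ (reduceTraj F) :=
  ((reduceConfL N n m).contDiff.comp hF).prodMk
    ((reducedCoordL N n m).contDiff.comp (contDiff_infty_iff_deriv.1 hF).2)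

/-- Since the auxiliary fields are already velocities of the reduced coordinates, a `k`-jet of the
reduced trajectory uses the `(k+1)`-jet of the original one. -/
theorem iteratedDeriv_reduceTraj (hF : ContDiff ℝ ∞ F) (k : ℕ) (t : ℝ) :
    iteratedDeriv k (reduceTraj F) t =
      (reduceConf (iteratedDeriv k F t), reducedCoord (iteratedDeriv (k + 1) F t)) := by
  induction k generalizing t with
  | zero => simp [reduceTraj]
  | succ k ih =>
    rw [iteratedDeriv_succ, show iteratedDeriv k (reduceTraj F) = _ from funext ih]
    exact (((reduceConfL N n m).hasFDerivAt.comp_hasDerivAt t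
      (hasDerivAt_iteratedDeriv hF k t)).prodMk
      ((reducedCoordL N n m).hasFDerivAt.comp_hasDerivAt t
        (hasDerivAt_iteratedDeriv hF (k + 1) t))).deriv

theorem reduceTraj_mem {P : Potentials n m} (hF : F ∈ P.trajHKT N) : reduceTraj F ∈ P.trajK N :=
  ⟨contDiff_reduceTraj hF.1, hF.2⟩

end Trajectory

/-- The second ordinary (4,4,0) superfield with given components, after the rotation of `η`. -/
def ordSF' (v v₁ v₂ w₁ ψ ψ₁ χ χ₁ : Gr (4 + N)) : Gr (4 + N) :=
  v + r2 • (theta N * ψ) - Complex.I • (theta N * (thetaBar N * v₁)) + (Complex.I * r2) • (eta N * χ)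
    - (2 : ℂ) • (eta N * (theta N * w₁)) + r2 • (eta N * (theta N * (thetaBar N * χ₁)))
    - Complex.I • (eta N * (etaBar N * v₁)) - (Complex.I * r2) • (eta N * (etaBar N * (theta N * ψ₁)))
    - eta N * (etaBar N * (theta N * (thetaBar N * v₂)))

/-- The second mirror (4,4,0) superfield with given components, after the rotation of `η`. -/
def mirSF' (v v₁ v₂ w₁ ψ ψ₁ χ χ₁ : Gr (4 + N)) : Gr (4 + N) :=
  v + r2 • (theta N * ψ) - Complex.I • (theta N * (thetaBar N * v₁))
    - (Complex.I * r2) • (etaBar N * χ)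
    + (2 : ℂ) • (etaBar N * (theta N * w₁)) - r2 • (etaBar N * (theta N * (thetaBar N * χ₁)))
    + Complex.I • (eta N * (etaBar N * v₁)) + (Complex.I * r2) • (eta N * (etaBar N * (theta N * ψ₁)))
    + eta N * (etaBar N * (theta N * (thetaBar N * v₂)))

section Derivatives

variable {v v₁ v₂ w₁ ψ ψ₁ χ χ₁ : ℝ → Gr (4 + N)} {dv dv₁ dv₂ dw₁ dψ dψ₁ dχ dχ₁ : Gr (4 + N)}
  {t : ℝ}

theorem hasDerivAt_ordSF' (hv : HasDerivAt v dv t) (hv₁ : HasDerivAt v₁ dv₁ t)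
    (hv₂ : HasDerivAt v₂ dv₂ t) (hw₁ : HasDerivAt w₁ dw₁ t) (hψ : HasDerivAt ψ dψ t)
    (hψ₁ : HasDerivAt ψ₁ dψ₁ t) (hχ : HasDerivAt χ dχ t) (hχ₁ : HasDerivAt χ₁ dχ₁ t) :
    HasDerivAt (fun s => ordSF' (v s) (v₁ s) (v₂ s) (w₁ s) (ψ s) (ψ₁ s) (χ s) (χ₁ s))
      (ordSF' dv dv₁ dv₂ dw₁ dψ dψ₁ dχ dχ₁) t :=
  ((((((((hv.fun_add ((hψ.gr_const_mul _).fun_const_smul _)).fun_sub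
    (((hv₁.gr_const_mul _).gr_const_mul _).fun_const_smul _)).fun_add
    ((hχ.gr_const_mul _).fun_const_smul _)).fun_sub
    (((hw₁.gr_const_mul _).gr_const_mul _).fun_const_smul _)).fun_add
    ((((hχ₁.gr_const_mul _).gr_const_mul _).gr_const_mul _).fun_const_smul _)).fun_sub
    (((hv₁.gr_const_mul _).gr_const_mul _).fun_const_smul _)).fun_sub
    ((((hψ₁.gr_const_mul _).gr_const_mul _).gr_const_mul _).fun_const_smul _)).fun_sub
    ((((hv₂.gr_const_mul _).gr_const_mul _).gr_const_mul _).gr_const_mul _))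

theorem hasDerivAt_mirSF' (hv : HasDerivAt v dv t) (hv₁ : HasDerivAt v₁ dv₁ t)
    (hv₂ : HasDerivAt v₂ dv₂ t) (hw₁ : HasDerivAt w₁ dw₁ t) (hψ : HasDerivAt ψ dψ t)
    (hψ₁ : HasDerivAt ψ₁ dψ₁ t) (hχ : HasDerivAt χ dχ t) (hχ₁ : HasDerivAt χ₁ dχ₁ t) :
    HasDerivAt (fun s => mirSF' (v s) (v₁ s) (v₂ s) (w₁ s) (ψ s) (ψ₁ s) (χ s) (χ₁ s))
      (mirSF' dv dv₁ dv₂ dw₁ dψ dψ₁ dχ dχ₁) t :=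
  ((((((((hv.fun_add ((hψ.gr_const_mul _).fun_const_smul _)).fun_sub
    (((hv₁.gr_const_mul _).gr_const_mul _).fun_const_smul _)).fun_sub
    ((hχ.gr_const_mul _).fun_const_smul _)).fun_add
    (((hw₁.gr_const_mul _).gr_const_mul _).fun_const_smul _)).fun_sub
    ((((hχ₁.gr_const_mul _).gr_const_mul _).gr_const_mul _).fun_const_smul _)).fun_add
    (((hv₁.gr_const_mul _).gr_const_mul _).fun_const_smul _)).fun_add
    ((((hψ₁.gr_const_mul _).gr_const_mul _).gr_const_mul _).fun_const_smul _)).fun_add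
    ((((hv₂.gr_const_mul _).gr_const_mul _).gr_const_mul _).gr_const_mul _))

end Derivatives

/-- The second (4,4,0) superfields, after the rotation of `η`, as functions of the jet of a
trajectory. -/
def hktJ (x v w : HKTConf N n m) : Flav n m → Gr (4 + N)
  | .inl i => ordSF' (x.1 1 (.inl i)) (v.1 1 (.inl i)) (w.1 1 (.inl i)) (conj (v.1 0 (.inl i) : Gr (4 + N)))
      (x.2 1 (.inl i)) (v.2 1 (.inl i)) (conj (x.2 0 (.inl i) : Gr (4 + N)))
      (conj (v.2 0 (.inl i) : Gr (4 + N)))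
  | .inr i => mirSF' (x.1 1 (.inr i)) (v.1 1 (.inr i)) (w.1 1 (.inr i)) (conj (v.1 0 (.inr i) : Gr (4 + N)))
      (x.2 1 (.inr i)) (v.2 1 (.inr i)) (conj (x.2 0 (.inr i) : Gr (4 + N)))
      (conj (v.2 0 (.inr i) : Gr (4 + N)))

section Trajectory

variable {F : ℝ → HKTConf N n m}

theorem hasDerivAt_hktBoson {x : ℝ → HKTConf N n m} {x' : HKTConf N n m} {t : ℝ}
    (h : HasDerivAt x x' t) (k : Fin 2) (i : Flav n m) :
    HasDerivAt (fun s => ((x s).1 k i : Gr (4 + N))) (x'.1 k i : Gr (4 + N)) t :=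
  hasDerivAt_ev (hasDerivAt_pi.1 (hasDerivAt_pi.1 (hasDerivAt_fst h) k) i)

theorem hasDerivAt_hktFermion {x : ℝ → HKTConf N n m} {x' : HKTConf N n m} {t : ℝ}
    (h : HasDerivAt x x' t) (k : Fin 2) (i : Flav n m) :
    HasDerivAt (fun s => ((x s).2 k i : Gr (4 + N))) (x'.2 k i : Gr (4 + N)) t :=
  hasDerivAt_od (hasDerivAt_pi.1 (hasDerivAt_pi.1 (hasDerivAt_snd h) k) i)

theorem chiralHKT_eq (hF : ContDiff ℝ ∞ F) (k : Fin 2) (i : Flav n m) (t : ℝ) :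
    chiralHKT F k i t = ((F t).1 k i : Gr (4 + N)) + r2 • (theta N * ((F t).2 k i : Gr (4 + N))) -
      Complex.I • (theta N * thetaBar N * ((iteratedDeriv 1 F t).1 k i : Gr (4 + N))) := by
  have h : HasDerivAt F (iteratedDeriv 1 F t) t := by
    simpa using hasDerivAt_iteratedDeriv hF 0 t
  rw [chiralHKT, chiral, (hasDerivAt_hktBoson h k i).deriv]

theorem hasDerivAt_chiralHKT (hF : ContDiff ℝ ∞ F) (k : Fin 2) (i : Flav n m) (t : ℝ) :
    HasDerivAt (chiralHKT F k i) (((iteratedDeriv 1 F t).1 k i : Gr (4 + N)) +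
      r2 • (theta N * ((iteratedDeriv 1 F t).2 k i : Gr (4 + N))) -
      Complex.I • (theta N * thetaBar N * ((iteratedDeriv 2 F t).1 k i : Gr (4 + N)))) t := by
  have h : ∀ t, HasDerivAt F (iteratedDeriv 1 F t) t := fun t => by
    simpa using hasDerivAt_iteratedDeriv hF 0 t
  exact hasDerivAt_chiral (b := fun s => ((F s).1 k i : Gr (4 + N)))
    (b₁ := fun s => ((iteratedDeriv 1 F s).1 k i : Gr (4 + N)))
    (f := fun s => ((F s).2 k i : Gr (4 + N))) (fun s => hasDerivAt_hktBoson (h s) k i)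
    (hasDerivAt_hktBoson (hasDerivAt_iteratedDeriv hF 1 t) k i) (hasDerivAt_hktFermion (h t) k i)

/-- The coefficient of `θ` doubles because `∂_θ̄` of the `θθ̄` term and `iθ∂_t` of the lowest
component add up. This `2i` times a velocity is what becomes the auxiliary field. -/
theorem DThetaBar_conj_chiralHKT (hF : ContDiff ℝ ∞ F) (k : Fin 2) (i : Flav n m) (t : ℝ) :
    DThetaBar (fun s => conj (chiralHKT F k i s)) t =
      r2 • conj ((F t).2 k i : Gr (4 + N)) +
      (2 * Complex.I) • (theta N * conj ((iteratedDeriv 1 F t).1 k i : Gr (4 + N))) -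
      (Complex.I * r2) • (theta N * (thetaBar N *
        conj ((iteratedDeriv 1 F t).2 k i : Gr (4 + N)))) := by
  rw [DThetaBar, (hasDerivAt_chiralHKT hF k i t).gr_conj.deriv, chiralHKT_eq hF]
  simp [conj_add, conj_sub, conj_smul, mul_assoc, par_neg, mul_add, mul_sub, mul_smul_comm,
    smul_add, smul_sub, smul_smul, -Complex.coe_smul, -iteratedDeriv_one]
  module

/-- The identification of fields comes from here. With `ε^{12} = -1` and `η ↦ iη`, the term `-η
D̄V̄²` becomes `-iη(√2 ψ̄² + 2iθ ξ̇ + …) = √2 η(-iψ̄²) + 2ηθ ξ̇ + …`, to be compared with `√2 η φ' +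
2ηθ A + …`. In the mirror case `η̄ ↦ -iη̄` gives the opposite sign, in agreement with `-√2 η̄ Ψ`. -/
theorem rho_superHKT_zero (hF : ContDiff ℝ ∞ F) (i : Flav n m) (t : ℝ) :
    rho (superHKT F (0, i) t) = superK (reduceTraj F) i t := by
  rw [superK_eq_superKJ (contDiff_reduceTraj hF)]
  simp only [iteratedDeriv_reduceTraj hF]
  rcases i with i | i
  · simp only [superHKT, superKJ, ordSF, Fin.sum_univ_two, epsUp, DThetaBar_conj_chiralHKT hF,
      (hasDerivAt_chiralHKT hF _ _ _).deriv, reduceTraj, reduceConf, reducedCoord]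
    simp only [chiralHKT_eq hF]
    simp [mul_assoc, mul_add, mul_sub, mul_smul_comm, smul_add, smul_sub, smul_smul,
      -Complex.coe_smul]
    match_scalars <;> grind [Complex.I_sq]
  · simp only [superHKT, superKJ, mirSF, Fin.sum_univ_two, epsUp, DThetaBar_conj_chiralHKT hF,
      (hasDerivAt_chiralHKT hF _ _ _).deriv, reduceTraj, reduceConf, reducedCoord]
    simp only [chiralHKT_eq hF]
    simp [mul_assoc, mul_add, mul_sub, mul_smul_comm, smul_add, smul_sub, smul_smul,
      -Complex.coe_smul]
    match_scalars <;> grind [Complex.I_sq]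

theorem rho_superHKT_one (hF : ContDiff ℝ ∞ F) (i : Flav n m) (t : ℝ) :
    rho (superHKT F (1, i) t) = hktJ (F t) (iteratedDeriv 1 F t) (iteratedDeriv 2 F t) i := by
  rcases i with i | i
  · simp only [superHKT, hktJ, ordSF', Fin.sum_univ_two, epsUp, DThetaBar_conj_chiralHKT hF,
      (hasDerivAt_chiralHKT hF _ _ _).deriv]
    simp only [chiralHKT_eq hF]
    simp [mul_assoc, mul_add, mul_sub, mul_smul_comm, smul_add, smul_sub, smul_smul,
      -Complex.coe_smul]
    match_scalars <;> grind [Complex.I_sq]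
  · simp only [superHKT, hktJ, mirSF', Fin.sum_univ_two, epsUp, DThetaBar_conj_chiralHKT hF,
      (hasDerivAt_chiralHKT hF _ _ _).deriv]
    simp only [chiralHKT_eq hF]
    simp [mul_assoc, mul_add, mul_sub, mul_smul_comm, smul_add, smul_sub, smul_smul,
      -Complex.coe_smul]
    match_scalars <;> grind [Complex.I_sq]

end Trajectory

end HKT

end

end BiHKT

namespace BiHKT

noncomputable section

/-! ### The constraints that tie the second half of a (4,4,0) multiplet to the first. -/

section Constraints

open Gr

variable {N n m : ℕ} {F : ℝ → HKTConf N n m}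

local notation "r2" => ((Real.sqrt 2 : ℝ) : ℂ)

/-- The superfields `Ξ` and `Σ`, after the rotation of `η`. -/
def xiField (F : ℝ → HKTConf N n m) (i : Flav n m) : SField N :=
  fun t => conj (rho (superHKT F (1, i) t))

theorem hasDerivAt_hktJ {x v w : ℝ → HKTConf N n m} {x' v' w' : HKTConf N n m} {t : ℝ}
    (hx : HasDerivAt x x' t) (hv : HasDerivAt v v' t) (hw : HasDerivAt w w' t) (i : Flav n m) :
    HasDerivAt (fun s => hktJ (x s) (v s) (w s) i) (hktJ x' v' w' i) t := by
  rcases i with i | i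
  · exact hasDerivAt_ordSF' (hasDerivAt_hktBoson hx _ _) (hasDerivAt_hktBoson hv _ _)
      (hasDerivAt_hktBoson hw _ _) (hasDerivAt_hktBoson hv _ _).gr_conj
      (hasDerivAt_hktFermion hx _ _) (hasDerivAt_hktFermion hv _ _)
      (hasDerivAt_hktFermion hx _ _).gr_conj (hasDerivAt_hktFermion hv _ _).gr_conj
  · exact hasDerivAt_mirSF' (hasDerivAt_hktBoson hx _ _) (hasDerivAt_hktBoson hv _ _)
      (hasDerivAt_hktBoson hw _ _) (hasDerivAt_hktBoson hv _ _).gr_conj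
      (hasDerivAt_hktFermion hx _ _) (hasDerivAt_hktFermion hv _ _)
      (hasDerivAt_hktFermion hx _ _).gr_conj (hasDerivAt_hktFermion hv _ _).gr_conj

theorem xiField_eq (hF : ContDiff ℝ ∞ F) (i : Flav n m) (t : ℝ) :
    xiField F i t = conj (hktJ (F t) (iteratedDeriv 1 F t) (iteratedDeriv 2 F t) i) := by
  rw [xiField, rho_superHKT_one hF]

theorem hasDerivAt_xiField (hF : ContDiff ℝ ∞ F) (i : Flav n m) (t : ℝ) :
    HasDerivAt (xiField F i) (conj (hktJ (iteratedDeriv 1 F t) (iteratedDeriv 2 F t)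
      (iteratedDeriv 3 F t) i)) t := by
  have h : HasDerivAt F (iteratedDeriv 1 F t) t := by
    simpa using hasDerivAt_iteratedDeriv hF 0 t
  rw [show xiField F i = _ from funext (xiField_eq hF i)]
  exact (hasDerivAt_hktJ h (hasDerivAt_iteratedDeriv hF 1 t) (hasDerivAt_iteratedDeriv hF 2 t)
    i).gr_conj

/-- The two halves of a (4,4,0) multiplet are built from the same components. A covariant derivative
of `Ξ` or `Σ` that does not vanish is therefore a covariant derivative of `𝒵` or `𝒰`; the factors
`±i` reflect the rotation of `η`. This and the next three identities are what convert the couplings.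
-/
theorem DThetaBar_xiField_inl (hF : ContDiff ℝ ∞ F) (i : Fin n) (t : ℝ) :
    DThetaBar (xiField F (.inl i)) t = Complex.I • DEta (superK (reduceTraj F) (.inl i)) t := by
  have hQ := contDiff_reduceTraj hF
  rw [DThetaBar, DEta, (hasDerivAt_xiField hF _ t).deriv, (hasDerivAt_superK hQ _ t).deriv,
    superK_eq_superKJ hQ, xiField_eq hF]
  simp only [iteratedDeriv_reduceTraj hF, superKJ, hktJ, ordSF, ordSF', reduceTraj, reduceConf,
    reducedCoord]
  simp [conj_add, conj_sub, conj_smul, conj_conj, conj_neg, Complex.conj_ofNat, par_neg, mul_add, mul_sub,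
    mul_smul_comm, smul_add, smul_sub, smul_smul, -Complex.coe_smul]
  match_scalars <;> grind [Complex.I_sq]

theorem DEtaBar_xiField_inl (hF : ContDiff ℝ ∞ F) (i : Fin n) (t : ℝ) :
    DEtaBar (xiField F (.inl i)) t = (-Complex.I) • DTheta (superK (reduceTraj F) (.inl i)) t := by
  have hQ := contDiff_reduceTraj hF
  rw [DEtaBar, DTheta, (hasDerivAt_xiField hF _ t).deriv, (hasDerivAt_superK hQ _ t).deriv,
    superK_eq_superKJ hQ, xiField_eq hF]
  simp only [iteratedDeriv_reduceTraj hF, superKJ, hktJ, ordSF, ordSF', reduceTraj, reduceConf,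
    reducedCoord]
  simp [conj_add, conj_sub, conj_smul, conj_conj, conj_neg, Complex.conj_ofNat, par_neg, mul_add, mul_sub,
    mul_smul_comm, smul_add, smul_sub, smul_smul, -Complex.coe_smul]
  match_scalars <;> grind [Complex.I_sq]

theorem DThetaBar_xiField_inr (hF : ContDiff ℝ ∞ F) (i : Fin m) (t : ℝ) :
    DThetaBar (xiField F (.inr i)) t = Complex.I • DEtaBar (superK (reduceTraj F) (.inr i)) t := by
  have hQ := contDiff_reduceTraj hF
  rw [DThetaBar, DEtaBar, (hasDerivAt_xiField hF _ t).deriv, (hasDerivAt_superK hQ _ t).deriv,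
    superK_eq_superKJ hQ, xiField_eq hF]
  simp only [iteratedDeriv_reduceTraj hF, superKJ, hktJ, mirSF, mirSF', reduceTraj, reduceConf,
    reducedCoord]
  simp [conj_add, conj_sub, conj_smul, conj_conj, conj_neg, Complex.conj_ofNat, par_neg, mul_add, mul_sub,
    mul_smul_comm, smul_add, smul_sub, smul_smul, -Complex.coe_smul]
  match_scalars <;> grind [Complex.I_sq]

theorem DEta_xiField_inr (hF : ContDiff ℝ ∞ F) (i : Fin m) (t : ℝ) :
    DEta (xiField F (.inr i)) t = (-Complex.I) • DTheta (superK (reduceTraj F) (.inr i)) t := by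
  have hQ := contDiff_reduceTraj hF
  rw [DEta, DTheta, (hasDerivAt_xiField hF _ t).deriv, (hasDerivAt_superK hQ _ t).deriv,
    superK_eq_superKJ hQ, xiField_eq hF]
  simp only [iteratedDeriv_reduceTraj hF, superKJ, hktJ, mirSF, mirSF', reduceTraj, reduceConf,
    reducedCoord]
  simp [conj_add, conj_sub, conj_smul, conj_conj, conj_neg, Complex.conj_ofNat, par_neg, mul_add, mul_sub,
    mul_smul_comm, smul_add, smul_sub, smul_smul, -Complex.coe_smul]
  match_scalars <;> grind [Complex.I_sq]

end Constraints

end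

end BiHKT

namespace BiHKT

noncomputable section

/-! ### The holomorphic potentials

The couplings are labelled by `(i, k) : Flav n m × Fin 2`: `A1`, `A2` for `i` ordinary and `B1`, `B2`
for `i` mirror. -/

section Holomorphic

variable {J : Type} [Fintype J] [DecidableEq J]

/-- The Cauchy–Riemann equation: the real differential is the complex one with scalars restricted,
so the imaginary direction contributes `i · i = -1` times the real one. -/
theorem wirt_one_eq_zero_of_analyticAt {f : (J → ℂ) → ℂ} {x : J → ℂ} (hf : AnalyticAt ℂ f x)
    (j : J) : wirt (j, 1) f x = 0 := by
  have h : fderiv ℝ f x = (fderiv ℂ f x).restrictScalars ℝ :=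
    (hf.differentiableAt.hasFDerivAt.restrictScalars ℝ).fderiv
  have e : (Pi.single j Complex.I : J → ℂ) = Complex.I • Pi.single j 1 := by
    rw [← Pi.single_smul, smul_eq_mul, mul_one]
  rw [wirt_apply, h, e]
  simp only [ContinuousLinearMap.coe_restrictScalars', map_smul, smul_eq_mul, wirtSign]
  simp [← mul_assoc]

theorem contDiffOn_of_analyticOnNhd {f : (J → ℂ) → ℂ} {U : Set (J → ℂ)}
    (hf : AnalyticOnNhd ℂ f U) : ContDiffOn ℝ ∞ f U :=
  fun x hx => ((hf x hx).contDiffAt.restrict_scalars ℝ).contDiffWithinAt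

end Holomorphic

section Couplings

variable {n m : ℕ}

/-- The sign of a multiplet in the metric: `1` for ordinary ones, `-1` for mirror ones. -/
def flavSign : Flav n m → ℂ
  | .inl _ => 1
  | .inr _ => -1

/-- Whether the potential with the label `τ` depends on a coordinate or on its conjugate. -/
def holFlip : Flav n m × Fin 2 → Flav n m → Fin 2
  | (_, 0), _ => 0
  | (.inl _, 1), .inl _ => 0
  | (.inl _, 1), .inr _ => 1
  | (.inr _, 1), .inl _ => 1
  | (.inr _, 1), .inr _ => 0

/-- The change of variables that makes the potential with the label `τ` holomorphic. -/
def holChange (τ : Flav n m × Fin 2) : CoordChange (Flav n m) (Flav n m) := ⟨id, holFlip τ⟩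

/-- The potentials, as functions of their holomorphic arguments. -/
def Potentials.holPot (P : Potentials n m) : Flav n m × Fin 2 → (Flav n m → ℂ) → ℂ
  | (.inl a, 0) => P.A1 a
  | (.inl a, 1) => P.A2 a
  | (.inr α, 0) => P.B1 α
  | (.inr α, 1) => P.B2 α

/-- The potentials, as functions of `(z, u)`. -/
def Potentials.pot (P : Potentials n m) (τ : Flav n m × Fin 2) (q : Flav n m → ℂ) : ℂ :=
  P.holPot τ ((holChange τ).mapC q)

theorem holChange_zero (i : Flav n m) : (holChange (i, 0)).mapC = id := by
  funext q j
  rcases i with i | i <;> rfl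

theorem holChange_inl (a : Fin n) : (holChange (.inl a, 1) : CoordChange (Flav n m) _).mapC = conjMirror := by
  funext q j
  rcases j with j | j <;> rfl

theorem holChange_inr (α : Fin m) : (holChange (.inr α, 1) : CoordChange (Flav n m) _).mapC = conjOrdinary := by
  funext q j
  rcases j with j | j <;> rfl

/-- Conjugating a fixed set of coordinates is an involution. The domain of each holomorphic
potential, pulled back once more, is therefore `P.Ω`. -/
theorem holChange_mapC_mapC (τ : Flav n m × Fin 2) (q : Flav n m → ℂ) :
    (holChange τ).mapC ((holChange τ).mapC q) = q := by
  funext j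
  change (if holFlip τ j = 0 then (if holFlip τ j = 0 then q j else starRingEnd ℂ (q j))
    else starRingEnd ℂ (if holFlip τ j = 0 then q j else starRingEnd ℂ (q j))) = q j
  split_ifs
  · rfl
  · exact Complex.conj_conj _

namespace Potentials.Regular

variable {P : Potentials n m} (hP : P.Regular)
include hP

theorem analytic_holPot (τ : Flav n m × Fin 2) :
    AnalyticOnNhd ℂ (P.holPot τ) ((holChange τ).mapC ⁻¹' P.Ω) := by
  obtain ⟨i, k⟩ := τ
  fin_cases k
  · simp only [Fin.zero_eta, holChange_zero]
    rcases i with i | i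
    · exact hP.hol_A1 i
    · exact hP.hol_B1 i
  · rcases i with i | i
    · simp only [Fin.mk_one, holChange_inl]
      exact hP.hol_A2 i
    · simp only [Fin.mk_one, holChange_inr]
      exact hP.hol_B2 i

theorem isOpen_holDomain (τ : Flav n m × Fin 2) : IsOpen ((holChange τ).mapC ⁻¹' P.Ω) :=
  (holChange τ).isOpen_preimage hP.isOpen

theorem preimage_holDomain (τ : Flav n m × Fin 2) :
    (holChange τ).mapC ⁻¹' ((holChange τ).mapC ⁻¹' P.Ω) = P.Ω := by
  ext q
  simp only [Set.mem_preimage, holChange_mapC_mapC]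

theorem contDiffOn_pot (τ : Flav n m × Fin 2) : ContDiffOn ℝ ∞ (P.pot τ) P.Ω := by
  have := (holChange τ).contDiffOn_comp
    (contDiffOn_of_analyticOnNhd (hP.analytic_holPot τ))
  rwa [hP.preimage_holDomain] at this

theorem wirt_pot (τ : Flav n m × Fin 2) {q : Flav n m → ℂ} (hq : q ∈ P.Ω) (j : Flav n m) :
    wirt (j, holFlip τ j + 1) (P.pot τ) q = 0 := by
  have hq' : (holChange τ).mapC q ∈ (holChange τ).mapC ⁻¹' P.Ω := by
    rwa [Set.mem_preimage, holChange_mapC_mapC]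
  have := (holChange τ).wirt_comp (hP.isOpen_holDomain τ)
    (contDiffOn_of_analyticOnNhd (hP.analytic_holPot τ))
    (j, holFlip τ j + 1) hq'
  refine this.trans (Finset.sum_eq_zero fun d _ => ?_)
  split_ifs with h
  · obtain ⟨j', k⟩ := d
    simp only [CoordChange.mapIdx, holChange, id, Prod.mk.injEq] at h
    obtain ⟨rfl, h⟩ := h
    rw [← add_left_cancel h, wirt_one_eq_zero_of_analyticAt (hP.analytic_holPot τ _ hq'), mul_zero]
  · rw [zero_mul]

theorem contDiffOn_K : ContDiffOn ℝ ∞ (fun q => (P.K q : ℂ)) P.Ω :=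
  Complex.ofRealCLM.contDiff.comp_contDiffOn hP.smooth_K

theorem superEval_holPot {N : ℕ} (τ : Flav n m × Fin 2) {X : Flav n m → Gr (4 + N)}
    (hX : bodies X ∈ P.Ω) :
    superEval (P.holPot τ) ((holChange τ).mapG X) = superEval (P.pot τ) X := by
  refine (superEval_comp (holChange τ) (hP.isOpen_holDomain τ)
    (contDiffOn_of_analyticOnNhd (hP.analytic_holPot τ)) ?_).symm
  rwa [Set.mem_preimage, holChange_mapC_mapC]

end Potentials.Regular

end Couplings

end

end BiHKT

namespace BiHKT

noncomputable section

/-! ### Covariant derivatives and integrals attached to the couplings -/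

section Operators

open Gr

variable {N n m : ℕ}

theorem EvenDer.neg {K : ℕ} {δ : Gr K → Gr K} (h : EvenDer δ) : EvenDer fun f => -δ f where
  add a b := by rw [h.add, neg_add]
  smul c a := by rw [h.smul, smul_neg]
  mul a b ha hb := by rw [h.mul a b ha hb, neg_add, neg_mul, mul_neg]
  one := by rw [h.one, neg_zero]

/-- The Berezin integral over the subspace on which a coupling lives. -/
def chiralInt : Flav n m × Fin 2 → Gr (4 + N) → Gr (4 + N)
  | (_, 0) => intThetaEtaEtaBar
  | (.inl _, 1) => intThetaThetaBarEta
  | (.inr _, 1) => intThetaThetaBarEtaBar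

/-- The odd part of the covariant derivative in a coupling. -/
def covPart : Flav n m × Fin 2 → Gr (4 + N) → Gr (4 + N)
  | (.inl _, 0) => dEta
  | (.inr _, 0) => fun f => -dEtaBar f
  | (_, 1) => dTheta

/-- The coefficient of `∂_t` in the covariant derivative in a coupling. -/
def covCoeff (N : ℕ) : Flav n m × Fin 2 → Gr (4 + N)
  | (.inl _, 0) => -Complex.I • etaBar N
  | (.inr _, 0) => Complex.I • eta N
  | (_, 1) => -Complex.I • thetaBar N

/-- The odd part of the covariant derivative that annihilates a potential. -/
def annPart : Flav n m × Fin 2 → Gr (4 + N) → Gr (4 + N)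
  | (_, 0) => fun f => -dThetaBar f
  | (.inl _, 1) => fun f => -dEtaBar f
  | (.inr _, 1) => dEta

/-- The coefficient of `∂_t` in the covariant derivative that annihilates a potential. -/
def annCoeff (N : ℕ) : Flav n m × Fin 2 → Gr (4 + N)
  | (_, 0) => Complex.I • theta N
  | (.inl _, 1) => Complex.I • eta N
  | (.inr _, 1) => -Complex.I • etaBar N

/-- The factor by which the two covariant derivatives differ on the reduced superfields. -/
def covFactor : Flav n m × Fin 2 → ℂ
  | (_, 0) => Complex.I
  | (_, 1) => -Complex.I

/-- The covariant derivative in a coupling, as a function of a superfield and its time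
derivative. -/
def cov (τ : Flav n m × Fin 2) (f f' : Gr (4 + N)) : Gr (4 + N) := covPart τ f + covCoeff N τ * f'

/-- The covariant derivative that annihilates a potential. -/
def ann (τ : Flav n m × Fin 2) (f f' : Gr (4 + N)) : Gr (4 + N) := annPart τ f + annCoeff N τ * f'

theorem evenDer_annPart : ∀ τ : Flav n m × Fin 2, EvenDer (annPart τ : Gr (4 + N) → Gr (4 + N))
  | (.inl _, 0) => isOddDer_dThetaBar.evenDer.neg
  | (.inr _, 0) => isOddDer_dThetaBar.evenDer.neg
  | (.inl _, 1) => isOddDer_dEtaBar.evenDer.neg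
  | (.inr _, 1) => isOddDer_dEta.evenDer

theorem evenDer_covPart : ∀ τ : Flav n m × Fin 2, EvenDer (covPart τ : Gr (4 + N) → Gr (4 + N))
  | (.inl _, 0) => isOddDer_dEta.evenDer
  | (.inr _, 0) => isOddDer_dEtaBar.evenDer.neg
  | (.inl _, 1) => isOddDer_dTheta.evenDer
  | (.inr _, 1) => isOddDer_dTheta.evenDer

theorem chiralInt_add (τ : Flav n m × Fin 2) (f g : Gr (4 + N)) :
    chiralInt τ (f + g) = chiralInt τ f + chiralInt τ g :=
  match τ with
  | (.inl _, 0) => by simp [chiralInt, intThetaEtaEtaBar]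
  | (.inr _, 0) => by simp [chiralInt, intThetaEtaEtaBar]
  | (.inl _, 1) => by simp [chiralInt, intThetaThetaBarEta]
  | (.inr _, 1) => by simp [chiralInt, intThetaThetaBarEtaBar]

theorem chiralInt_smul (τ : Flav n m × Fin 2) (c : ℂ) (f : Gr (4 + N)) :
    chiralInt τ (c • f) = c • chiralInt τ f :=
  match τ with
  | (.inl _, 0) => by simp [chiralInt, intThetaEtaEtaBar]
  | (.inr _, 0) => by simp [chiralInt, intThetaEtaEtaBar]
  | (.inl _, 1) => by simp [chiralInt, intThetaThetaBarEta]
  | (.inr _, 1) => by simp [chiralInt, intThetaThetaBarEtaBar]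

/-- `chiralInt` as a continuous linear map. -/
def chiralIntL (N : ℕ) (τ : Flav n m × Fin 2) : Gr (4 + N) →L[ℝ] Gr (4 + N) :=
  (LinearMap.toContinuousLinearMap
    ({ toFun := chiralInt τ
       map_add' := chiralInt_add τ
       map_smul' := chiralInt_smul τ } : Gr (4 + N) →ₗ[ℂ] Gr (4 + N))).restrictScalars ℝ

theorem chiralInt_sum (τ : Flav n m × Fin 2) {ι : Type*} (s : Finset ι) (f : ι → Gr (4 + N)) :
    chiralInt τ (∑ i ∈ s, f i) = ∑ i ∈ s, chiralInt τ (f i) :=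
  map_sum (chiralIntL N τ) f s

theorem _root_.HasDerivAt.chiralInt (τ : Flav n m × Fin 2) {g : ℝ → Gr (4 + N)} {g' : Gr (4 + N)}
    {t : ℝ} (hg : HasDerivAt g g' t) : HasDerivAt (fun s => chiralInt τ (g s)) (chiralInt τ g') t :=
  (chiralIntL N τ).hasFDerivAt.comp_hasDerivAt t hg

/-- The four derivatives of the full measure are those of the smaller one and `annPart`, up to sign;
the restriction to the origin loses nothing because the full integral contains no odd coordinates.
`g'` is arbitrary here; for `g' = ġ` the last term is a total time derivative. -/
theorem intFull_eq_chiralInt (τ : Flav n m × Fin 2) (g g' : Gr (4 + N)) :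
    intFull g = -chiralInt τ (ann τ g g') + chiralInt τ (annCoeff N τ * g') := by
  have h : intFull g = -chiralInt τ (annPart τ g) :=
    match τ with
    | (.inl _, 0) => by
      rw [← atZero_intFull]; simp [chiralInt, annPart, intThetaEtaEtaBar, intFull]
    | (.inr _, 0) => by
      rw [← atZero_intFull]; simp [chiralInt, annPart, intThetaEtaEtaBar, intFull]
    | (.inl _, 1) => by
      rw [← atZero_intFull]; simp [chiralInt, annPart, intThetaThetaBarEta, intFull]
    | (.inr _, 1) => by
      rw [← atZero_intFull]; simp [chiralInt, annPart, intThetaThetaBarEtaBar, intFull]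
  rw [h, ann, chiralInt_add]
  abel

/-- The chain rule for a covariant derivative: its odd part is a derivation on even elements, and
the odd coefficient of `∂_t` commutes with the even factor. -/
theorem superEval_ann {J : Type} [Fintype J] [DecidableEq J] {U : Set (J → ℂ)} {f : (J → ℂ) → ℂ}
    {Y Y' : J → Gr (4 + N)} (τ : Flav n m × Fin 2) (hU : IsOpen U) (hf : ContDiffOn ℝ ∞ f U)
    (hY : bodies Y ∈ U) (hYe : ∀ j, (Y j).IsEven) :
    ann τ (superEval f Y) (∑ c, superEval (wirt c f) Y * coordG Y' c) =
      ∑ c, superEval (wirt c f) Y * ann τ (coordG Y c) (coordG Y' c) := by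
  rw [ann, (evenDer_annPart τ).superEval (by omega) hU hf hY hYe, Finset.mul_sum,
    ← Finset.sum_add_distrib]
  refine Finset.sum_congr rfl fun c _ => ?_
  rw [ann, mul_add, ← mul_assoc, ← mul_assoc,
    (isEven_superEval hU (contDiffOn_wirt hU hf c) hY hYe).comm (annCoeff N τ)]

/-- A factor annihilated by the covariant derivative can be taken out. This is how the derivative is
made to fall on `Ξ` or `Σ` only. -/
theorem ann_mul (τ : Flav n m × Fin 2) {e e' ξ ξ' : Gr (4 + N)} (he : e.IsEven) (hξ : ξ.IsEven)
    (h : ann τ e e' = 0) : ann τ (e * ξ) (e' * ξ + e * ξ') = e * ann τ ξ ξ' := by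
  rw [ann] at h
  rw [ann, (evenDer_annPart τ).mul e ξ he hξ, ann, mul_add, mul_add, ← mul_assoc, ← mul_assoc,
    ← mul_assoc, he.comm (annCoeff N τ), eq_neg_of_add_eq_zero_left h, neg_mul]
  abel

end Operators

/-! ### Properties of the superfields along trajectories -/

section Superfields

open Gr

variable {N n m : ℕ}

theorem isEven_superKJ (x v w : KConf N n m) (a : KAux N n m) (i : Flav n m) :
    (superKJ x v w a i).IsEven := by
  rw [isEven_iff]
  rcases i with i | i
  · simp [superKJ, ordSF, par_add, par_sub, par_smul, par_neg, -Complex.coe_smul]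
  · simp [superKJ, mirSF, par_add, par_sub, par_smul, par_neg, -Complex.coe_smul]

theorem isEven_hktJ (x v w : HKTConf N n m) (i : Flav n m) : (hktJ x v w i).IsEven := by
  rw [isEven_iff]
  rcases i with i | i
  · simp [hktJ, ordSF', par_add, par_sub, par_smul, par_neg, -Complex.coe_smul]
  · simp [hktJ, mirSF', par_add, par_sub, par_smul, par_neg, -Complex.coe_smul]

theorem body_neg {K : ℕ} (f : Gr K) : body (-f) = -body f := rfl

theorem bodies_superKJ (x v w : KConf N n m) (a : KAux N n m) :
    bodies (superKJ x v w a) = fun i => body (x.1 i : Gr (4 + N)) := by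
  funext i
  change body (superKJ x v w a i) = _
  rcases i with i | i
  · simp [superKJ, ordSF, body_add, body_sub, body_neg, body_smul, -Complex.coe_smul]
  · simp [superKJ, mirSF, body_add, body_sub, body_neg, body_smul, -Complex.coe_smul]

theorem atZero_superKJ (x v w : KConf N n m) (a : KAux N n m) (i : Flav n m) :
    atZero (superKJ x v w a i) = x.1 i := by
  rcases i with i | i
  · simp [superKJ, ordSF, -Complex.coe_smul]
  · simp [superKJ, mirSF, -Complex.coe_smul]

theorem conj_dEta_sub {f f' : Gr (4 + N)} (hf : f.IsEven) (hf' : f'.IsEven) :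
    conj (dEta f - Complex.I • (etaBar N * f')) =
      -dEtaBar (conj f) + Complex.I • (eta N * conj f') := by
  simp [conj_sub, conj_dEta, conj_smul, hf.conj.par_eq, hf'.conj.par_eq]

theorem conj_dEtaBar_add {f f' : Gr (4 + N)} (hf : f.IsEven) (hf' : f'.IsEven) :
    conj (-dEtaBar f + Complex.I • (eta N * f')) =
      dEta (conj f) - Complex.I • (etaBar N * conj f') := by
  simp [conj_add, conj_neg, conj_dEtaBar, conj_smul, hf.conj.par_eq, hf'.conj.par_eq, sub_eq_add_neg]

section Trajectory

variable {Q : ℝ → KConf N n m × KAux N n m} (hQ : ContDiff ℝ ∞ Q)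
include hQ

theorem isEven_superK (i : Flav n m) (t : ℝ) : (superK Q i t).IsEven := by
  rw [superK_eq_superKJ hQ]; exact isEven_superKJ _ _ _ _ _

theorem isEven_deriv_superK (i : Flav n m) (t : ℝ) : (deriv (superK Q i) t).IsEven := by
  rw [(hasDerivAt_superK hQ i t).deriv]; exact isEven_superKJ _ _ _ _ _

theorem ann_superK (τ : Flav n m × Fin 2) (j : Flav n m) (t : ℝ) :
    ann τ (coordG (fun i => superK Q i t) (j, holFlip τ j))
      (coordG (fun i => deriv (superK Q i) t) (j, holFlip τ j)) = 0 := by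
  have h1 : ∀ i, -dThetaBar (superK Q i t) + Complex.I • (theta N * deriv (superK Q i) t) = 0 :=
    fun i => congrFun (DThetaBar_superK hQ i) t
  have h2 : ∀ i : Fin n, -dEtaBar (superK Q (.inl i) t) +
      Complex.I • (eta N * deriv (superK Q (.inl i)) t) = 0 :=
    fun i => congrFun (DEtaBar_superK_inl hQ i) t
  have h3 : ∀ i : Fin m, dEta (superK Q (.inr i) t) -
      Complex.I • (etaBar N * deriv (superK Q (.inr i)) t) = 0 :=
    fun i => congrFun (DEta_superK_inr hQ i) t
  have h4 := fun i => congrArg conj (h2 i)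
  have h5 := fun i => congrArg conj (h3 i)
  simp only [conj_dEta_sub (isEven_superK hQ _ _) (isEven_deriv_superK hQ _ _), conj_zero,
    conj_dEtaBar_add (isEven_superK hQ _ _) (isEven_deriv_superK hQ _ _)] at h4 h5
  match τ, j with
  | (.inl _, 0), j => simpa [ann, annPart, annCoeff, coordG, holFlip, smul_mul_assoc] using h1 j
  | (.inr _, 0), j => simpa [ann, annPart, annCoeff, coordG, holFlip, smul_mul_assoc] using h1 j
  | (.inl _, 1), .inl j => simpa [ann, annPart, annCoeff, coordG, holFlip, smul_mul_assoc] using h2 j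
  | (.inl _, 1), .inr j => simpa [ann, annPart, annCoeff, coordG, holFlip, smul_mul_assoc] using h5 j
  | (.inr _, 1), .inl j =>
    simpa [ann, annPart, annCoeff, coordG, holFlip, smul_mul_assoc, sub_eq_add_neg] using h4 j
  | (.inr _, 1), .inr j =>
    simpa [ann, annPart, annCoeff, coordG, holFlip, smul_mul_assoc, sub_eq_add_neg] using h3 j

end Trajectory

theorem ann_xiField {F : ℝ → HKTConf N n m} (hF : ContDiff ℝ ∞ F) (τ : Flav n m × Fin 2) (t : ℝ) :
    ann τ (xiField F τ.1 t) (deriv (xiField F τ.1) t) =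
      covFactor τ • cov τ (superK (reduceTraj F) τ.1 t) (deriv (superK (reduceTraj F) τ.1) t) :=
  match τ with
  | (.inl i, 0) => by
    simpa [ann, annPart, annCoeff, smul_mul_assoc, cov, covPart, covCoeff, covFactor, DThetaBar, DEta,
      sub_eq_add_neg] using DThetaBar_xiField_inl hF i t
  | (.inr i, 0) => by
    simpa [ann, annPart, annCoeff, smul_mul_assoc, cov, covPart, covCoeff, covFactor, DThetaBar, DEtaBar,
      sub_eq_add_neg] using DThetaBar_xiField_inr hF i t
  | (.inl i, 1) => by
    simpa [ann, annPart, annCoeff, smul_mul_assoc, cov, covPart, covCoeff, covFactor, DTheta, DEtaBar,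
      sub_eq_add_neg] using DEtaBar_xiField_inl hF i t
  | (.inr i, 1) => by
    simpa [ann, annPart, annCoeff, smul_mul_assoc, cov, covPart, covCoeff, covFactor, DTheta, DEta,
      sub_eq_add_neg] using DEta_xiField_inr hF i t

end Superfields

end

end BiHKT

namespace BiHKT

noncomputable section

/-! ### Lagrangians up to total derivatives -/

section Mechanics

variable {X X' Y : Type}
  [NormedAddCommGroup X] [NormedSpace ℝ X] [NormedAddCommGroup X'] [NormedSpace ℝ X']
  [NormedAddCommGroup Y] [NormedSpace ℝ Y]

theorem EquivLagr.trans {adm : Set (ℝ → X)} {L L' L'' : (ℝ → X) → ℝ → Y}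
    (h : EquivLagr adm L L') (h' : EquivLagr adm L' L'') : EquivLagr adm L L'' := by
  obtain ⟨k, G, hG⟩ := h
  obtain ⟨k', G', hG'⟩ := h'
  -- Jets of order `k + k'` contain both jets, so the two boundary terms can be added.
  refine ⟨k + k', fun j => G (fun i => j (Fin.castLE (by omega) i)) +
    G' (fun i => j (Fin.castLE (by omega) i)), fun F hF t => ?_⟩
  refine ((hG F hF t).fun_add (hG' F hF t)).congr_deriv ?_
  abel

end Mechanics

/-! ### The prepotential in superspace -/

section Prepotential

open Gr

variable {N n m : ℕ} {P : Potentials n m}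

/-- The projection `(v¹, v²) ↦ v¹`. -/
def firstCoord (n m : ℕ) : CoordChange (Flav n m) (Fin 2 × Flav n m) := ⟨fun i => (0, i), fun _ => 0⟩

/-- The coupling functions of the prepotential. -/
def Potentials.coupling (P : Potentials n m) (i : Flav n m) (q : Flav n m → ℂ) : ℂ :=
  flavSign i * (P.pot (i, 0) q + P.pot (i, 1) q)

/-- `Ξ` and `Σ` are conjugates of the second coordinates, hence the index `1` next to the coupling
function and `0` next to its conjugate. The relative sign of the mirror couplings is put into
`flavSign`. -/
theorem Potentials.prepotential_eq (P : Potentials n m) :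
    P.prepotential = fun x => (P.K ((firstCoord n m).mapC x) : ℂ) +
      ∑ i, (P.coupling i ((firstCoord n m).mapC x) * coordC x ((1, i), 1) +
        starRingEnd ℂ (P.coupling i ((firstCoord n m).mapC x)) * coordC x ((1, i), 0)) := by
  funext x
  have h0 : ∀ (i : Flav n m) q, P.pot (i, 0) q = P.holPot (i, 0) q := fun i q => by
    rw [Potentials.pot, holChange_zero]; rfl
  have h1 : ∀ (a : Fin n) q, P.pot (.inl a, 1) q = P.A2 a (conjMirror q) := fun i q => by
    rw [Potentials.pot, holChange_inl]; rfl
  have h2 : ∀ (a : Fin m) q, P.pot (.inr a, 1) q = P.B2 a (conjOrdinary q) := fun i q => by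
    rw [Potentials.pot, holChange_inr]; rfl
  have hm : (firstCoord n m).mapC x = fun i => x (0, i) := rfl
  simp only [Potentials.prepotential, hm, Fintype.sum_sum_type, Potentials.coupling, h0, h1, h2,
    Potentials.holPot, flavSign, coordC, Finset.sum_add_distrib, Complex.conj_conj]
  simp only [one_mul, neg_mul, map_neg, Finset.sum_neg_distrib, if_true, one_ne_zero, if_false]
  ring

theorem Potentials.Regular.contDiffOn_coupling (hP : P.Regular) (i : Flav n m) :
    ContDiffOn ℝ ∞ (P.coupling i) P.Ω :=
  contDiffOn_const.mul ((hP.contDiffOn_pot _).add (hP.contDiffOn_pot _))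

theorem Potentials.Regular.superEval_prepotential (hP : P.Regular)
    {X : Fin 2 × Flav n m → Gr (4 + N)} (hX : bodies (fun i => X (0, i)) ∈ P.Ω)
    (hXe : ∀ j, (X j).IsEven) :
    superEval P.prepotential X = superEval (fun q => (P.K q : ℂ)) (fun i => X (0, i)) +
      ∑ i, (superEval (P.coupling i) (fun i => X (0, i)) * conj (X (1, i)) +
        conj (superEval (P.coupling i) (fun i => X (0, i)) * conj (X (1, i)))) := by
  set σ := firstCoord n m
  have hU : IsOpen (σ.mapC ⁻¹' P.Ω) := σ.isOpen_preimage hP.isOpen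
  have hX' : bodies X ∈ σ.mapC ⁻¹' P.Ω := hX
  have hK := σ.contDiffOn_comp hP.contDiffOn_K
  have hc := fun i => σ.contDiffOn_comp (hP.contDiffOn_coupling i)
  have hco : ∀ d, ContDiffOn ℝ ∞ (fun x : Fin 2 × Flav n m → ℂ => coordC x d) (σ.mapC ⁻¹' P.Ω) :=
    fun d => (contDiff_coordC d).contDiffOn
  have e1 : ∀ {h : (Flav n m → ℂ) → ℂ}, ContDiffOn ℝ ∞ h P.Ω →
      superEval (fun y => h (σ.mapC y)) X = superEval h (fun i => X (0, i)) := fun hh =>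
    superEval_comp σ hP.isOpen hh hX
  rw [P.prepotential_eq, superEval_add hU hK (ContDiffOn.sum fun i _ =>
      ((hc i).mul (hco _)).add ((contDiffOn_conj (hc i)).mul (hco _))) hX', e1 hP.contDiffOn_K,
    superEval_sum _ hU (fun i _ =>
      ((hc i).mul (hco _)).add ((contDiffOn_conj (hc i)).mul (hco _))) hX']
  congr 1
  refine Finset.sum_congr rfl fun i _ => ?_
  rw [superEval_add hU ((hc i).mul (hco _)) ((contDiffOn_conj (hc i)).mul (hco _)) hX',
    superEval_mul_coord (by omega) hU (hc i) hX' hXe,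
    superEval_mul_coord (by omega) hU (contDiffOn_conj (hc i)) hX' hXe,
    superEval_conj hU (hc i) hX' hXe, e1 (hP.contDiffOn_coupling i), conj_mul, conj_conj]
  congr 1
  exact (hXe (1, i)).comm' _

theorem Potentials.Regular.superEval_coupling (hP : P.Regular) {X : Flav n m → Gr (4 + N)}
    (hX : bodies X ∈ P.Ω) (i : Flav n m) :
    superEval (P.coupling i) X =
      ∑ k : Fin 2, flavSign i • superEval (P.pot (i, k)) X := by
  change superEval (fun q => flavSign i * (P.pot (i, 0) q + P.pot (i, 1) q)) X = _
  rw [superEval_const_mul hP.isOpen ((hP.contDiffOn_pot _).add (hP.contDiffOn_pot _)) hX,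
    superEval_add hP.isOpen (hP.contDiffOn_pot _) (hP.contDiffOn_pot _) hX, Fin.sum_univ_two, smul_add]

/-- The coefficient of a coupling in the Lagrangian. -/
def couplingCoeff (τ : Flav n m × Fin 2) : ℂ := -(flavSign τ.1 * covFactor τ) / 4

theorem sum_label {K : ℕ} (f : Flav n m × Fin 2 → Gr K) :
    ∑ τ, f τ = ∑ a, (f (.inl a, 0) + f (.inl a, 1)) + ∑ α, (f (.inr α, 0) + f (.inr α, 1)) := by
  rw [Fintype.sum_prod_type, Fintype.sum_sum_type]
  simp only [Fin.sum_univ_two]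

/-- The couplings of the bi-Kähler model. -/
def Potentials.couplingLagr (P : Potentials n m) (Q : ℝ → KConf N n m × KAux N n m) (t : ℝ) :
    Gr (4 + N) :=
  ∑ τ, couplingCoeff τ • chiralInt τ (superEval (P.pot τ) (fun i => superK Q i t) *
    cov τ (superK Q τ.1 t) (deriv (superK Q τ.1) t))

theorem bodies_superK {Q : ℝ → KConf N n m × KAux N n m} (hQ : Q ∈ P.trajK N) (t : ℝ) :
    bodies (fun i => superK Q i t) ∈ P.Ω := by
  have : (fun i => superK Q i t) = _ := funext fun i => superK_eq_superKJ hQ.1 i t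
  rw [this, bodies_superKJ]
  exact hQ.2 t

/-- Potentials of conjugated arguments become functions on `P.Ω` evaluated at one family of
superfields, so that all couplings have the same form. -/
theorem Potentials.Regular.lagrK_eq (hP : P.Regular) {Q : ℝ → KConf N n m × KAux N n m}
    (hQ : Q ∈ P.trajK N) (t : ℝ) :
    lagrK P Q t = (1 / 4 : ℂ) • intFull (superEval (fun q => (P.K q : ℂ)) fun i => superK Q i t) +
      (P.couplingLagr Q t + conj (P.couplingLagr Q t)) := by
  have h0 : ∀ i, superEval (P.holPot (i, 0)) (fun i => superK Q i t) =
      superEval (P.pot (i, 0)) (fun i => superK Q i t) := fun i => by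
    rw [← hP.superEval_holPot _ (bodies_superK hQ t)]
    rcases i with i | i <;> rfl
  have h1 : ∀ a, superEval (P.A2 a) (superConjMirror fun i => superK Q i t) =
      superEval (P.pot (.inl a, 1)) (fun i => superK Q i t) := fun i => by
    rw [← hP.superEval_holPot _ (bodies_superK hQ t)]
    congr 1
    funext j
    rcases j with j | j <;> rfl
  have h2 : ∀ a, superEval (P.B2 a) (superConjOrdinary fun i => superK Q i t) =
      superEval (P.pot (.inr a, 1)) (fun i => superK Q i t) := fun i => by
    rw [← hP.superEval_holPot _ (bodies_superK hQ t)]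
    congr 1
    funext j
    rcases j with j | j <;> rfl
  have h3 := fun i => h0 (.inl i)
  have h4 := fun i => h0 (.inr i)
  simp only [Potentials.holPot] at h3 h4
  -- For the four kinds of coupling `couplingCoeff` equals `-i/4`, `i/4`, `i/4`, `-i/4`: the signs
  -- of the explicit prefactors and of the two subtracted integrals.
  have e : (-Complex.I / 4) • fTermA P Q t + (Complex.I / 4) • fTermB P Q t =
      P.couplingLagr Q t := by
    rw [Potentials.couplingLagr, sum_label]
    simp only [fTermA, fTermB, h1, h2, h3, h4, smul_sub, Finset.sum_add_distrib, ← Finset.smul_sum,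
      couplingCoeff, flavSign, covFactor, cov, covPart, covCoeff, chiralInt, DEta, DTheta, DEtaBar,
      intThetaEtaEtaBar, intThetaThetaBarEta, intThetaThetaBarEtaBar, neg_smul, neg_mul,
      smul_mul_assoc, ← sub_eq_add_neg]
    simp only [dTheta_sum, dThetaBar_sum, dEta_sum, dEtaBar_sum, atZero_sum]
    module
  rw [lagrK, e]

end Prepotential

end

end BiHKT

namespace BiHKT

noncomputable section

/-! ### The bi-HKT Lagrangian is the bi-Kähler one up to a total derivative -/

section HKTLagrangian

open Gr

variable {N n m : ℕ} {P : Potentials n m}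

theorem Potentials.Regular.contDiffOn_prepotential (hP : P.Regular) :
    ContDiffOn ℝ ∞ P.prepotential ((firstCoord n m).mapC ⁻¹' P.Ω) := by
  have hc := fun i => (firstCoord n m).contDiffOn_comp (hP.contDiffOn_coupling i)
  rw [P.prepotential_eq]
  exact ((firstCoord n m).contDiffOn_comp hP.contDiffOn_K).add (ContDiffOn.sum fun i _ =>
    ((hc i).mul (contDiff_coordC _).contDiffOn).add
      ((contDiffOn_conj (hc i)).mul (contDiff_coordC _).contDiffOn))

theorem isEven_xiField {F : ℝ → HKTConf N n m} (hF : ContDiff ℝ ∞ F) (i : Flav n m) (t : ℝ) :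
    (xiField F i t).IsEven := by
  rw [xiField_eq hF]; exact (isEven_hktJ _ _ _ _).conj

/-- The couplings of the bi-HKT model. -/
def Potentials.couplingHKT (P : Potentials n m) (F : ℝ → HKTConf N n m) (t : ℝ) : Gr (4 + N) :=
  ∑ τ, (flavSign τ.1 / 4) • intFull (superEval (P.pot τ) (fun i => superK (reduceTraj F) i t) *
    xiField F τ.1 t)

/-- The rotation of `η` is inserted under the integral, which it leaves unchanged, and then carried
into the arguments of the prepotential. No boundary term arises here. -/
theorem Potentials.Regular.lagrHKT_eq (hP : P.Regular) {F : ℝ → HKTConf N n m}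
    (hF : F ∈ P.trajHKT N) (t : ℝ) :
    lagrHKT P.prepotential F t =
      (1 / 4 : ℂ) • intFull (superEval (fun q => (P.K q : ℂ)) fun i => superK (reduceTraj F) i t) +
        (P.couplingHKT F t + conj (P.couplingHKT F t)) := by
  have hQ := reduceTraj_mem hF
  have hb := bodies_superK hQ t
  have h0 : (fun i => rho (superHKT F (0, i) t)) = fun i => superK (reduceTraj F) i t :=
    funext fun i => rho_superHKT_zero hF.1 i t
  have hbX : (fun i => body (superHKT F (0, i) t)) ∈ P.Ω := by
    have : (fun i => body (superHKT F (0, i) t)) = bodies (fun i => superK (reduceTraj F) i t) := by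
      rw [← h0]
      exact funext fun i => (body_rho _).symm
    rwa [this]
  have hbX' : bodies (fun j => superHKT F j t) ∈ (firstCoord n m).mapC ⁻¹' P.Ω := hbX
  have hXe : ∀ j, (rho (superHKT F j t)).IsEven := by
    rintro ⟨k, i⟩
    fin_cases k
    · simp only [Fin.zero_eta, rho_superHKT_zero hF.1]
      exact isEven_superK hQ.1 i t
    · simp only [Fin.mk_one, rho_superHKT_one hF.1]
      exact isEven_hktJ _ _ _ _
  have e1 : rho (superEval P.prepotential fun j => superHKT F j t) =
      superEval P.prepotential fun j => rho (superHKT F j t) :=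
    superEval_map ((firstCoord n m).isOpen_preimage hP.isOpen) hP.contDiffOn_prepotential hbX' rho
      rho_add rho_smul rho_mul rho_one (fun c => by
        unfold coordG
        split_ifs
        · rfl
        · exact (conj_rho _).symm) fun j => body_rho _
  rw [lagrHKT, ← intFull_rho, e1, hP.superEval_prepotential (by rw [h0]; exact hb) hXe, intFull_add,
    smul_add]
  simp only [rho_superHKT_zero hF.1]
  congr 1
  rw [intFull_sum, Finset.smul_sum, Potentials.couplingHKT, Fintype.sum_prod_type, conj_sum,
    ← Finset.sum_add_distrib]
  refine Finset.sum_congr rfl fun i _ => ?_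
  change (1 / 4 : ℂ) • intFull (_ * xiField F i t + conj (_ * xiField F i t)) = _
  rw [intFull_add, ← conj_intFull, hP.superEval_coupling hb, Fin.sum_univ_two, Fin.sum_univ_two,
    add_mul, smul_mul_assoc, smul_mul_assoc, intFull_add, intFull_smul, intFull_smul, smul_add]
  have hs : ∀ y : Gr (4 + N), (1 / 4 : ℂ) • (flavSign i • y) = (flavSign i / 4) • y := fun y => by
    rw [smul_smul]; congr 1; ring
  have hq : starRingEnd ℂ (1 / 4) = 1 / 4 := by simp [Complex.conj_ofNat]
  rw [← conj_conj ((1 / 4 : ℂ) • conj _), conj_smul, hq, conj_conj, smul_add, hs, hs]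

/-- The boundary term of the couplings. -/
def Potentials.couplingBdry (P : Potentials n m) (x v w : HKTConf N n m) : Gr (4 + N) :=
  ∑ τ, (flavSign τ.1 / 4) • chiralInt τ (annCoeff N τ *
    (superEval (P.pot τ) (superKJ (reduceConf x) (reduceConf v) (reduceConf w) (reducedCoord v)) *
      conj (hktJ x v w τ.1)))

theorem Potentials.couplingBdry_eq {F : ℝ → HKTConf N n m} (hF : ContDiff ℝ ∞ F) (t : ℝ) :
    P.couplingBdry (F t) (iteratedDeriv 1 F t) (iteratedDeriv 2 F t) =
      ∑ τ, (flavSign τ.1 / 4) • chiralInt τ (annCoeff N τ *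
        (superEval (P.pot τ) (fun i => superK (reduceTraj F) i t) * xiField F τ.1 t)) := by
  have h : (fun i => superK (reduceTraj F) i t) = superKJ (reduceConf (F t))
      (reduceConf (iteratedDeriv 1 F t)) (reduceConf (iteratedDeriv 2 F t))
      (reducedCoord (iteratedDeriv 1 F t)) := by
    funext i
    rw [superK_eq_superKJ (contDiff_reduceTraj hF)]
    simp only [iteratedDeriv_reduceTraj hF, reduceTraj, iteratedDeriv_one]
  simp only [Potentials.couplingBdry, xiField_eq hF, h]

theorem Potentials.Regular.hasDerivAt_superEval_superK (hP : P.Regular) {f : (Flav n m → ℂ) → ℂ}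
    (hf : ContDiffOn ℝ ∞ f P.Ω) {Q : ℝ → KConf N n m × KAux N n m} (hQ : Q ∈ P.trajK N) (t : ℝ) :
    HasDerivAt (fun s => superEval f (fun i => superK Q i s))
      (∑ c, superEval (wirt c f) (fun i => superK Q i t) *
        coordG (fun i => deriv (superK Q i) t) c) t :=
  hasDerivAt_superEval (by omega) hP.isOpen hf (fun s => bodies_superK hQ s)
    (fun s j => isEven_superK hQ.1 j s)
    fun j => (hasDerivAt_superK hQ.1 j t).differentiableAt.hasDerivAt

/-- In the chain rule each term vanishes for one of two reasons: its argument is annihilated, or the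
potential does not depend on that argument. -/
theorem Potentials.Regular.ann_superEval_pot (hP : P.Regular) (τ : Flav n m × Fin 2)
    {Q : ℝ → KConf N n m × KAux N n m} (hQ : Q ∈ P.trajK N) (t : ℝ) :
    ann τ (superEval (P.pot τ) (fun i => superK Q i t))
      (∑ c, superEval (wirt c (P.pot τ)) (fun i => superK Q i t) *
        coordG (fun i => deriv (superK Q i) t) c) = 0 := by
  rw [superEval_ann τ hP.isOpen (hP.contDiffOn_pot τ) (bodies_superK hQ t)
    fun j => isEven_superK hQ.1 j t]
  refine Finset.sum_eq_zero fun c _ => ?_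
  obtain ⟨j, k⟩ := c
  by_cases h : k = holFlip τ j
  · rw [h, ann_superK hQ.1, mul_zero]
  · have h' : k = holFlip τ j + 1 := by omega
    rw [h', superEval_eq_zero hP.isOpen (fun y hy => hP.wirt_pot τ hy j) (bodies_superK hQ t),
      zero_mul]

/-- The full integral is minus the smaller integral of the covariant derivative plus a term with
`∂_t`. In the first, the derivative passes the potential and becomes `covFactor τ` times a covariant
derivative of the first half of the multiplet, which is the bi-Kähler coupling. The second is the
derivative of the boundary term. -/
theorem Potentials.Regular.hasDerivAt_couplingBdry (hP : P.Regular) {F : ℝ → HKTConf N n m}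
    (hF : F ∈ P.trajHKT N) (t : ℝ) :
    HasDerivAt (fun s => P.couplingBdry (F s) (iteratedDeriv 1 F s) (iteratedDeriv 2 F s))
      (P.couplingHKT F t - P.couplingLagr (reduceTraj F) t) t := by
  have hQ := reduceTraj_mem hF
  simp only [Potentials.couplingBdry_eq hF.1]
  have hd := fun τ : Flav n m × Fin 2 =>
    (hP.hasDerivAt_superEval_superK (hP.contDiffOn_pot τ) hQ t).gr_mul
    (hasDerivAt_xiField hF.1 τ.1 t).differentiableAt.hasDerivAt
  refine (HasDerivAt.fun_sum fun τ _ =>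
    (((hd τ).gr_const_mul (annCoeff N τ)).chiralInt τ).fun_const_smul (flavSign τ.1 / 4)).congr_deriv ?_
  rw [Potentials.couplingHKT, Potentials.couplingLagr, ← Finset.sum_sub_distrib]
  refine Finset.sum_congr rfl fun τ _ => ?_
  rw [intFull_eq_chiralInt τ _ _, ann_mul τ (isEven_superEval hP.isOpen (hP.contDiffOn_pot τ)
    (bodies_superK hQ t) fun j => isEven_superK hQ.1 j t) (isEven_xiField hF.1 _ t)
    (hP.ann_superEval_pot τ hQ t), ann_xiField hF.1, mul_smul_comm, chiralInt_smul, couplingCoeff]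
  module

theorem Potentials.Regular.equivLagr_lagrK (hP : P.Regular) :
    EquivLagr (P.trajHKT N) (lagrHKT P.prepotential) (fun F => lagrK P (reduceTraj F)) := by
  -- Jets of order two suffice, because the superfields contain at most second time derivatives of
  -- the component fields.
  refine ⟨2, fun j => P.couplingBdry (j 0) (j 1) (j 2) + conj (P.couplingBdry (j 0) (j 1) (j 2)),
    fun F hF t => ?_⟩
  have h := hP.hasDerivAt_couplingBdry hF t
  have h2 := h.fun_add h.gr_conj
  simp only [Fin.val_zero, Fin.val_one, Fin.val_two, iteratedDeriv_zero]
  refine h2.congr_deriv ?_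
  rw [hP.lagrHKT_eq hF, hP.lagrK_eq (reduceTraj_mem hF), conj_sub]
  abel

end HKTLagrangian

end

end BiHKT

namespace BiHKT

noncomputable section

/-! ### The first-order form of the bi-Kähler Lagrangian -/

section FirstOrder

open Gr

variable {N n m : ℕ} {P : Potentials n m}

theorem Gr.IsEven.mul_left_comm {K : ℕ} {e : Gr K} (he : e.IsEven) (f g : Gr K) :
    e * (f * g) = f * (e * g) := by
  rw [← mul_assoc, he.comm, mul_assoc]

/-- Bosonic fields as elements of the Grassmann algebra. -/
def boson (z : Flav n m → Ev N) (i : Flav n m) : Gr (4 + N) := z i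

theorem isEven_boson (z : Flav n m → Ev N) (i : Flav n m) : (boson z i).IsEven := isEven_ev _

/-- Accelerations occur linearly and only with all four odd coordinates in front, so they can be
separated and treated as an infinitesimal shift. -/
theorem superKJ_add_acceleration (x v w : KConf N n m) (a : KAux N n m) (i : Flav n m) :
    superKJ x v w a i = superKJ x v 0 a i + superKJ 0 0 w 0 i := by
  rcases i with i | i
  · simp [superKJ, ordSF, -Complex.coe_smul]
    abel
  · simp [superKJ, mirSF, -Complex.coe_smul]

theorem superKJ_add_velocity (v w w' : KConf N n m) (a : KAux N n m) (i : Flav n m) :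
    superKJ v w w' a i = superKJ v 0 0 0 i + superKJ 0 w w' a i := by
  rcases i with i | i
  · simp [superKJ, ordSF, -Complex.coe_smul]
    abel
  · simp [superKJ, mirSF, -Complex.coe_smul]
    abel

theorem superKJ_acceleration (w : KConf N n m) (i : Flav n m) :
    superKJ 0 0 w 0 i = (-flavSign i) •
      (theta N * (thetaBar N * (eta N * (etaBar N * boson w.1 i)))) := by
  rcases i with i | i <;> simp [superKJ, ordSF, mirSF, flavSign, boson]

theorem coordG_acceleration (w : KConf N n m) (c : Flav n m × Fin 2) :
    coordG (superKJ 0 0 w 0) c = (-flavSign c.1) •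
      (theta N * (thetaBar N * (eta N * (etaBar N * coordG (boson w.1) c)))) := by
  obtain ⟨i, k⟩ := c
  have h : starRingEnd ℂ (flavSign i) = flavSign i := by rcases i with i | i <;> simp [flavSign]
  have h' : par (conj (boson w.1 i)) = conj (boson w.1 i) := (isEven_boson w.1 i).conj.par_eq
  unfold coordG
  split_ifs
  · exact superKJ_acceleration w i
  · simp only [superKJ_acceleration, conj_smul, map_neg, h]
    simp [h', par_neg]

theorem Potentials.Regular.atZero_superEval (hP : P.Regular) {f : (Flav n m → ℂ) → ℂ}
    (hf : ContDiffOn ℝ ∞ f P.Ω) (x v w : KConf N n m) (a : KAux N n m) (hx : P.InDomain x.1) :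
    atZero (superEval f (superKJ x v w a)) = superEval f (boson x.1) := by
  refine superEval_map hP.isOpen hf (by rw [bodies_superKJ]; exact hx) atZero atZero_add atZero_smul
    atZero_mul atZero_one (fun c => ?_) fun j => ?_
  · unfold coordG
    split_ifs
    · exact atZero_superKJ _ _ _ _ _
    · rw [atZero_conj, atZero_superKJ]; rfl
  · exact (congrFun (bodies_superKJ x v w a) j).symm

/-- The shift is proportional to `θθ̄ηη̄`, and a product of two such shifts vanishes. The expansion
of first order is therefore exact. -/
theorem Potentials.Regular.superEval_acceleration (hP : P.Regular) {f : (Flav n m → ℂ) → ℂ}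
    (hf : ContDiffOn ℝ ∞ f P.Ω) (x v w : KConf N n m) (a : KAux N n m) (hx : P.InDomain x.1) :
    superEval f (superKJ x v w a) = superEval f (superKJ x v 0 a) -
      theta N * (thetaBar N * (eta N * (etaBar N *
        ∑ c, flavSign c.1 • (superEval (wirt c f) (superKJ x v 0 a) * coordG (boson w.1) c)))) := by
  have hb : bodies (superKJ x v 0 a) ∈ P.Ω := by rw [bodies_superKJ]; exact hx
  -- With `y = 1`, the vanishing of products of two shifts is the condition of the expansion.
  have h := superEval_taylor_one (s := superKJ 0 0 w 0) (by omega : 0 < 4 + N) hP.isOpen hf hb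
    (isEven_superKJ _ _ _ _) (isEven_superKJ _ _ _ _)
    (fun j => by rw [show body _ = _ from congrFun (bodies_superKJ 0 0 w 0) j]; rfl) 1
    (fun c d => by
      have h := (isEven_coordG (isEven_boson w.1) c).mul_left_comm (theta N)
      simp [coordG_acceleration, smul_mul_assoc, mul_smul_comm, mul_assoc, h])
  rw [show superKJ x v w a = fun j => superKJ x v 0 a j + superKJ 0 0 w 0 j from
    funext (superKJ_add_acceleration x v w a)]
  rw [mul_one, mul_one] at h
  rw [h, sub_eq_add_neg]
  congr 1
  simp only [Finset.mul_sum, ← Finset.sum_neg_distrib]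
  refine Finset.sum_congr rfl fun c _ => ?_
  have he := isEven_superEval hP.isOpen (contDiffOn_wirt hP.isOpen hf c) hb
    (isEven_superKJ _ _ _ _)
  rw [mul_one, coordG_acceleration, mul_smul_comm, he.mul_left_comm, he.mul_left_comm,
    he.mul_left_comm, he.mul_left_comm]
  simp only [mul_smul_comm, neg_smul]

theorem cov_add (τ : Flav n m × Fin 2) (f f' g g' : Gr (4 + N)) :
    cov τ (f + g) (f' + g') = cov τ f f' + cov τ g g' := by
  rw [cov, cov, cov, (evenDer_covPart τ).add, mul_add]
  abel

theorem chiralInt_top (τ : Flav n m × Fin 2) (f : Gr (4 + N)) :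
    chiralInt τ (theta N * (thetaBar N * (eta N * (etaBar N * f)))) = 0 :=
  match τ with
  | (.inl _, 0) => by simp [chiralInt, intThetaEtaEtaBar]
  | (.inr _, 0) => by simp [chiralInt, intThetaEtaEtaBar]
  | (.inl _, 1) => by simp [chiralInt, intThetaThetaBarEta]
  | (.inr _, 1) => by simp [chiralInt, intThetaThetaBarEtaBar]

theorem chiralInt_sub (τ : Flav n m × Fin 2) (f g : Gr (4 + N)) :
    chiralInt τ (f - g) = chiralInt τ f - chiralInt τ g :=
  map_sub (chiralIntL N τ) f g

/-- Apart from the term with `a`, every term either repeats an odd coordinate or keeps one that is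
not integrated over and disappears at the origin. So the only second-order data left in a coupling
is the time derivative of the auxiliary field. -/
theorem chiralInt_cov_acceleration (τ : Flav n m × Fin 2) (w w' : KConf N n m) (a : KAux N n m)
    {e : Gr (4 + N)} (he : e.IsEven) :
    chiralInt τ (e * cov τ (superKJ 0 0 w 0 τ.1) (superKJ 0 w w' a τ.1)) =
      (-2 * flavSign τ.1 * covFactor τ) • (atZero e * boson a τ.1) := by
  have h1 := he.mul_left_comm (theta N)
  have h2 := he.mul_left_comm (thetaBar N)
  have h3 := he.mul_left_comm (eta N)
  have h4 := he.mul_left_comm (etaBar N)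
  match τ with
  | (.inl i, 0) =>
    simp only [chiralInt, intThetaEtaEtaBar, cov, covPart, covCoeff, superKJ_acceleration, superKJ,
      ordSF, flavSign, covFactor, boson]
    simp [mul_add, mul_sub, mul_smul_comm, smul_mul_assoc, h1, h2, h3, h4, atZero_mul, smul_smul,
      -Complex.coe_smul]
    try module
  | (.inr i, 0) =>
    simp only [chiralInt, intThetaEtaEtaBar, cov, covPart, covCoeff, superKJ_acceleration, superKJ,
      mirSF, flavSign, covFactor, boson]
    simp [mul_add, mul_sub, mul_smul_comm, smul_mul_assoc, h1, h2, h3, h4, atZero_mul, smul_smul,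
      -Complex.coe_smul]
    try module
  | (.inl i, 1) =>
    simp only [chiralInt, intThetaThetaBarEta, cov, covPart, covCoeff, superKJ_acceleration, superKJ,
      ordSF, flavSign, covFactor, boson]
    simp [mul_add, mul_sub, mul_smul_comm, smul_mul_assoc, h1, h2, h3, h4, atZero_mul, smul_smul,
      -Complex.coe_smul]
    try module
  | (.inr i, 1) =>
    simp only [chiralInt, intThetaThetaBarEtaBar, cov, covPart, covCoeff, superKJ_acceleration,
      superKJ, mirSF, flavSign, covFactor, boson]
    simp [mul_add, mul_sub, mul_smul_comm, smul_mul_assoc, h1, h2, h3, h4, atZero_mul, smul_smul,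
      -Complex.coe_smul]
    try module

/-- The kinetic term of the first-order Lagrangian. -/
def Potentials.kineticFirst (P : Potentials n m) (x : KConf N n m) (a : KAux N n m)
    (v : KConf N n m) : Gr (4 + N) :=
  (1 / 4 : ℂ) • intFull (superEval (fun q => (P.K q : ℂ)) (superKJ x v 0 a)) +
    (1 / 4 : ℂ) • ∑ c, ∑ d, flavSign c.1 • (superEval (wirt d (wirt c fun q => (P.K q : ℂ)))
      (boson x.1) * coordG (boson v.1) d * coordG (boson v.1) c)

/-- The term of the first-order Lagrangian that comes from one coupling. -/
def Potentials.couplingTerm (P : Potentials n m) (x : KConf N n m) (a : KAux N n m)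
    (v : KConf N n m) (τ : Flav n m × Fin 2) : Gr (4 + N) :=
  couplingCoeff τ • chiralInt τ (superEval (P.pot τ) (superKJ x v 0 a) *
      cov τ (superKJ x v 0 a τ.1) (superKJ v 0 0 0 τ.1)) +
    (1 / 2 : ℂ) • ∑ c, superEval (wirt c (P.pot τ)) (boson x.1) * coordG (boson v.1) c *
      boson a τ.1

/-- The first-order Lagrangian of the bi-Kähler model. -/
def Potentials.lagrFirst (P : Potentials n m) (x : KConf N n m) (a : KAux N n m)
    (v : KConf N n m) : Gr (4 + N) :=
  P.kineticFirst x a v + (∑ τ, P.couplingTerm x a v τ + conj (∑ τ, P.couplingTerm x a v τ))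

section Trajectory

variable {Q : ℝ → KConf N n m × KAux N n m}

theorem superK_jet (hQ : ContDiff ℝ ∞ Q) (t : ℝ) :
    (fun i => superK Q i t) = superKJ (Q t).1 (deriv Q t).1 (iteratedDeriv 2 Q t).1 (Q t).2 := by
  funext i
  rw [superK_eq_superKJ hQ, iteratedDeriv_one]

theorem hasDerivAt_boson (hQ : ContDiff ℝ ∞ Q) (t : ℝ) (i : Flav n m) :
    HasDerivAt (fun s => boson (Q s).1.1 i) (boson (deriv Q t).1.1 i) t := by
  have h := hasDerivAt_kBoson (hasDerivAt_conf hQ 0 t) i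
  simp only [iteratedDeriv_zero, zero_add, Nat.reduceAdd, iteratedDeriv_one] at h
  exact h

theorem hasDerivAt_boson_velocity (hQ : ContDiff ℝ ∞ Q) (t : ℝ) (i : Flav n m) :
    HasDerivAt (fun s => boson (deriv Q s).1.1 i) (boson (iteratedDeriv 2 Q t).1.1 i) t := by
  have h := hasDerivAt_kBoson (hasDerivAt_conf hQ 1 t) i
  simp only [iteratedDeriv_zero, zero_add, Nat.reduceAdd, iteratedDeriv_one] at h
  exact h

theorem hasDerivAt_boson_aux (hQ : ContDiff ℝ ∞ Q) (t : ℝ) (i : Flav n m) :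
    HasDerivAt (fun s => boson (Q s).2 i) (boson (deriv Q t).2 i) t := by
  have h := hasDerivAt_aux (hasDerivAt_confAux hQ 0 t) i
  simp only [iteratedDeriv_zero, zero_add, Nat.reduceAdd, iteratedDeriv_one] at h
  exact h

theorem Potentials.Regular.hasDerivAt_superEval_boson (hP : P.Regular) {f : (Flav n m → ℂ) → ℂ}
    (hf : ContDiffOn ℝ ∞ f P.Ω) (hQ : Q ∈ P.trajK N) (t : ℝ) :
    HasDerivAt (fun s => superEval f (boson (Q s).1.1))
      (∑ c, superEval (wirt c f) (boson (Q t).1.1) * coordG (boson (deriv Q t).1.1) c) t :=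
  hasDerivAt_superEval (by omega) hP.isOpen hf (fun s => hQ.2 s) (fun s j => isEven_boson _ j)
    fun j => hasDerivAt_boson hQ.1 t j

/-- The acceleration enters the Lagrangian as `-¼ Σ ± ∂_c K z̈^c`. Integration by parts trades it
for the second derivatives of `K` contracted with velocities in `kineticFirst`. -/
theorem Potentials.Regular.kinetic_eq (hP : P.Regular) (hQ : Q ∈ P.trajK N) (t : ℝ) :
    HasDerivAt (fun s => (-1 / 4 : ℂ) • ∑ c, flavSign c.1 •
        (superEval (wirt c fun q => (P.K q : ℂ)) (boson (Q s).1.1) * coordG (boson (deriv Q s).1.1) c))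
      ((1 / 4 : ℂ) • intFull (superEval (fun q => (P.K q : ℂ)) fun i => superK Q i t) -
        P.kineticFirst (Q t).1 (Q t).2 (deriv Q t).1) t := by
  have hW := fun c => contDiffOn_wirt hP.isOpen hP.contDiffOn_K c
  refine ((HasDerivAt.fun_sum fun c _ => ((hP.hasDerivAt_superEval_boson (hW c) hQ t).gr_mul
    (hasDerivAt_coordG (hasDerivAt_boson_velocity hQ.1 t) c)).fun_const_smul
      (flavSign c.1)).fun_const_smul (-1 / 4 : ℂ)).congr_deriv ?_
  rw [superK_jet hQ.1, hP.superEval_acceleration hP.contDiffOn_K _ _ _ _ (hQ.2 t), intFull_sub,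
    intFull_top, atZero_sum, Potentials.kineticFirst]
  have h0 : ∀ c, atZero (coordG (boson (iteratedDeriv 2 Q t).1.1) c) =
      coordG (boson (iteratedDeriv 2 Q t).1.1) c := fun c => by
    unfold coordG
    split_ifs
    · exact atZero_ev _
    · rw [atZero_conj]; exact congrArg conj (atZero_ev _)
  simp only [atZero_smul, atZero_mul, hP.atZero_superEval (hW _) _ _ _ _ (hQ.2 t), h0, smul_add,
    Finset.sum_add_distrib, Finset.sum_mul, Finset.smul_sum]
  simp only [← Finset.smul_sum]
  module

/-- A coupling contains the time derivative of the auxiliary field only as `-½` times potential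
times `Ȧ`. Integration by parts moves the derivative to the potential and gives the second part of
`couplingTerm`. -/
theorem Potentials.Regular.coupling_eq (hP : P.Regular) (hQ : Q ∈ P.trajK N) (t : ℝ) :
    HasDerivAt (fun s => ∑ τ, (-1 / 2 : ℂ) •
        (superEval (P.pot τ) (boson (Q s).1.1) * boson (Q s).2 τ.1))
      (P.couplingLagr Q t - ∑ τ, P.couplingTerm (Q t).1 (Q t).2 (deriv Q t).1 τ) t := by
  refine (HasDerivAt.fun_sum fun τ _ =>
    ((hP.hasDerivAt_superEval_boson (hP.contDiffOn_pot τ) hQ t).gr_mul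
      (hasDerivAt_boson_aux hQ.1 t τ.1)).fun_const_smul (-1 / 2 : ℂ)).congr_deriv ?_
  rw [Potentials.couplingLagr, ← Finset.sum_sub_distrib]
  refine Finset.sum_congr rfl fun τ _ => ?_
  have hb : bodies (superKJ (Q t).1 (deriv Q t).1 0 (Q t).2) ∈ P.Ω := by
    rw [bodies_superKJ]; exact hQ.2 t
  have he := isEven_superEval hP.isOpen (hP.contDiffOn_pot τ) hb (isEven_superKJ _ _ _ _)
  have e1 : superK Q τ.1 t = superKJ (Q t).1 (deriv Q t).1 0 (Q t).2 τ.1 +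
      superKJ 0 0 (iteratedDeriv 2 Q t).1 0 τ.1 := by
    rw [← superKJ_add_acceleration, ← superK_jet hQ.1]
  have e2 : deriv (superK Q τ.1) t = superKJ (deriv Q t).1 0 0 0 τ.1 +
      superKJ 0 (iteratedDeriv 2 Q t).1 (iteratedDeriv 3 Q t).1 (deriv Q t).2 τ.1 := by
    rw [(hasDerivAt_superK hQ.1 _ t).deriv, ← superKJ_add_velocity, iteratedDeriv_one]
  -- The signs square to one and `covFactor τ ^ 2 = -1` in all cases, which leaves `-1/2`.
  have hs : couplingCoeff τ * (-2 * flavSign τ.1 * covFactor τ) = -1 / 2 := by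
    rw [couplingCoeff]
    match τ with
    | (.inl _, 0) => simp only [flavSign, covFactor]; ring_nf; norm_num
    | (.inr _, 0) => simp only [flavSign, covFactor]; ring_nf; norm_num
    | (.inl _, 1) => simp only [flavSign, covFactor]; ring_nf; norm_num
    | (.inr _, 1) => simp only [flavSign, covFactor]; ring_nf; norm_num
  rw [superK_jet hQ.1, hP.superEval_acceleration (hP.contDiffOn_pot τ) _ _ _ _ (hQ.2 t), sub_mul,
    chiralInt_sub, e1, e2]
  simp only [mul_assoc (theta N), mul_assoc (thetaBar N), mul_assoc (eta N), mul_assoc (etaBar N)]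
  rw [chiralInt_top, sub_zero, cov_add,
    mul_add, chiralInt_add, chiralInt_cov_acceleration _ _ _ _ he,
    hP.atZero_superEval (hP.contDiffOn_pot τ) _ _ _ _ (hQ.2 t), smul_add (couplingCoeff τ), smul_smul, hs,
    Potentials.couplingTerm, Finset.sum_mul]
  module

end Trajectory

theorem Potentials.Regular.equivLagr_lagrFirst (hP : P.Regular) :
    EquivLagr (P.trajK N) (lagrK P) (fun Q t => P.lagrFirst (Q t).1 (Q t).2 (deriv Q t).1) := by
  set g : KConf N n m × KAux N n m → Gr (4 + N) := fun q =>
    ∑ τ, (-1 / 2 : ℂ) • (superEval (P.pot τ) (boson q.1.1) * boson q.2 τ.1)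
  -- First-order jets suffice: the kinetic boundary term contains velocities, the boundary terms of
  -- the couplings do not.
  refine ⟨1, fun j => (-1 / 4 : ℂ) • ∑ c, flavSign c.1 •
    (superEval (wirt c fun q => (P.K q : ℂ)) (boson (j 0).1.1) * coordG (boson (j 1).1.1) c) +
    (g (j 0) + conj (g (j 0))), fun Q hQ t => ?_⟩
  have h := hP.coupling_eq hQ t
  have h2 := (hP.kinetic_eq hQ t).fun_add (h.fun_add h.gr_conj)
  simp only [Fin.val_zero, Fin.val_one, iteratedDeriv_zero, iteratedDeriv_one]
  refine h2.congr_deriv ?_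
  rw [hP.lagrK_eq hQ, Potentials.lagrFirst, conj_sub]
  abel

end FirstOrder

end

end BiHKT

namespace BiHKT

noncomputable section

/-! ### Hamiltonian reduction of Lagrangians that depend only on velocities along the fibres -/

section Reduction

variable {X X' A Y : Type}
  [NormedAddCommGroup X] [NormedSpace ℝ X] [NormedAddCommGroup X'] [NormedSpace ℝ X']
  [NormedAddCommGroup A] [NormedSpace ℝ A] [NormedAddCommGroup Y] [NormedSpace ℝ Y]

/-- Velocities of `X` map onto pairs `(κ v, π v)`, and the Lagrangian factors through this map. Its
differential splits accordingly: the part along `κ` is the equation of motion of the auxiliary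
variable and must vanish for the momentum to be a pull-back; the part along `π` is the momentum of
the reduced model. Since the fibre velocities do not contribute to `p · v`, the energies agree. -/
theorem reducedHamiltonianAt_iff (π : X →L[ℝ] X') (κ : X →L[ℝ] A)
    (hs : ∀ x' a, ∃ x, π x = x' ∧ κ x = a) {ℓ : X → X → Y} {ℓK : X' → A → X' → Y} {x' : X'}
    (hℓ : ∀ x v, π x = x' → ℓ x v = ℓK x' (κ v) (π v))
    (hd : Differentiable ℝ fun p : A × X' => ℓK x' p.1 p.2) (p' : X' → Y) (E : Y) :
    ReducedHamiltonianAt π ℓ x' p' E ↔ AuxHamiltonianAt ℓK x' p' E := by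
  set g : A × X' → Y := fun p => ℓK x' p.1 p.2
  have h1 : ∀ x v δ, π x = x' → lineDeriv ℝ (ℓ x) v δ = fderiv ℝ g (κ v, π v) (κ δ, π δ) := by
    intro x v δ hx
    have e : ℓ x = g ∘ (κ.prod π) := funext fun v => hℓ x v hx
    have hf : HasFDerivAt (ℓ x) ((fderiv ℝ g (κ v, π v)).comp (κ.prod π)) v := by
      rw [e]
      exact (hd (κ v, π v)).hasFDerivAt.comp v (κ.prod π).hasFDerivAt
    exact hf.hasLineDerivAt δ |>.lineDeriv
  have h2 : ∀ a v α, lineDeriv ℝ (fun b => ℓK x' b v) a α = fderiv ℝ g (a, v) (α, 0) := by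
    intro a v α
    have hf : HasFDerivAt (fun b => ℓK x' b v)
        ((fderiv ℝ g (a, v)).comp (ContinuousLinearMap.inl ℝ A X')) a :=
      HasFDerivAt.comp (g := g) (f := fun b => (b, v)) a (hd (a, v)).hasFDerivAt
        (hasFDerivAt_prodMk_left a v)
    exact hf.hasLineDerivAt α |>.lineDeriv
  have h3 : ∀ a v δ, lineDeriv ℝ (ℓK x' a) v δ = fderiv ℝ g (a, v) (0, δ) := by
    intro a v δ
    have hf : HasFDerivAt (ℓK x' a)
        ((fderiv ℝ g (a, v)).comp (ContinuousLinearMap.inr ℝ A X')) v :=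
      (hd (a, v)).hasFDerivAt.comp v (hasFDerivAt_prodMk_right a v)
    exact hf.hasLineDerivAt δ |>.lineDeriv
  constructor
  · rintro ⟨x, p, hx, hp, v, hv, hE⟩
    have key : ∀ δ, p' (π δ) = fderiv ℝ g (κ v, π v) (κ δ, π δ) := fun δ => by
      rw [← hp, hv, momentum, h1 x v δ hx]
    -- `p'` is not assumed linear; its value at zero is read off from the momentum of the zero
    -- direction.
    have p0 : p' 0 = 0 := by
      have := key 0
      rwa [map_zero, map_zero, show ((0 : A), (0 : X')) = 0 from rfl, map_zero] at this
    refine ⟨κ v, π v, fun α => ?_, fun δ => ?_, ?_⟩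
    -- A direction along the fibre, `π δ = 0`, that moves the auxiliary variable by `α`.
    · obtain ⟨δ, hδ, hα⟩ := hs 0 α
      rw [h2, ← hα, ← hδ, ← key, hδ, p0]
    -- A lift of `δ` along which the auxiliary variable does not move.
    · obtain ⟨δ', hδ, hα⟩ := hs δ 0
      rw [momentum, h3, ← hα, ← hδ, ← key]
    · rw [hE, hp, hℓ x v hx]
  · rintro ⟨a, v, ha, hv, hE⟩
    obtain ⟨x, hx, -⟩ := hs x' 0
    obtain ⟨w, hw, hwa⟩ := hs v a
    refine ⟨x, fun δ => p' (π δ), hx, fun δ => rfl, w, fun δ => ?_, ?_⟩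
    · change p' (π δ) = _
      rw [momentum, h1 x w δ hx, hw, hwa, hv, momentum, h3,
        show (κ δ, π δ) = (κ δ, 0) + (0, π δ) by simp, map_add, ← h2, ha, zero_add]
    · change _ = p' (π w) - _
      rw [hE, hℓ x w hx, hw, hwa]

end Reduction

/-! ### Smoothness of the first-order Lagrangians and the reduction of the bi-HKT model. -/

section Smoothness

open Gr

variable {N n m : ℕ} {P : Potentials n m} {E : Type*} [NormedAddCommGroup E] [NormedSpace ℝ E]

theorem _root_.ContDiff.gr_const_mul {K : ℕ} {f : E → Gr K} (hf : ContDiff ℝ ∞ f) (c : Gr K) :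
    ContDiff ℝ ∞ fun y => c * f y :=
  contDiff_const.gr_mul hf

theorem contDiff_gr_linear {K : ℕ} {L : Gr K → Gr K} (hadd : ∀ f g, L (f + g) = L f + L g)
    (hsmul : ∀ (c : ℂ) f, L (c • f) = c • L f) {f : E → Gr K} (hf : ContDiff ℝ ∞ f) :
    ContDiff ℝ ∞ fun y => L (f y) :=
  ((LinearMap.toContinuousLinearMap
    ({ toFun := L, map_add' := hadd, map_smul' := hsmul } : Gr K →ₗ[ℂ] Gr K)).restrictScalars
      ℝ).contDiff.comp hf

theorem contDiff_coe_ev {f : E → Ev N} (hf : ContDiff ℝ ∞ f) :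
    ContDiff ℝ ∞ fun y => (f y : Gr (4 + N)) :=
  ((Ev N).subtypeL.restrictScalars ℝ).contDiff.comp hf

theorem contDiff_coe_od {f : E → Od N} (hf : ContDiff ℝ ∞ f) :
    ContDiff ℝ ∞ fun y => (f y : Gr (4 + N)) :=
  ((Od N).subtypeL.restrictScalars ℝ).contDiff.comp hf

theorem contDiff_superKJ {x v w : E → KConf N n m} {a : E → KAux N n m} (hx : ContDiff ℝ ∞ x)
    (hv : ContDiff ℝ ∞ v) (hw : ContDiff ℝ ∞ w) (ha : ContDiff ℝ ∞ a) (i : Flav n m) :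
    ContDiff ℝ ∞ fun y => superKJ (x y) (v y) (w y) (a y) i := by
  have hb : ∀ {x : E → KConf N n m}, ContDiff ℝ ∞ x → ∀ i,
      ContDiff ℝ ∞ fun y => ((x y).1 i : Gr (4 + N)) := fun hx i =>
    contDiff_coe_ev (contDiff_pi.1 (contDiff_fst.comp hx) i)
  have hf : ∀ {x : E → KConf N n m}, ContDiff ℝ ∞ x → ∀ k i,
      ContDiff ℝ ∞ fun y => ((x y).2 k i : Gr (4 + N)) := fun hx k i =>
    contDiff_coe_od (contDiff_pi.1 (contDiff_pi.1 (contDiff_snd.comp hx) k) i)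
  have h2 : ∀ i, ContDiff ℝ ∞ fun y => (a y i : Gr (4 + N)) := fun i =>
    contDiff_coe_ev (contDiff_pi.1 ha i)
  rcases i with i | i
  · exact ((((((((hb hx _).add (((hf hx 0 _).gr_const_mul _).const_smul _)).sub
      ((((hb hv _).gr_const_mul _).gr_const_mul _).const_smul _)).add
      (((hf hx 1 _).gr_const_mul _).const_smul _)).add
      ((((h2 _).gr_const_mul _).gr_const_mul _).const_smul _)).sub
      (((((hf hv 1 _).gr_const_mul _).gr_const_mul _).gr_const_mul _).const_smul _)).sub
      ((((hb hv _).gr_const_mul _).gr_const_mul _).const_smul _)).sub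
      (((((hf hv 0 _).gr_const_mul _).gr_const_mul _).gr_const_mul _).const_smul _)).sub
      (((((hb hw _).gr_const_mul _).gr_const_mul _).gr_const_mul _).gr_const_mul _)
  · exact ((((((((hb hx _).add (((hf hx 0 _).gr_const_mul _).const_smul _)).sub
      ((((hb hv _).gr_const_mul _).gr_const_mul _).const_smul _)).sub
      (((hf hx 1 _).gr_const_mul _).const_smul _)).sub
      ((((h2 _).gr_const_mul _).gr_const_mul _).const_smul _)).add
      (((((hf hv 1 _).gr_const_mul _).gr_const_mul _).gr_const_mul _).const_smul _)).add
      ((((hb hv _).gr_const_mul _).gr_const_mul _).const_smul _)).add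
      (((((hf hv 0 _).gr_const_mul _).gr_const_mul _).gr_const_mul _).const_smul _)).add
      (((((hb hw _).gr_const_mul _).gr_const_mul _).gr_const_mul _).gr_const_mul _)

theorem Potentials.Regular.contDiff_lagrFirst (hP : P.Regular) (x : KConf N n m)
    (hx : P.InDomain x.1) :
    ContDiff ℝ ∞ fun p : KAux N n m × KConf N n m => P.lagrFirst x p.1 p.2 := by
  have hv : ContDiff ℝ ∞ fun p : KAux N n m × KConf N n m => p.2 := contDiff_snd
  have ha : ContDiff ℝ ∞ fun p : KAux N n m × KConf N n m => p.1 := contDiff_fst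
  have hY := contDiff_superKJ (contDiff_const (c := x)) hv (contDiff_const (c := (0 : KConf N n m))) ha
  have hY' := contDiff_superKJ hv (contDiff_const (c := (0 : KConf N n m)))
    (contDiff_const (c := (0 : KConf N n m))) (contDiff_const (c := (0 : KAux N n m)))
  have hE : ∀ {f : (Flav n m → ℂ) → ℂ}, ContDiffOn ℝ ∞ f P.Ω →
      ContDiff ℝ ∞ fun p : KAux N n m × KConf N n m => superEval f (superKJ x p.2 0 p.1) := fun hf =>
    contDiff_superEval hP.isOpen hf hx (fun p => bodies_superKJ _ _ _ _) hY
  have hbv : ∀ i, ContDiff ℝ ∞ fun p : KAux N n m × KConf N n m => boson p.2.1 i := fun i =>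
    contDiff_coe_ev (contDiff_pi.1 (contDiff_fst.comp hv) i)
  have hba : ∀ i, ContDiff ℝ ∞ fun p : KAux N n m × KConf N n m => boson p.1 i := fun i =>
    contDiff_coe_ev (contDiff_pi.1 ha i)
  have hcv : ∀ c, ContDiff ℝ ∞ fun p : KAux N n m × KConf N n m => coordG (boson p.2.1) c := by
    intro c
    unfold coordG
    split_ifs
    · exact hbv _
    · exact (hbv _).gr_conj
  have hτ : ∀ τ, ContDiff ℝ ∞ fun p : KAux N n m × KConf N n m => P.couplingTerm x p.1 p.2 τ :=
    fun τ => ((contDiff_gr_linear (chiralInt_add τ) (chiralInt_smul τ)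
      ((hE (hP.contDiffOn_pot τ)).gr_mul ((contDiff_gr_linear (evenDer_covPart τ).add
        (evenDer_covPart τ).smul (hY τ.1)).add ((hY' τ.1).gr_const_mul _)))).const_smul _).add
      ((ContDiff.sum fun c _ => ((hcv c).gr_const_mul _).gr_mul (hba τ.1)).const_smul _)
  have hS := ContDiff.sum (s := Finset.univ) fun τ _ => hτ τ
  exact (((contDiff_gr_linear intFull_add intFull_smul (hE hP.contDiffOn_K)).const_smul _).add
    ((ContDiff.sum fun c _ => ContDiff.sum fun d _ =>
      ((((hcv d).gr_const_mul _).gr_mul (hcv c)).const_smul _)).const_smul _)).add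
    (hS.add hS.gr_conj)

/-- The reduced fields and the auxiliary fields together determine the original ones: `φ' = -iψ̄²`
is solved by the conjugate of `iφ'`, and `ξ = v̄²` by conjugation. The same linear bijection serves
for configurations and velocities. -/
theorem exists_reduceConf_eq (x : KConf N n m) (a : KAux N n m) :
    ∃ y : HKTConf N n m, reduceConfL N n m y = x ∧ reducedCoordL N n m y = a := by
  refine ⟨(fun k i => if k = 0 then x.1 i else conjEv (a i),
    fun k i => if k = 0 then x.2 0 i else conjOd (Complex.I • x.2 1 i)), ?_, ?_⟩
  · refine Prod.ext (funext fun i => rfl) (funext fun k => funext fun i => ?_)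
    fin_cases k
    · rfl
    · apply Subtype.ext
      change (-Complex.I) • conj (conj (Complex.I • (x.2 1 i : Gr (4 + N)))) = (x.2 1 i : Gr (4 + N))
      rw [conj_conj, smul_smul]
      simp
  · refine funext fun i => Subtype.ext ?_
    change conj (conj (a i : Gr (4 + N))) = a i
    rw [conj_conj]

/-- The first-order Lagrangian of the bi-HKT model. -/
def Potentials.lagrFirstHKT (P : Potentials n m) (x v : HKTConf N n m) : Gr (4 + N) :=
  P.lagrFirst (reduceConf x) (reducedCoord v) (reduceConf v)

theorem Potentials.Regular.contDiff_lagrFirstHKT (hP : P.Regular) (x : HKTConf N n m)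
    (hx : P.InDomain (x.1 0)) : ContDiff ℝ ∞ (P.lagrFirstHKT x) :=
  ContDiff.comp (g := fun p : KAux N n m × KConf N n m => P.lagrFirst (reduceConf x) p.1 p.2)
    (f := fun v => (reducedCoordL N n m v, reduceConfL N n m v))
    (hP.contDiff_lagrFirst (reduceConf x) hx)
    ((reducedCoordL N n m).contDiff.prodMk (reduceConfL N n m).contDiff)

/-- The first-order form of the bi-Kähler Lagrangian is pulled back along the reduction of
trajectories and composed with the equivalence of the two models. -/
theorem Potentials.Regular.equivLagr_lagrFirstHKT (hP : P.Regular) :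
    EquivLagr (P.trajHKT N) (lagrHKT P.prepotential) (fun F t => P.lagrFirstHKT (F t) (deriv F t)) := by
  obtain ⟨k, G, hG⟩ := hP.equivLagr_lagrFirst (N := N)
  have h : EquivLagr (P.trajHKT N) (fun F => lagrK P (reduceTraj F))
      (fun F t => P.lagrFirstHKT (F t) (deriv F t)) := by
    -- The pulled-back boundary term needs one more derivative, since the auxiliary fields are
    -- velocities.
    refine ⟨k + 1, fun j => G fun i => (reduceConf (j i.castSucc), reducedCoord (j i.succ)),
      fun F hF t => ?_⟩
    have := hG _ (reduceTraj_mem hF) t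
    simp only [iteratedDeriv_reduceTraj hF.1] at this
    refine this.congr_deriv ?_
    rw [← iteratedDeriv_one (f := reduceTraj F), iteratedDeriv_reduceTraj hF.1, iteratedDeriv_one]
    rfl
  exact hP.equivLagr_lagrK.trans h

theorem Potentials.Regular.reducedHamiltonianAt_iff (hP : P.Regular) (x : KConf N n m)
    (p : KConf N n m → Gr (4 + N)) (E : Gr (4 + N)) (hx : P.InDomain x.1) :
    ReducedHamiltonianAt reduceConf P.lagrFirstHKT x p E ↔ AuxHamiltonianAt P.lagrFirst x p E :=
  BiHKT.reducedHamiltonianAt_iff (reduceConfL N n m) (reducedCoordL N n m) exists_reduceConf_eq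
    (fun y v hy => by rw [← hy]; rfl) ((hP.contDiff_lagrFirst x hx).differentiable (by simp)) p E

end Smoothness

end

end BiHKT

namespace BiHKT

noncomputable section

/-! ### The metric -/

section Metric

variable {n m : ℕ} {P : Potentials n m}

/-- A function on the bi-HKT target that is affine in the second coordinates. -/
def affineFn (K : (Flav n m → ℂ) → ℂ) (F G : Flav n m → (Flav n m → ℂ) → ℂ)
    (x : Fin 2 × Flav n m → ℂ) : ℂ :=
  K ((firstCoord n m).mapC x) + ∑ i, (F i ((firstCoord n m).mapC x) * coordC x ((1, i), 1) +
    G i ((firstCoord n m).mapC x) * coordC x ((1, i), 0))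

theorem wirt_sum {J : Type} {ι : Type*} [Fintype J] [DecidableEq J] (s : Finset ι)
    {F : ι → (J → ℂ) → ℂ} {x : J → ℂ} (hF : ∀ i, DifferentiableAt ℝ (F i) x) (c : J × Fin 2) :
    wirt c (fun y => ∑ i ∈ s, F i y) x = ∑ i ∈ s, wirt c (F i) x := by
  simp only [wirt_apply, fderiv_fun_sum fun i _ => hF i, _root_.sum_apply,
    Finset.mul_sum, ← Finset.sum_add_distrib, Finset.sum_div]

/-! ### Wirtinger derivatives of functions affine in the second coordinates. -/

section Affine

variable {U : Set (Flav n m → ℂ)} (hU : IsOpen U) {K : (Flav n m → ℂ) → ℂ}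
  {F G : Flav n m → (Flav n m → ℂ) → ℂ} (hK : ContDiffOn ℝ ∞ K U)
  (hF : ∀ i, ContDiffOn ℝ ∞ (F i) U) (hG : ∀ i, ContDiffOn ℝ ∞ (G i) U)
  {x : Fin 2 × Flav n m → ℂ} (hx : (firstCoord n m).mapC x ∈ U)
include hU hx

theorem wirt_firstCoord_zero (hK : ContDiffOn ℝ ∞ K U) (j : Flav n m) (s : Fin 2) :
    wirt ((0, j), s) (fun y => K ((firstCoord n m).mapC y)) x =
      wirt (j, s) K ((firstCoord n m).mapC x) := by
  rw [(firstCoord n m).wirt_comp hU hK _ hx, Finset.sum_eq_single (j, s)]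
  · simp [CoordChange.mapIdx, firstCoord]
  · rintro ⟨i, r⟩ - h
    rw [if_neg, zero_mul]
    intro h'
    simp only [CoordChange.mapIdx, firstCoord, Prod.mk.injEq, zero_add, true_and] at h'
    exact h (by rw [h'.1, h'.2])
  · simp

theorem wirt_firstCoord_one (hK : ContDiffOn ℝ ∞ K U) (j : Flav n m) (s : Fin 2) :
    wirt ((1, j), s) (fun y => K ((firstCoord n m).mapC y)) x = 0 := by
  rw [(firstCoord n m).wirt_comp hU hK _ hx]
  refine Finset.sum_eq_zero fun d _ => ?_
  rw [if_neg, zero_mul]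
  simp [CoordChange.mapIdx, firstCoord]

include hK hF hG

theorem wirt_affineFn (c : (Fin 2 × Flav n m) × Fin 2) :
    wirt c (affineFn K F G) x = wirt c (fun y => K ((firstCoord n m).mapC y)) x +
      ∑ i, (wirt c (fun y => F i ((firstCoord n m).mapC y)) x * coordC x ((1, i), 1) +
        F i ((firstCoord n m).mapC x) * (if c = ((1, i), 1) then 1 else 0) +
        (wirt c (fun y => G i ((firstCoord n m).mapC y)) x * coordC x ((1, i), 0) +
          G i ((firstCoord n m).mapC x) * (if c = ((1, i), 0) then 1 else 0))) := by
  have hd : ∀ {H : (Flav n m → ℂ) → ℂ}, ContDiffOn ℝ ∞ H U →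
      DifferentiableAt ℝ (fun y => H ((firstCoord n m).mapC y)) x := fun hH =>
    differentiableAt_of_contDiffOn ((firstCoord n m).isOpen_preimage hU)
      ((firstCoord n m).contDiffOn_comp hH) hx
  have hc : ∀ d, DifferentiableAt ℝ (fun y : Fin 2 × Flav n m → ℂ => coordC y d) x := fun d =>
    (contDiff_coordC d).differentiable (by simp) x
  have hs : ∀ i, DifferentiableAt ℝ (fun y : Fin 2 × Flav n m → ℂ =>
      F i ((firstCoord n m).mapC y) * coordC y ((1, i), 1) +
        G i ((firstCoord n m).mapC y) * coordC y ((1, i), 0)) x := fun i =>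
    ((hd (hF i)).fun_mul (hc _)).fun_add ((hd (hG i)).fun_mul (hc _))
  unfold affineFn
  rw [wirt_add (hd hK) (DifferentiableAt.fun_sum fun i _ => hs i), wirt_sum _ hs]
  congr 1
  refine Finset.sum_congr rfl fun i _ => ?_
  rw [wirt_add ((hd (hF i)).fun_mul (hc _)) ((hd (hG i)).fun_mul (hc _)), wirt_mul (hd (hF i)) (hc _),
    wirt_mul (hd (hG i)) (hc _), wirt_coordC, wirt_coordC]

theorem wirt_affineFn_zero (j : Flav n m) (s : Fin 2) :
    wirt ((0, j), s) (affineFn K F G) x =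
      affineFn (wirt (j, s) K) (fun i => wirt (j, s) (F i)) (fun i => wirt (j, s) (G i)) x := by
  rw [wirt_affineFn hU hK hF hG hx]
  simp only [wirt_firstCoord_zero hU hx hK, wirt_firstCoord_zero hU hx (hF _),
    wirt_firstCoord_zero hU hx (hG _), affineFn]
  simp

theorem wirt_affineFn_one_one (j : Flav n m) :
    wirt ((1, j), 1) (affineFn K F G) x = affineFn (F j) 0 0 x := by
  rw [wirt_affineFn hU hK hF hG hx]
  simp only [wirt_firstCoord_one hU hx hK, wirt_firstCoord_one hU hx (hF _),
    wirt_firstCoord_one hU hx (hG _), affineFn]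
  simp

theorem wirt_affineFn_one_zero (j : Flav n m) :
    wirt ((1, j), 0) (affineFn K F G) x = affineFn (G j) 0 0 x := by
  rw [wirt_affineFn hU hK hF hG hx]
  simp only [wirt_firstCoord_one hU hx hK, wirt_firstCoord_one hU hx (hF _),
    wirt_firstCoord_one hU hx (hG _), affineFn]
  simp

end Affine

theorem affineFn_zero (K : (Flav n m → ℂ) → ℂ) (x : Fin 2 × Flav n m → ℂ) :
    affineFn K 0 0 x = K ((firstCoord n m).mapC x) := by
  simp [affineFn]

/-- The coupling functions and their conjugates. -/
def Potentials.couplingConj (P : Potentials n m) (i : Flav n m) (q : Flav n m → ℂ) : ℂ :=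
  starRingEnd ℂ (P.coupling i q)

theorem Potentials.prepotential_eq_affineFn (P : Potentials n m) :
    P.prepotential = affineFn (fun q => (P.K q : ℂ)) P.coupling P.couplingConj :=
  P.prepotential_eq

/-- Two multiplets are both ordinary or both mirror. -/
def SameSector : Flav n m → Flav n m → Prop
  | .inl _, .inl _ => True
  | .inr _, .inr _ => True
  | .inl _, .inr _ => False
  | .inr _, .inl _ => False

/-- The sign of a component of the metric, which vanishes for mixed components. -/
def sectorSign : Flav n m → Flav n m → ℂ
  | .inl _, .inl _ => 1
  | .inr _, .inr _ => -1
  | .inl _, .inr _ => 0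
  | .inr _, .inl _ => 0

/-- The nonzero components of the metric, as functions of the coordinates that remain. -/
def Potentials.metricRed (P : Potentials n m) (i j : Flav n m) (q : Flav n m → ℂ) :
    Fin 2 → Fin 2 → ℂ
  | 0, 0 => wirt (i, 0) (wirt (j, 1) fun q => (P.K q : ℂ)) q
  | 0, 1 => wirt (i, 0) (P.coupling j) q - wirt (j, 0) (P.coupling i) q
  | 1, 0 => wirt (j, 1) (P.couplingConj i) q - wirt (i, 1) (P.couplingConj j) q
  | 1, 1 => wirt (j, 0) (wirt (i, 1) fun q => (P.K q : ℂ)) q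

namespace Potentials.Regular

variable (hP : P.Regular)
include hP

theorem contDiffOn_couplingConj (i : Flav n m) : ContDiffOn ℝ ∞ (P.couplingConj i) P.Ω :=
  contDiffOn_conj (hP.contDiffOn_coupling i)

/-- Inside one sector a potential is holomorphic in all coordinates or antiholomorphic in all, so
one of the two derivatives, taken first, already gives zero. Across sectors this fails, but the
metric has no mixed components. -/
theorem wirt_wirt_pot {q : Flav n m → ℂ} (hq : q ∈ P.Ω) {i j : Flav n m} (h : SameSector i j)
    (τ : Flav n m × Fin 2) : wirt (i, 0) (wirt (j, 1) (P.pot τ)) q = 0 := by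
  have hz : ∀ c, wirt c (fun _ : Flav n m → ℂ => (0 : ℂ)) q = 0 := fun c => wirt_const 0 c
  by_cases hj : holFlip τ j = 0
  · have e : Set.EqOn (wirt (j, 1) (P.pot τ)) (fun _ => 0) P.Ω := fun y hy => by
      have := hP.wirt_pot τ hy j
      rwa [hj, zero_add] at this
    rw [wirt_eqOn hP.isOpen e (i, 0) hq, hz]
  · have hi : holFlip τ i = 1 := by
      obtain ⟨l, k⟩ := τ
      rcases i with i | i <;> rcases j with j | j <;> rcases l with l | l <;> fin_cases k <;>
        simp_all [holFlip, SameSector]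
    have e : Set.EqOn (wirt (i, 0) (P.pot τ)) (fun _ => 0) P.Ω := fun y hy => by
      have := hP.wirt_pot τ hy i
      rwa [hi] at this
    rw [wirt_comm hP.isOpen (hP.contDiffOn_pot τ) (i, 0) (j, 1) hq, wirt_eqOn hP.isOpen e (j, 1) hq,
      hz]

theorem wirt_coupling {q : Flav n m → ℂ} (hq : q ∈ P.Ω) (c : Flav n m × Fin 2) (i : Flav n m) :
    wirt c (P.coupling i) q =
      flavSign i * (wirt c (P.pot (i, 0)) q + wirt c (P.pot (i, 1)) q) := by
  have hd := fun τ => differentiableAt_of_contDiffOn hP.isOpen (hP.contDiffOn_pot τ) hq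
  change wirt c (fun q => flavSign i * (P.pot (i, 0) q + P.pot (i, 1) q)) q = _
  rw [wirt_const_mul _ ((hd _).fun_add (hd _)), wirt_add (hd _) (hd _)]

theorem wirt_wirt_coupling {q : Flav n m → ℂ} (hq : q ∈ P.Ω) {i j : Flav n m} (h : SameSector i j)
    (l : Flav n m) : wirt (i, 0) (wirt (j, 1) (P.coupling l)) q = 0 := by
  have hd := fun τ => differentiableAt_of_contDiffOn hP.isOpen
    (contDiffOn_wirt hP.isOpen (hP.contDiffOn_pot τ) (j, 1)) hq
  rw [wirt_eqOn hP.isOpen (fun y hy => hP.wirt_coupling hy (j, 1) l) (i, 0) hq,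
    wirt_const_mul _ ((hd _).fun_add (hd _)), wirt_add (hd _) (hd _), hP.wirt_wirt_pot hq h,
    hP.wirt_wirt_pot hq h, add_zero, mul_zero]

theorem wirt_couplingConj {q : Flav n m → ℂ} (hq : q ∈ P.Ω) (c : Flav n m × Fin 2) (i : Flav n m) :
    wirt c (P.couplingConj i) q = starRingEnd ℂ (wirt (flipC c) (P.coupling i) q) :=
  wirt_conj (differentiableAt_of_contDiffOn hP.isOpen (hP.contDiffOn_coupling i) hq) c

theorem wirt_wirt_couplingConj {q : Flav n m → ℂ} (hq : q ∈ P.Ω) {i j : Flav n m}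
    (h : SameSector i j) (l : Flav n m) :
    wirt (i, 0) (wirt (j, 1) (P.couplingConj l)) q = 0 := by
  have h' : SameSector j i := by
    rcases i with i | i <;> rcases j with j | j <;> simp_all [SameSector]
  rw [wirt_eqOn hP.isOpen (fun y hy => hP.wirt_couplingConj hy (j, 1) l) (i, 0) hq,
    wirt_conj (differentiableAt_of_contDiffOn hP.isOpen
      (contDiffOn_wirt hP.isOpen (hP.contDiffOn_coupling l) _) hq)]
  change starRingEnd ℂ (wirt (i, 1) (wirt (j, 0) (P.coupling l)) q) = 0
  rw [wirt_comm hP.isOpen (hP.contDiffOn_coupling l) (i, 1) (j, 0) hq,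
    hP.wirt_wirt_coupling hq h', map_zero]

/-- Two derivatives along second coordinates give zero by affinity; one along each kind of
coordinate gives a derivative of a coupling function; two along first coordinates give a derivative
of `K`, because the couplings drop out within a sector. The `ε` tensors antisymmetrize the
off-diagonal components. Nothing depends on `ξ`, `σ`. -/
theorem deltaOp_eq {i j : Flav n m} (h : SameSector i j) (k l : Fin 2)
    {x : Fin 2 × Flav n m → ℂ} (hx : (firstCoord n m).mapC x ∈ P.Ω) :
    deltaOp P.prepotential k i l j x = P.metricRed i j ((firstCoord n m).mapC x) k l := by
  have hU := hP.isOpen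
  have hV : IsOpen ((firstCoord n m).mapC ⁻¹' P.Ω) := (firstCoord n m).isOpen_preimage hU
  have hK := hP.contDiffOn_K
  have hF := hP.contDiffOn_coupling
  have hG := hP.contDiffOn_couplingConj
  have h0 : ∀ i : Flav n m, ContDiffOn ℝ ∞ ((0 : Flav n m → (Flav n m → ℂ) → ℂ) i) P.Ω :=
    fun i => contDiffOn_const
  have h' : SameSector j i := by
    rcases i with i | i <;> rcases j with j | j <;> simp_all [SameSector]
  have a0 : ∀ c j s, wirt c (wirt ((0, j), s) P.prepotential) x =
      wirt c (affineFn (wirt (j, s) fun q => (P.K q : ℂ)) (fun i => wirt (j, s) (P.coupling i))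
        (fun i => wirt (j, s) (P.couplingConj i))) x := fun c j s => by
    rw [P.prepotential_eq_affineFn]
    exact wirt_eqOn hV (fun y hy => wirt_affineFn_zero hU hK hF hG hy j s) c hx
  have a1 : ∀ c j, wirt c (wirt ((1, j), 1) P.prepotential) x =
      wirt c (affineFn (P.coupling j) 0 0) x := fun c j => by
    rw [P.prepotential_eq_affineFn]
    exact wirt_eqOn hV (fun y hy => wirt_affineFn_one_one hU hK hF hG hy j) c hx
  have a2 : ∀ c j, wirt c (wirt ((1, j), 0) P.prepotential) x =
      wirt c (affineFn (P.couplingConj j) 0 0) x := fun c j => by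
    rw [P.prepotential_eq_affineFn]
    exact wirt_eqOn hV (fun y hy => wirt_affineFn_one_zero hU hK hF hG hy j) c hx
  have b0 : ∀ i s {H : (Flav n m → ℂ) → ℂ}, ContDiffOn ℝ ∞ H P.Ω →
      wirt ((0, i), s) (affineFn H 0 0) x = wirt (i, s) H ((firstCoord n m).mapC x) :=
    fun i s H hH => by
      rw [show affineFn H 0 0 = _ from funext (affineFn_zero H), wirt_firstCoord_zero hU hx hH]
  have b1 : ∀ i s {H : (Flav n m → ℂ) → ℂ}, ContDiffOn ℝ ∞ H P.Ω →
      wirt ((1, i), s) (affineFn H 0 0) x = 0 :=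
    fun i s H hH => by
      rw [show affineFn H 0 0 = _ from funext (affineFn_zero H), wirt_firstCoord_one hU hx hH]
  have hW : ∀ {H : (Flav n m → ℂ) → ℂ} c, ContDiffOn ℝ ∞ H P.Ω → ContDiffOn ℝ ∞ (wirt c H) P.Ω :=
    fun c hH => contDiffOn_wirt hU hH c
  -- The only place where the second coordinates could survive: their coefficients are `∂_i ∂̄_j` of
  -- coupling functions and of their conjugates, which vanish within a sector.
  have c1 : ∀ i j, SameSector i j → wirt ((0, i), 0) (wirt ((0, j), 1) P.prepotential) x =
      wirt (i, 0) (wirt (j, 1) fun q => (P.K q : ℂ)) ((firstCoord n m).mapC x) := fun i j h => by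
    rw [a0, wirt_affineFn_zero hU (hW _ hK) (fun l => hW _ (hF l)) (fun l => hW _ (hG l)) hx]
    simp [affineFn, hP.wirt_wirt_coupling hx h, hP.wirt_wirt_couplingConj hx h]
  have c2 : ∀ i j, SameSector j i → wirt ((0, i), 1) (wirt ((0, j), 0) P.prepotential) x =
      wirt (j, 0) (wirt (i, 1) fun q => (P.K q : ℂ)) ((firstCoord n m).mapC x) := fun i j h => by
    rw [← c1 j i h]
    exact wirt_comm hV hP.contDiffOn_prepotential _ _ hx
  have e : ∀ k l, deltaOp P.prepotential k i l j x =
      wirt ((k, i), 0) (wirt ((l, j), 1) P.prepotential) x +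
      ∑ k' : Fin 2, ∑ l' : Fin 2, epsDn k k' * epsDn l l' *
        wirt ((k', i), 1) (wirt ((l', j), 0) P.prepotential) x := fun k l => rfl
  rw [e]
  simp only [Fin.sum_univ_two]
  match k, l with
  | 0, 0 => simp [epsDn, c1 i j h, a2, b1 _ _ (hG _), metricRed]
  | 0, 1 =>
    simp only [a1, b0 _ _ (hF _), metricRed, epsDn, a0, wirt_affineFn_one_one hU (hW _ hK)
      (fun l => hW _ (hF l)) (fun l => hW _ (hG l)) hx, affineFn_zero]
    simp [sub_eq_add_neg]
  | 1, 0 =>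
    simp only [a2, b0 _ _ (hG _), metricRed, epsDn, a0, wirt_affineFn_one_zero hU (hW _ hK)
      (fun l => hW _ (hF l)) (fun l => hW _ (hG l)) hx, affineFn_zero]
    simp [sub_eq_add_neg]
  | 1, 1 => simp [epsDn, c2 i j h', a1, b1 _ _ (hF _), metricRed]

theorem metricHKT_eq (M M' : Fin 2 × Flav n m) {x : Fin 2 × Flav n m → ℂ}
    (hx : (firstCoord n m).mapC x ∈ P.Ω) :
    metricHKT P.prepotential M M' x =
      sectorSign M.2 M'.2 * P.metricRed M.2 M'.2 ((firstCoord n m).mapC x) M.1 M'.1 := by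
  obtain ⟨k, i⟩ := M
  obtain ⟨l, j⟩ := M'
  rcases i with i | i <;> rcases j with j | j
  · simp [sectorSign, metricHKT, hP.deltaOp_eq (i := .inl i) (j := .inl j) trivial k l hx]
  · simp [sectorSign, metricHKT]
  · simp [sectorSign, metricHKT]
  · simp [sectorSign, metricHKT, hP.deltaOp_eq (i := .inr i) (j := .inr j) trivial k l hx]

theorem metricHKT_congr (M M' : Fin 2 × Flav n m) (x y : Fin 2 × Flav n m → ℂ)
    (hx : (fun i => x (0, i)) ∈ P.Ω) (h : ∀ i, x (0, i) = y (0, i)) :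
    metricHKT P.prepotential M M' x = metricHKT P.prepotential M M' y := by
  have e : (firstCoord n m).mapC y = (firstCoord n m).mapC x := funext fun i => (h i).symm
  have hx' : (firstCoord n m).mapC x ∈ P.Ω := hx
  rw [hP.metricHKT_eq M M' hx', hP.metricHKT_eq M M' (by rw [e]; exact hx'), e]

end Potentials.Regular

end Metric

end

end BiHKT

namespace BiHKT

noncomputable section

/-! ### Superfields without fermions -/

section Bosonic

open Gr

variable {N n m : ℕ} {P : Potentials n m}

section EvenConstants

variable (x : Ev N) (f : Gr (4 + N))

@[simp] theorem ev_mul_theta : (x : Gr (4 + N)) * (theta N * f) = theta N * (x * f) :=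
  (isEven_ev x).mul_left_comm _ _
@[simp] theorem ev_mul_thetaBar : (x : Gr (4 + N)) * (thetaBar N * f) = thetaBar N * (x * f) :=
  (isEven_ev x).mul_left_comm _ _
@[simp] theorem ev_mul_eta : (x : Gr (4 + N)) * (eta N * f) = eta N * (x * f) :=
  (isEven_ev x).mul_left_comm _ _
@[simp] theorem ev_mul_etaBar : (x : Gr (4 + N)) * (etaBar N * f) = etaBar N * (x * f) :=
  (isEven_ev x).mul_left_comm _ _
@[simp] theorem dTheta_ev_mul : dTheta ((x : Gr (4 + N)) * f) = x * dTheta f := by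
  rw [isOddDer_dTheta.mul, dTheta_ev, zero_mul, zero_add, par_ev]
@[simp] theorem dThetaBar_ev_mul : dThetaBar ((x : Gr (4 + N)) * f) = x * dThetaBar f := by
  rw [isOddDer_dThetaBar.mul, dThetaBar_ev, zero_mul, zero_add, par_ev]
@[simp] theorem dEta_ev_mul : dEta ((x : Gr (4 + N)) * f) = x * dEta f := by
  rw [isOddDer_dEta.mul, dEta_ev, zero_mul, zero_add, par_ev]
@[simp] theorem dEtaBar_ev_mul : dEtaBar ((x : Gr (4 + N)) * f) = x * dEtaBar f := by
  rw [isOddDer_dEtaBar.mul, dEtaBar_ev, zero_mul, zero_add, par_ev]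
@[simp] theorem atZero_ev_mul : atZero ((x : Gr (4 + N)) * f) = x * atZero f := by
  rw [atZero_mul, atZero_ev]

end EvenConstants

/-- The nilpotent part of a superfield without fermions, or of its conjugate, in terms of the
velocity `p` and the auxiliary field `q`. -/
def soulForm : Flav n m × Fin 2 → Ev N → Ev N → Gr (4 + N)
  | (.inl _, 0), p, q => (-Complex.I) • (theta N * (thetaBar N * p)) +
      (-Complex.I) • (eta N * (etaBar N * p)) + (2 : ℂ) • (eta N * (theta N * q))
  | (.inr _, 0), p, q => (-Complex.I) • (theta N * (thetaBar N * p)) +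
      Complex.I • (eta N * (etaBar N * p)) + (-2 : ℂ) • (etaBar N * (theta N * q))
  | (.inl _, 1), p, q => Complex.I • (theta N * (thetaBar N * p)) +
      Complex.I • (eta N * (etaBar N * p)) + (2 : ℂ) • (thetaBar N * (etaBar N * q))
  | (.inr _, 1), p, q => Complex.I • (theta N * (thetaBar N * p)) +
      (-Complex.I) • (eta N * (etaBar N * p)) + (-2 : ℂ) • (thetaBar N * (eta N * q))

/-- The field or its conjugate. -/
def coordEv (v : Flav n m → Ev N) (c : Flav n m × Fin 2) : Ev N :=
  if c.2 = 0 then v c.1 else conjEv (v c.1)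

theorem coordG_boson (v : Flav n m → Ev N) (c : Flav n m × Fin 2) :
    coordG (boson v) c = coordEv v c := by
  unfold coordG coordEv
  split_ifs <;> rfl

theorem superKJ_boson (z v : Flav n m → Ev N) (a : KAux N n m) (i : Flav n m) :
    superKJ (z, 0) (v, 0) 0 a i = boson z i + soulForm (i, 0) (v i) (a i) := by
  rcases i with i | i
  · simp [superKJ, ordSF, soulForm, boson, -Complex.coe_smul]
    module
  · simp [superKJ, mirSF, soulForm, boson, -Complex.coe_smul]
    module

theorem superKJ_velocity_boson (v : Flav n m → Ev N) (i : Flav n m) :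
    superKJ (v, 0) 0 0 0 i = boson v i := by
  rcases i with i | i <;> simp [superKJ, ordSF, mirSF, boson, -Complex.coe_smul]

theorem coordG_soulForm (v : Flav n m → Ev N) (a : KAux N n m) (c : Flav n m × Fin 2) :
    coordG (fun i => soulForm (i, 0) (v i) (a i)) c = soulForm c (coordEv v c) (coordEv a c) :=
  match c with
  | (.inl i, 0) => rfl
  | (.inr i, 0) => rfl
  | (.inl i, 1) => by
    simp [coordG, coordEv, soulForm, conj_add, conj_smul, par_neg, Complex.conj_ofNat, conj_neg]
  | (.inr i, 1) => by
    simp [coordG, coordEv, soulForm, conj_add, conj_smul, par_neg, Complex.conj_ofNat, conj_neg]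

theorem isEven_soulForm (c : Flav n m × Fin 2) (p q : Ev N) : (soulForm c p q).IsEven := by
  rw [isEven_iff]
  match c with
  | (.inl i, 0) => simp [soulForm, par_add, par_smul, par_neg]
  | (.inr i, 0) => simp [soulForm, par_add, par_smul, par_neg]
  | (.inl i, 1) => simp [soulForm, par_add, par_smul, par_neg]
  | (.inr i, 1) => simp [soulForm, par_add, par_smul, par_neg]

theorem body_soulForm (c : Flav n m × Fin 2) (p q : Ev N) : body (soulForm c p q) = 0 :=
  match c with
  | (.inl i, 0) => by simp [soulForm, body_add, body_smul, body_neg]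
  | (.inr i, 0) => by simp [soulForm, body_add, body_smul, body_neg]
  | (.inl i, 1) => by simp [soulForm, body_add, body_smul, body_neg]
  | (.inr i, 1) => by simp [soulForm, body_add, body_smul, body_neg]

/-- The coefficient of `θ θ̄ η η̄` in the product of two nilpotent parts. -/
def soulProd (d c : Flav n m × Fin 2) (p q p' q' : Ev N) : Gr (4 + N) :=
  if d.2 = c.2 then (-2 * sectorSign d.1 c.1) • ((p : Gr (4 + N)) * p')
  else (2 * sectorSign d.1 c.1) • ((p : Gr (4 + N)) * p') +
    (4 * sectorSign d.1 c.1) • ((q : Gr (4 + N)) * q')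

/-- The velocities meet as `θθ̄` against `ηη̄` in two ways, which add within a sector and cancel
across sectors because the sign of `ηη̄` differs. The auxiliary fields meet only if one factor is
conjugated and both belong to the same sector; otherwise an odd coordinate is repeated or the
products do not match. -/
theorem soulForm_mul (d c : Flav n m × Fin 2) (p q p' q' : Ev N) :
    soulForm d p q * soulForm c p' q' =
      theta N * (thetaBar N * (eta N * (etaBar N * soulProd d c p q p' q'))) := by
  obtain ⟨i, k⟩ := d
  obtain ⟨j, l⟩ := c
  rcases i with i | i <;> rcases j with j | j <;> fin_cases k <;> fin_cases l <;>
  · simp [soulForm, soulProd, sectorSign, add_mul, mul_add, smul_mul_assoc, mul_smul_comm, mul_assoc,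
      smul_smul]
    try module

theorem soulForm_mul_top (c : Flav n m × Fin 2) (p q : Ev N) (f : Gr (4 + N)) :
    soulForm c p q * (theta N * (thetaBar N * (eta N * (etaBar N * f)))) = 0 :=
  match c with
  | (.inl i, 0) => by simp [soulForm, add_mul, smul_mul_assoc, mul_assoc]
  | (.inr i, 0) => by simp [soulForm, add_mul, smul_mul_assoc, mul_assoc]
  | (.inl i, 1) => by simp [soulForm, add_mul, smul_mul_assoc, mul_assoc]
  | (.inr i, 1) => by simp [soulForm, add_mul, smul_mul_assoc, mul_assoc]

theorem intFull_soulForm (e : Ev N) (c : Flav n m × Fin 2) (p q : Ev N) :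
    intFull ((e : Gr (4 + N)) * soulForm c p q) = 0 :=
  match c with
  | (.inl i, 0) => by simp [soulForm, intFull, mul_add, mul_smul_comm]
  | (.inr i, 0) => by simp [soulForm, intFull, mul_add, mul_smul_comm]
  | (.inl i, 1) => by simp [soulForm, intFull, mul_add, mul_smul_comm]
  | (.inr i, 1) => by simp [soulForm, intFull, mul_add, mul_smul_comm]

theorem intFull_soulForm_mul (e : Ev N) (d c : Flav n m × Fin 2) (p q p' q' : Ev N) :
    intFull ((e : Gr (4 + N)) * (soulForm d p q * soulForm c p' q')) =
      (e : Gr (4 + N)) * soulProd d c p q p' q' := by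
  rw [soulForm_mul]
  simp only [ev_mul_theta, ev_mul_thetaBar, ev_mul_eta, ev_mul_etaBar, intFull_top, atZero_ev_mul]
  unfold soulProd
  split_ifs <;> simp

/-- The covariant derivative of a superfield without fermions. -/
def covForm (τ : Flav n m × Fin 2) (p q : Ev N) : Gr (4 + N) :=
  match τ with
  | (.inl _, 0) => (2 : ℂ) • (theta N * q) + (-2 * Complex.I) • (etaBar N * p)
  | (.inr _, 0) => (2 : ℂ) • (theta N * q) + (2 * Complex.I) • (eta N * p)
  | (.inl _, 1) => (-2 : ℂ) • (eta N * q) + (-2 * Complex.I) • (thetaBar N * p)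
  | (.inr _, 1) => (2 : ℂ) • (etaBar N * q) + (-2 * Complex.I) • (thetaBar N * p)

theorem cov_boson (τ : Flav n m × Fin 2) (z p q : Ev N) :
    cov τ ((z : Gr (4 + N)) + soulForm (τ.1, 0) p q) p = covForm τ p q :=
  match τ with
  | (.inl _, 0) => by
    simp [cov, covPart, covCoeff, soulForm, covForm, smul_mul_assoc]
    module
  | (.inr _, 0) => by
    simp [cov, covPart, covCoeff, soulForm, covForm, smul_mul_assoc]
    module
  | (.inl _, 1) => by
    simp [cov, covPart, covCoeff, soulForm, covForm, smul_mul_assoc]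
    module
  | (.inr _, 1) => by
    simp [cov, covPart, covCoeff, soulForm, covForm, smul_mul_assoc]
    module

/-- Each term of the covariant derivative contains an odd coordinate already present in front.
Products of two nilpotent parts thus drop out of the couplings, where first order is enough. -/
theorem top_mul_covForm (τ : Flav n m × Fin 2) (f : Gr (4 + N)) (hf : f.IsEven) (p q : Ev N) :
    theta N * (thetaBar N * (eta N * (etaBar N * (f * covForm τ p q)))) = 0 := by
  have h1 := hf.mul_left_comm (theta N)
  have h2 := hf.mul_left_comm (thetaBar N)
  have h3 := hf.mul_left_comm (eta N)
  have h4 := hf.mul_left_comm (etaBar N)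
  match τ with
  | (.inl _, 0) => simp [covForm, mul_add, mul_smul_comm, h1, h2, h3, h4]
  | (.inr _, 0) => simp [covForm, mul_add, mul_smul_comm, h1, h2, h3, h4]
  | (.inl _, 1) => simp [covForm, mul_add, mul_smul_comm, h1, h2, h3, h4]
  | (.inr _, 1) => simp [covForm, mul_add, mul_smul_comm, h1, h2, h3, h4]

theorem chiralInt_covForm (τ : Flav n m × Fin 2) (e p q : Ev N) :
    chiralInt τ ((e : Gr (4 + N)) * covForm τ p q) = 0 :=
  match τ with
  | (.inl _, 0) => by simp [covForm, chiralInt, intThetaEtaEtaBar, mul_add, mul_smul_comm]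
  | (.inr _, 0) => by simp [covForm, chiralInt, intThetaEtaEtaBar, mul_add, mul_smul_comm]
  | (.inl _, 1) => by simp [covForm, chiralInt, intThetaThetaBarEta, mul_add, mul_smul_comm]
  | (.inr _, 1) => by simp [covForm, chiralInt, intThetaThetaBarEtaBar, mul_add, mul_smul_comm]

/-- The last term is not of metric form; it is exactly what the term from the integration by parts
in `couplingTerm` removes. Across sectors nothing else remains. -/
theorem chiralInt_soulForm_covForm (τ : Flav n m × Fin 2) (j : Flav n m) (e p q p' q' : Ev N) :
    couplingCoeff τ • chiralInt τ ((e : Gr (4 + N)) *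
        (soulForm (j, holFlip τ j) p q * covForm τ p' q')) =
      (flavSign τ.1 * sectorSign τ.1 j) • ((e : Gr (4 + N)) * ((p : Gr (4 + N)) * q') -
        (e : Gr (4 + N)) * ((q : Gr (4 + N)) * p')) -
      (1 / 2 : ℂ) • ((e : Gr (4 + N)) * ((p : Gr (4 + N)) * q')) := by
  match τ, j with
  | (.inl _, 0), .inl _ =>
    simp [couplingCoeff, chiralInt, intThetaEtaEtaBar, soulForm, covForm, holFlip, flavSign,
      covFactor, sectorSign, mul_add, add_mul, mul_smul_comm, smul_mul_assoc, mul_assoc, smul_smul]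
    match_scalars <;> grind [Complex.I_sq]
  | (.inl _, 0), .inr _ =>
    simp [couplingCoeff, chiralInt, intThetaEtaEtaBar, soulForm, covForm, holFlip, flavSign,
      covFactor, sectorSign, mul_add, add_mul, mul_smul_comm, smul_mul_assoc, mul_assoc, smul_smul]
    match_scalars <;> grind [Complex.I_sq]
  | (.inr _, 0), .inl _ =>
    simp [couplingCoeff, chiralInt, intThetaEtaEtaBar, soulForm, covForm, holFlip, flavSign,
      covFactor, sectorSign, mul_add, add_mul, mul_smul_comm, smul_mul_assoc, mul_assoc, smul_smul]
    match_scalars <;> grind [Complex.I_sq]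
  | (.inr _, 0), .inr _ =>
    simp [couplingCoeff, chiralInt, intThetaEtaEtaBar, soulForm, covForm, holFlip, flavSign,
      covFactor, sectorSign, mul_add, add_mul, mul_smul_comm, smul_mul_assoc, mul_assoc, smul_smul]
    match_scalars <;> grind [Complex.I_sq]
  | (.inl _, 1), .inl _ =>
    simp [couplingCoeff, chiralInt, intThetaThetaBarEta, soulForm, covForm, holFlip, flavSign,
      covFactor, sectorSign, mul_add, add_mul, mul_smul_comm, smul_mul_assoc, mul_assoc, smul_smul]
    match_scalars <;> grind [Complex.I_sq]
  | (.inl _, 1), .inr _ =>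
    simp [couplingCoeff, chiralInt, intThetaThetaBarEta, soulForm, covForm, holFlip, flavSign,
      covFactor, sectorSign, mul_add, add_mul, mul_smul_comm, smul_mul_assoc, mul_assoc, smul_smul]
    match_scalars <;> grind [Complex.I_sq]
  | (.inr _, 1), .inl _ =>
    simp [couplingCoeff, chiralInt, intThetaThetaBarEtaBar, soulForm, covForm, holFlip, flavSign,
      covFactor, sectorSign, mul_add, add_mul, mul_smul_comm, smul_mul_assoc, mul_assoc, smul_smul]
    match_scalars <;> grind [Complex.I_sq]
  | (.inr _, 1), .inr _ =>
    simp [couplingCoeff, chiralInt, intThetaThetaBarEtaBar, soulForm, covForm, holFlip, flavSign,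
      covFactor, sectorSign, mul_add, add_mul, mul_smul_comm, smul_mul_assoc, mul_assoc, smul_smul]
    match_scalars <;> grind [Complex.I_sq]

end Bosonic

end

end BiHKT

namespace BiHKT

noncomputable section

/-! ### The bosonic part of the Lagrangian -/

section BosonicLagrangian

open Gr

variable {N n m : ℕ} {P : Potentials n m}

theorem sectorSign_comm (i j : Flav n m) : sectorSign i j = sectorSign j i := by
  rcases i with i | i <;> rcases j with j | j <;> rfl

theorem sectorSign_eq (i j : Flav n m) : sectorSign i j = (flavSign i + flavSign j) / 2 := by
  rcases i with i | i <;> rcases j with j | j <;> norm_num [sectorSign, flavSign]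

theorem mem_bodies_boson {z : Flav n m → Ev N} (hz : P.InDomain z) : bodies (boson z) ∈ P.Ω := hz

namespace Potentials.Regular

variable (hP : P.Regular) {z : Flav n m → Ev N} (hz : P.InDomain z)
include hP hz

theorem isEven_superEval_boson {f : (Flav n m → ℂ) → ℂ} (hf : ContDiffOn ℝ ∞ f P.Ω) :
    (superEval f (boson z)).IsEven :=
  isEven_superEval hP.isOpen hf (mem_bodies_boson hz) (isEven_boson z)

theorem superEval_boson_mem {f : (Flav n m → ℂ) → ℂ} (hf : ContDiffOn ℝ ∞ f P.Ω) :
    superEval f (boson z) ∈ Ev N := by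
  refine mem_ev (hP.isEven_superEval_boson hz hf) ?_
  refine superEval_map hP.isOpen hf (mem_bodies_boson hz) atZero atZero_add atZero_smul atZero_mul atZero_one
    (fun c => ?_) fun j => rfl
  rw [coordG_boson, atZero_ev]

/-- Second order in the nilpotent parts, weighted by `1/4 · 1/2` and the coefficients of `soulProd`,
gives `-1/4` for two derivatives of equal type and `1/4` for opposite types. The term from the
integration by parts adds `1/4` to both: the former cancel and the latter become `1/2`. The
auxiliary fields contribute `1/2` directly, for opposite types only. -/
theorem kineticFirst_boson_eq_sum_coord (v : Flav n m → Ev N) (a : KAux N n m) :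
    P.kineticFirst (z, 0) a (v, 0) = ∑ c, ∑ d, if d.2 = c.2 then 0 else
      (sectorSign d.1 c.1 / 2) •
        (superEval (wirt d (wirt c fun q => (P.K q : ℂ))) (boson z) *
          (coordEv v d * coordEv v c + coordEv a d * coordEv a c : Gr (4 + N))) := by
  have hW := fun c => contDiffOn_wirt hP.isOpen hP.contDiffOn_K c
  have hWW := fun d c => contDiffOn_wirt hP.isOpen (hW c) d
  have hT := superEval_taylor_two (s := fun i => soulForm (i, 0) (v i) (a i))
    (by omega : 0 < 4 + N) hP.isOpen hP.contDiffOn_K (mem_bodies_boson hz) (isEven_boson z)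
    (fun j => isEven_soulForm _ _ _) (fun j => body_soulForm _ _ _)
    (fun c d e => by simp only [coordG_soulForm, soulForm_mul, soulForm_mul_top])
  have hI : intFull (superEval (fun q => (P.K q : ℂ)) (superKJ (z, 0) (v, 0) 0 a)) =
      (1 / 2 : ℂ) • ∑ c, ∑ d, superEval (wirt d (wirt c fun q => (P.K q : ℂ))) (boson z) *
        soulProd d c (coordEv v d) (coordEv a d) (coordEv v c) (coordEv a c) := by
    rw [show superKJ (z, 0) (v, 0) 0 a = _ from funext (superKJ_boson z v a), hT, intFull_add,
      intFull_add, intFull_smul, intFull_sum, intFull_sum]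
    have h0 : intFull (superEval (fun q => (P.K q : ℂ)) (boson z)) = 0 := by
      lift superEval (fun q => (P.K q : ℂ)) (boson z) to Ev N using
        hP.superEval_boson_mem hz hP.contDiffOn_K with e
      simp [intFull]
    have h1 : ∀ c, intFull (superEval (wirt c fun q => (P.K q : ℂ)) (boson z) *
        coordG (fun i => soulForm (i, 0) (v i) (a i)) c) = 0 := fun c => by
      rw [coordG_soulForm]
      exact intFull_soulForm ⟨_, hP.superEval_boson_mem hz (hW c)⟩ _ _ _
    simp only [h0, h1, Finset.sum_const_zero, zero_add, intFull_sum]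
    congr 1
    refine Finset.sum_congr rfl fun c _ => Finset.sum_congr rfl fun d _ => ?_
    rw [coordG_soulForm, coordG_soulForm]
    exact intFull_soulForm_mul ⟨_, hP.superEval_boson_mem hz (hWW d c)⟩ _ _ _ _ _ _
  set g : Flav n m × Fin 2 → Flav n m × Fin 2 → Gr (4 + N) := fun d c =>
    superEval (wirt d (wirt c fun q => (P.K q : ℂ))) (boson z) *
      ((coordEv v d : Gr (4 + N)) * coordEv v c) with hg
  have hsym : ∀ c d, g d c = g c d := fun c d => by
    simp only [hg]
    rw [superEval_congr hP.isOpen (hWW d c) (wirt_comm hP.isOpen hP.contDiffOn_K d c) (mem_bodies_boson hz),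
      (isEven_ev (coordEv v d)).comm]
  -- The summand is symmetric in `c` and `d`, so the sign of `c` may be replaced by the average of
  -- the signs of `c` and `d`, which is `sectorSign`. This eliminates the mixed components.
  have hS : ∑ c, ∑ d, flavSign c.1 • g d c = ∑ c, ∑ d, sectorSign d.1 c.1 • g d c := by
    have e : ∑ c, ∑ d, flavSign c.1 • g d c = ∑ c, ∑ d, flavSign d.1 • g d c := by
      rw [Finset.sum_comm]
      exact Finset.sum_congr rfl fun c _ => Finset.sum_congr rfl fun d _ => by rw [hsym]
    have h2 : ∑ c, ∑ d, flavSign c.1 • g d c = (1 / 2 : ℂ) •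
        (∑ c, ∑ d, flavSign c.1 • g d c + ∑ c, ∑ d, flavSign d.1 • g d c) := by
      rw [← e]; module
    rw [h2, ← Finset.sum_add_distrib, Finset.smul_sum]
    refine Finset.sum_congr rfl fun c _ => ?_
    rw [← Finset.sum_add_distrib, Finset.smul_sum]
    refine Finset.sum_congr rfl fun d _ => ?_
    rw [sectorSign_eq]
    module
  rw [Potentials.kineticFirst, hI]
  simp only [coordG_boson, mul_assoc]
  change _ + (1 / 4 : ℂ) • ∑ c, ∑ d, flavSign c.1 • g d c = _
  rw [hS, smul_smul, Finset.smul_sum, Finset.smul_sum, ← Finset.sum_add_distrib]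
  refine Finset.sum_congr rfl fun c _ => ?_
  rw [Finset.smul_sum, Finset.smul_sum, ← Finset.sum_add_distrib]
  refine Finset.sum_congr rfl fun d _ => ?_
  simp only [hg, soulProd]
  split_ifs
  · rw [mul_smul_comm]; module
  · rw [mul_add, mul_add, mul_smul_comm, mul_smul_comm]; module

/-- The two orders of a holomorphic and an antiholomorphic derivative contribute equally, which
turns the factors `1/2` into the Hermitian form of the metric. -/
theorem kineticFirst_boson (v : Flav n m → Ev N) (a : KAux N n m) :
    P.kineticFirst (z, 0) a (v, 0) = ∑ i, ∑ j, sectorSign i j •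
      (superEval (wirt (i, 0) (wirt (j, 1) fun q => (P.K q : ℂ))) (boson z) *
        (boson v i * conj (boson v j) + boson a i * conj (boson a j))) := by
  have hW := fun c => contDiffOn_wirt hP.isOpen hP.contDiffOn_K c
  have hWW := fun d c => contDiffOn_wirt hP.isOpen (hW c) d
  rw [hP.kineticFirst_boson_eq_sum_coord hz]
  simp only [sum_index_gr, Finset.sum_add_distrib]
  simp only [if_true, one_ne_zero, zero_ne_one, if_false, Finset.sum_const_zero, zero_add, add_zero]
  have e1 : ∀ i j : Flav n m,
      (sectorSign j i / 2) • (superEval (wirt (j, 1) (wirt (i, 0) fun q => (P.K q : ℂ))) (boson z) *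
        (coordEv v (j, 1) * coordEv v (i, 0) + coordEv a (j, 1) * coordEv a (i, 0) : Gr (4 + N))) =
      (sectorSign i j / 2) •
      (superEval (wirt (i, 0) (wirt (j, 1) fun q => (P.K q : ℂ))) (boson z) *
        (boson v i * conj (boson v j) + boson a i * conj (boson a j))) := fun i j => by
    rw [superEval_congr hP.isOpen (hWW (j, 1) (i, 0)) (wirt_comm hP.isOpen hP.contDiffOn_K _ _) (mem_bodies_boson hz),
      sectorSign_comm, (isEven_ev (coordEv v (j, 1))).comm, (isEven_ev (coordEv a (j, 1))).comm]
    rfl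
  rw [Finset.sum_congr rfl fun i _ => Finset.sum_congr rfl fun j _ => e1 i j]
  rw [Finset.sum_comm (f := fun i j : Flav n m => (sectorSign j i / 2) •
    (superEval (wirt (j, 0) (wirt (i, 1) fun q => (P.K q : ℂ))) (boson z) *
      (coordEv v (j, 0) * coordEv v (i, 1) + coordEv a (j, 0) * coordEv a (i, 1) : Gr (4 + N)))),
    ← Finset.sum_add_distrib]
  refine Finset.sum_congr rfl fun i _ => ?_
  rw [← Finset.sum_add_distrib]
  refine Finset.sum_congr rfl fun j _ => ?_
  change _ + (sectorSign i j / 2) •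
      (superEval (wirt (i, 0) (wirt (j, 1) fun q => (P.K q : ℂ))) (boson z) *
        (boson v i * conj (boson v j) + boson a i * conj (boson a j))) = _
  have half : ∀ (s : ℂ) (X : Gr (4 + N)), (s / 2) • X + (s / 2) • X = s • X := fun s X => by module
  exact half _ _

/-- Zeroth order vanishes under the integral and second order by the odd coordinates of the
covariant derivative. At first order only one Wirtinger derivative per coordinate survives, and the
extra `-½` term cancels against the one from the integration by parts. -/
theorem couplingTerm_boson (v : Flav n m → Ev N) (a : KAux N n m) (τ : Flav n m × Fin 2) :
    P.couplingTerm (z, 0) a (v, 0) τ = ∑ j, (flavSign τ.1 * sectorSign τ.1 j) •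
      (superEval (wirt (j, 0) (P.pot τ)) (boson z) *
        (boson v j * boson a τ.1 - boson a j * boson v τ.1)) := by
  have hW := fun c => contDiffOn_wirt hP.isOpen (hP.contDiffOn_pot τ) c
  have hz0 : ∀ j, superEval (wirt (j, holFlip τ j + 1) (P.pot τ)) (boson z) = 0 := fun j =>
    superEval_eq_zero hP.isOpen (fun y hy => hP.wirt_pot τ hy j) (mem_bodies_boson hz)
  have hD : cov τ (superKJ (z, 0) (v, 0) 0 a τ.1) (superKJ (v, 0) 0 0 0 τ.1) =
      covForm τ (v τ.1) (a τ.1) := by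
    rw [superKJ_boson, superKJ_velocity_boson]
    exact cov_boson τ _ _ _
  have hT := superEval_taylor_one (s := fun i => soulForm (i, 0) (v i) (a i))
    (by omega : 0 < 4 + N) hP.isOpen (hP.contDiffOn_pot τ) (mem_bodies_boson hz) (isEven_boson z)
    (fun j => isEven_soulForm _ _ _) (fun j => body_soulForm _ _ _) (covForm τ (v τ.1) (a τ.1))
    (fun c d => by
      rw [← mul_assoc]
      simp only [coordG_soulForm, soulForm_mul, mul_assoc]
      refine top_mul_covForm τ _ ?_ _ _
      unfold soulProd
      split_ifs
      · exact ((isEven_ev _).mul (isEven_ev _)).smul _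
      · exact (((isEven_ev _).mul (isEven_ev _)).smul _).add (((isEven_ev _).mul (isEven_ev _)).smul _))
  rw [Potentials.couplingTerm, hD, show superKJ (z, 0) (v, 0) 0 a = _ from
    funext (superKJ_boson z v a), hT, chiralInt_add, chiralInt_sum,
    chiralInt_covForm τ ⟨_, hP.superEval_boson_mem hz (hP.contDiffOn_pot τ)⟩, zero_add,
    Finset.smul_sum, Finset.smul_sum, ← Finset.sum_add_distrib, sum_index_gr]
  refine Finset.sum_congr rfl fun j _ => ?_
  have key := chiralInt_soulForm_covForm τ j ⟨_, hP.superEval_boson_mem hz (hW (j, holFlip τ j))⟩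
    (coordEv v (j, holFlip τ j)) (coordEv a (j, holFlip τ j)) (v τ.1) (a τ.1)
  simp only [coordG_soulForm, coordG_boson]
  have hc0 : chiralInt τ (0 : Gr (4 + N)) = 0 := by simpa using chiralInt_smul τ 0 (0 : Gr (4 + N))
  rcases (by omega : holFlip τ j = 0 ∨ holFlip τ j = 1) with h | h
  · have h1 := hz0 j
    rw [h, zero_add] at h1
    rw [h] at key
    rw [h1, key]
    simp only [zero_mul, hc0, smul_zero, add_zero, mul_assoc]
    change _ - _ + (1 / 2 : ℂ) • (superEval _ _ * (boson v j * boson a τ.1)) = _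
    rw [mul_sub]
    exact sub_add_cancel _ _
  -- A conjugated argument belongs to the other sector, where `sectorSign` vanishes and the two
  -- remaining halves cancel.
  · have h1 := hz0 j
    rw [h] at h1
    have hs : sectorSign τ.1 j = 0 := by
      obtain ⟨i, k⟩ := τ
      rcases i with i | i <;> rcases j with j | j <;> fin_cases k <;> simp_all [holFlip, sectorSign]
    rw [h] at key
    have h1' : superEval (wirt (j, 0) (P.pot τ)) (boson z) = 0 := h1
    rw [h1', key, hs]
    simp only [zero_mul, hc0, smul_zero, zero_add, mul_assoc, mul_zero, zero_smul, zero_sub]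
    exact neg_add_cancel _

theorem superEval_wirt_coupling (i j : Flav n m) :
    superEval (wirt (j, 0) (P.coupling i)) (boson z) =
      flavSign i • (superEval (wirt (j, 0) (P.pot (i, 0))) (boson z) +
        superEval (wirt (j, 0) (P.pot (i, 1))) (boson z)) := by
  have hW := fun k => contDiffOn_wirt hP.isOpen (hP.contDiffOn_pot (i, k)) (j, 0)
  have hm := mem_bodies_boson hz
  calc superEval (wirt (j, 0) (P.coupling i)) (boson z)
      = superEval (fun y => flavSign i *
          (wirt (j, 0) (P.pot (i, 0)) y + wirt (j, 0) (P.pot (i, 1)) y)) (boson z) :=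
        superEval_congr hP.isOpen (contDiffOn_wirt hP.isOpen (hP.contDiffOn_coupling i) (j, 0))
          (fun y hy => hP.wirt_coupling hy (j, 0) i) hm
    _ = flavSign i • superEval (fun y =>
          wirt (j, 0) (P.pot (i, 0)) y + wirt (j, 0) (P.pot (i, 1)) y) (boson z) :=
        superEval_const_mul hP.isOpen ((hW 0).add (hW 1)) hm _
    _ = _ := congrArg _ (superEval_add hP.isOpen (hW 0) (hW 1) hm)

/-- Exchanging the names of the indices in one of the two terms produces the antisymmetrized
derivative of the couplings, which is the off-diagonal block of the metric. -/
theorem sum_couplingTerm_boson (v : Flav n m → Ev N) (a : KAux N n m) :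
    ∑ τ, P.couplingTerm (z, 0) a (v, 0) τ = ∑ i, ∑ j, sectorSign i j •
      ((superEval (wirt (i, 0) (P.coupling j)) (boson z) -
        superEval (wirt (j, 0) (P.coupling i)) (boson z)) * (boson v i * boson a j)) := by
  have e : ∑ τ, P.couplingTerm (z, 0) a (v, 0) τ = ∑ i, ∑ j, sectorSign i j •
      (superEval (wirt (j, 0) (P.coupling i)) (boson z) *
        (boson v j * boson a i - boson a j * boson v i)) := by
    rw [sum_index_gr]
    refine Finset.sum_congr rfl fun i _ => ?_
    rw [hP.couplingTerm_boson hz, hP.couplingTerm_boson hz, ← Finset.sum_add_distrib]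
    refine Finset.sum_congr rfl fun j _ => ?_
    rw [hP.superEval_wirt_coupling hz, smul_mul_assoc, add_mul]
    module
  rw [e]
  simp only [mul_sub, sub_mul, smul_sub, Finset.sum_sub_distrib]
  refine congrArg₂ (· - ·) ?_ ?_
  · rw [Finset.sum_comm]
    exact Finset.sum_congr rfl fun i _ => Finset.sum_congr rfl fun j _ => by rw [sectorSign_comm]
  · exact Finset.sum_congr rfl fun i _ => Finset.sum_congr rfl fun j _ => by
      rw [(isEven_boson a j).comm]

omit hz in
theorem contDiffOn_metricRed (i j : Flav n m) (k l : Fin 2) :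
    ContDiffOn ℝ ∞ (fun q => P.metricRed i j q k l) P.Ω := by
  have hU := hP.isOpen
  match k, l with
  | 0, 0 => exact contDiffOn_wirt hU (contDiffOn_wirt hU hP.contDiffOn_K _) _
  | 0, 1 =>
    exact (contDiffOn_wirt hU (hP.contDiffOn_coupling _) _).sub
      (contDiffOn_wirt hU (hP.contDiffOn_coupling _) _)
  | 1, 0 =>
    exact (contDiffOn_wirt hU (hP.contDiffOn_couplingConj _) _).sub
      (contDiffOn_wirt hU (hP.contDiffOn_couplingConj _) _)
  | 1, 1 => exact contDiffOn_wirt hU (contDiffOn_wirt hU hP.contDiffOn_K _) _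

theorem superEval_couplingConj (i j : Flav n m) :
    superEval (wirt (j, 1) (P.couplingConj i)) (boson z) =
      conj (superEval (wirt (j, 0) (P.coupling i)) (boson z)) := by
  have hW := contDiffOn_wirt hP.isOpen (hP.contDiffOn_coupling i) (j, 0)
  rw [← superEval_conj hP.isOpen hW (mem_bodies_boson hz) (isEven_boson z)]
  exact superEval_congr hP.isOpen (contDiffOn_wirt hP.isOpen (hP.contDiffOn_couplingConj i) _)
    (fun y hy => hP.wirt_couplingConj hy (j, 1) i) (mem_bodies_boson hz)

omit hz in
theorem superEval_metricHKT (M M' : Fin 2 × Flav n m) (b : Fin 2 → Flav n m → Ev N)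
    (hb : P.InDomain (b 0)) :
    superEval (metricHKT P.prepotential M M') (fun j => (b j.1 j.2 : Gr (4 + N))) =
      sectorSign M.2 M'.2 •
        superEval (fun q => P.metricRed M.2 M'.2 q M.1 M'.1) (boson (b 0)) := by
  have hR := hP.contDiffOn_metricRed M.2 M'.2 M.1 M'.1
  have hsR : ContDiffOn ℝ ∞ (fun q => sectorSign M.2 M'.2 * P.metricRed M.2 M'.2 q M.1 M'.1) P.Ω :=
    contDiffOn_const.mul hR
  set X : Fin 2 × Flav n m → Gr (4 + N) := fun j => (b j.1 j.2 : Gr (4 + N)) with hX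
  have hXb : (firstCoord n m).mapG X = boson (b 0) := funext fun i => rfl
  have hm : (firstCoord n m).mapC (bodies X) ∈ P.Ω := by
    rw [← CoordChange.bodies_mapG, hXb]
    exact mem_bodies_boson hb
  have e1 : superEval (metricHKT P.prepotential M M') X = superEval (fun x => sectorSign M.2 M'.2 *
          P.metricRed M.2 M'.2 ((firstCoord n m).mapC x) M.1 M'.1) X := by
    refine (superEval_congr ((firstCoord n m).isOpen_preimage hP.isOpen)
          ((firstCoord n m).contDiffOn_comp hsR) (fun x hx => ?_) hm).symm
    exact (hP.metricHKT_eq M M' hx).symm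
  have e2 := superEval_comp (firstCoord n m) hP.isOpen hsR hm
  rw [e1, e2, hXb]
  exact superEval_const_mul hP.isOpen hR (mem_bodies_boson hb) _

omit hz in
-- The four blocks of the metric are matched with the parts of the Lagrangian: the diagonal blocks
-- with the velocities and the auxiliary fields in the kinetic term, the off-diagonal ones with the
-- couplings and their conjugate.
theorem lagrFirstHKT_boson (b v : Fin 2 → Flav n m → Ev N) (hb : P.InDomain (b 0)) :
    P.lagrFirstHKT (b, 0) (v, 0) = ∑ M, ∑ M',
      superEval (metricHKT P.prepotential M M') (fun j => (b j.1 j.2 : Gr (4 + N))) *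
        (v M.1 M.2 : Gr (4 + N)) * conj (v M'.1 M'.2 : Gr (4 + N)) := by
  have hr : ∀ b : Fin 2 → Flav n m → Ev N, reduceConf (b, 0) = (b 0, 0) := fun b => by
    refine Prod.ext rfl (funext fun k => funext fun i => Subtype.ext ?_)
    simp only [reduceConf]
    split_ifs
    · rfl
    · change (-Complex.I) • conj (0 : Gr (4 + N)) = 0
      rw [conj_zero, smul_zero]
  set a : KAux N n m := fun i => conjEv (v 1 i) with ha
  have hW := fun i c => contDiffOn_wirt hP.isOpen (hP.contDiffOn_coupling i) c
  have hWc := fun i c => contDiffOn_wirt hP.isOpen (hP.contDiffOn_couplingConj i) c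
  rw [Potentials.lagrFirstHKT, hr, hr, Potentials.lagrFirst]
  change P.kineticFirst (b 0, 0) a (v 0, 0) + (∑ τ, P.couplingTerm (b 0, 0) a (v 0, 0) τ +
    conj (∑ τ, P.couplingTerm (b 0, 0) a (v 0, 0) τ)) = _
  have hca : ∀ i, conj (boson a i) = (v 1 i : Gr (4 + N)) := fun i => conj_conj _
  have h00 : ∀ i j, superEval (fun q => P.metricRed i j q 0 0) (boson (b 0)) =
      superEval (wirt (i, 0) (wirt (j, 1) fun q => (P.K q : ℂ))) (boson (b 0)) := fun i j => rfl
  have h11 : ∀ i j, superEval (fun q => P.metricRed i j q 1 1) (boson (b 0)) =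
      superEval (wirt (j, 0) (wirt (i, 1) fun q => (P.K q : ℂ))) (boson (b 0)) := fun i j => rfl
  have h01 : ∀ i j, superEval (fun q => P.metricRed i j q 0 1) (boson (b 0)) =
      superEval (wirt (i, 0) (P.coupling j)) (boson (b 0)) -
        superEval (wirt (j, 0) (P.coupling i)) (boson (b 0)) := fun i j =>
    superEval_sub hP.isOpen (hW _ _) (hW _ _) (mem_bodies_boson hb)
  have h10 : ∀ i j, superEval (fun q => P.metricRed i j q 1 0) (boson (b 0)) =
      conj (superEval (wirt (j, 0) (P.coupling i)) (boson (b 0)) -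
        superEval (wirt (i, 0) (P.coupling j)) (boson (b 0))) := fun i j => by
    rw [conj_sub, ← hP.superEval_couplingConj hb, ← hP.superEval_couplingConj hb]
    exact superEval_sub hP.isOpen (hWc _ _) (hWc _ _) (mem_bodies_boson hb)
  set E : Fin 2 × Flav n m → Fin 2 × Flav n m → Gr (4 + N) := fun M M' =>
    superEval (metricHKT P.prepotential M M') (fun j => (b j.1 j.2 : Gr (4 + N))) with hE
  have hEM : ∀ M M', E M M' = sectorSign M.2 M'.2 •
      superEval (fun q => P.metricRed M.2 M'.2 q M.1 M'.1) (boson (b 0)) := fun M M' =>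
    hP.superEval_metricHKT M M' b hb
  set C := ∑ τ, P.couplingTerm (b 0, 0) a (v 0, 0) τ with hC
  have t00 : ∑ i, ∑ j, E (0, i) (0, j) * (v 0 i : Gr (4 + N)) * conj (v 0 j : Gr (4 + N)) =
      ∑ i, ∑ j, sectorSign i j •
        (superEval (wirt (i, 0) (wirt (j, 1) fun q => (P.K q : ℂ))) (boson (b 0)) *
          (boson (v 0) i * conj (boson (v 0) j))) :=
    Finset.sum_congr rfl fun i _ => Finset.sum_congr rfl fun j _ => by
      rw [hEM, h00, smul_mul_assoc, smul_mul_assoc, mul_assoc]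
      rfl
  have t11 : ∑ i, ∑ j, E (1, i) (1, j) * (v 1 i : Gr (4 + N)) * conj (v 1 j : Gr (4 + N)) =
      ∑ i, ∑ j, sectorSign i j •
        (superEval (wirt (i, 0) (wirt (j, 1) fun q => (P.K q : ℂ))) (boson (b 0)) *
          (boson a i * conj (boson a j))) := by
    -- The auxiliary fields are conjugates of the velocities of the second coordinates, so the two
    -- indices of this block are exchanged.
    rw [Finset.sum_comm]
    refine Finset.sum_congr rfl fun i _ => Finset.sum_congr rfl fun j _ => ?_
    rw [hEM, h11, smul_mul_assoc, smul_mul_assoc, mul_assoc, hca, sectorSign_comm,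
      (isEven_ev (v 1 j)).comm]
    rfl
  have t01 : ∑ i, ∑ j, E (0, i) (1, j) * (v 0 i : Gr (4 + N)) * conj (v 1 j : Gr (4 + N)) = C := by
    rw [hC, hP.sum_couplingTerm_boson hb]
    refine Finset.sum_congr rfl fun i _ => Finset.sum_congr rfl fun j _ => ?_
    rw [hEM, h01, smul_mul_assoc, smul_mul_assoc, mul_assoc]
    rfl
  have t10 : ∑ i, ∑ j, E (1, i) (0, j) * (v 1 i : Gr (4 + N)) * conj (v 0 j : Gr (4 + N)) =
      conj C := by
    rw [← t01, conj_sum, Finset.sum_comm]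
    refine Finset.sum_congr rfl fun i _ => ?_
    rw [conj_sum]
    refine Finset.sum_congr rfl fun j _ => ?_
    have hs : starRingEnd ℂ (sectorSign i j) = sectorSign i j := by
      rcases i with i | i <;> rcases j with j | j <;> simp [sectorSign]
    rw [hEM, hEM, h10, h01, smul_mul_assoc, smul_mul_assoc, smul_mul_assoc, smul_mul_assoc,
      conj_smul, hs, mul_assoc, Gr.conj_mul, Gr.conj_mul, conj_conj, sectorSign_comm]
    rw [← mul_assoc (v 1 j : Gr (4 + N))]
    exact congrArg _ (((isEven_ev (v 1 j)).mul (isEven_ev (conjEv (v 0 i)))).comm _).symm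
  have split : ∀ f : Fin 2 × Flav n m → Fin 2 × Flav n m → Gr (4 + N),
      ∑ M, ∑ M', f M M' = ∑ i, ∑ j, f (0, i) (0, j) + ∑ i, ∑ j, f (0, i) (1, j) +
        (∑ i, ∑ j, f (1, i) (0, j) + ∑ i, ∑ j, f (1, i) (1, j)) := fun f => by
    simp only [Fintype.sum_prod_type, Fin.sum_univ_two, Finset.sum_add_distrib]
    abel
  rw [split, t00, t01, t10, t11, hP.kineticFirst_boson hb]
  simp only [mul_add, smul_add, Finset.sum_add_distrib]
  abel

end Potentials.Regular

end BosonicLagrangian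

end

end BiHKT

/-! ### The theorem, assembled with `lagrFirstHKT` and `lagrFirst` as the first-order Lagrangians.
-/

open BiHKT in
theorem theorem2 (N n m : ℕ) (P : Potentials n m) (hP : P.Regular) :
    -- the bi-HKT metric does not depend on the coordinates `ξ`, `σ`
    (∀ (M M' : Fin 2 × Flav n m) (x y : Fin 2 × Flav n m → ℂ),
      (fun i => x (0, i)) ∈ P.Ω → (∀ i, x (0, i) = y (0, i)) →
        metricHKT P.prepotential M M' x = metricHKT P.prepotential M M' y) ∧
    -- the superfields of the reduced model are chiral and twisted chiral
    (∀ Q ∈ P.trajK N,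
      (∀ a : Fin n, DThetaBar (superK Q (.inl a)) = 0 ∧ DEtaBar (superK Q (.inl a)) = 0) ∧
      (∀ α : Fin m, DThetaBar (superK Q (.inr α)) = 0 ∧ DEta (superK Q (.inr α)) = 0)) ∧
    -- up to a total derivative, the bi-HKT Lagrangian is the bi-Kähler one, in which the time
    -- derivatives of `ξ`, `σ` stand for the auxiliary fields
    EquivLagr (P.trajHKT N) (lagrHKT P.prepotential) (fun F => lagrK P (reduceTraj F)) ∧
    -- Hamiltonian reduction, for first-order forms of the two Lagrangians
    ∃ (ℓ : HKTConf N n m → HKTConf N n m → Gr (4 + N))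
      (ℓK : KConf N n m → KAux N n m → KConf N n m → Gr (4 + N)),
      EquivLagr (P.trajHKT N) (lagrHKT P.prepotential) (fun F t => ℓ (F t) (deriv F t)) ∧
      EquivLagr (P.trajK N) (lagrK P) (fun Q t => ℓK (Q t).1 (Q t).2 (deriv Q t).1) ∧
      (∀ x, P.InDomain (x.1 0) → ContDiff ℝ ∞ (ℓ x)) ∧
      (∀ x', P.InDomain x'.1 →
        ContDiff ℝ ∞ (fun p : KAux N n m × KConf N n m => ℓK x' p.1 p.2)) ∧
      -- the bosonic part of the bi-HKT Lagrangian is given by the metric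
      (∀ b v : Fin 2 → Flav n m → Ev N, P.InDomain (b 0) →
        ℓ (b, 0) (v, 0) = ∑ M, ∑ M',
          superEval (metricHKT P.prepotential M M') (fun j => (b j.1 j.2 : Gr (4 + N))) *
            (v M.1 M.2 : Gr (4 + N)) * Gr.conj (v M'.1 M'.2 : Gr (4 + N))) ∧
      -- `ξ`, `σ` enter only through their time derivatives
      (∀ x y v, P.InDomain (x.1 0) → reduceConf x = reduceConf y → ℓ x v = ℓ y v) ∧
      (∀ x v, P.InDomain (x.1 0) →
        ℓ x v = ℓK (reduceConf x) (reducedCoord v) (reduceConf v)) ∧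
      -- setting the momenta of `ξ`, `σ` to zero gives the Hamiltonian of the bi-Kähler model
      (∀ (x' : KConf N n m) (p' : KConf N n m → Gr (4 + N)) (E : Gr (4 + N)), P.InDomain x'.1 →
        (ReducedHamiltonianAt reduceConf ℓ x' p' E ↔ AuxHamiltonianAt ℓK x' p' E)) := by
  exact ⟨hP.metricHKT_congr,
    fun Q hQ => ⟨fun a => ⟨DThetaBar_superK hQ.1 _, DEtaBar_superK_inl hQ.1 a⟩,
      fun α => ⟨DThetaBar_superK hQ.1 _, DEta_superK_inr hQ.1 α⟩⟩,
    hP.equivLagr_lagrK, P.lagrFirstHKT, P.lagrFirst, hP.equivLagr_lagrFirstHKT,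
    hP.equivLagr_lagrFirst, hP.contDiff_lagrFirstHKT, hP.contDiff_lagrFirst,
    hP.lagrFirstHKT_boson, fun x y v _ h => by simp only [Potentials.lagrFirstHKT, h],
    fun x v _ => rfl, hP.reducedHamiltonianAt_iff⟩
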